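/- **Theorem 2 (Sobolev-like inequalities).** Let $p:\mathbb R^n\to[1,\infty]$ be a measurable function, put $p^-=\operatorname{ess\,inf}p$, $p^+=\operatorname{ess\,sup}p$, and assume that $1<p^-\le p^+<+\infty$ and that $p$ belongs to the class $\mathcal P^{\log}(\mathbb R^n)$: the limit $\frac1{p_\infty}=\lim_{|x|\to\infty}\frac1{p(x)}$ exists and, for some constant $c$ and all $x,y\in\mathbb R^n$, $$\Big|\frac1{p(x)}-\frac1{p(y)}\Big|\le\frac{c}{\log(e+1/|x-y|)}\quad\text{and}\quad \Big|\frac1{p(x)}-\frac1{p_\infty}\Big|\le\frac{c}{\log(e+|x|)} .$$ Let $0<s<n/p^+$, $\beta>0$ and $0\le s_1<s$, and set $\theta=\frac{s-s_1}{\beta+s}$ and $q(\cdot)=\frac{p(\cdot)}{1-\theta}$. Then $\theta<1$, and there is a constant $C$ (which does not depend on $f$) such that every tempered distribution $f$ on $\mathbb R^n$ (in particular every measurable function that is one) with $f\in\dot W^{s,p(\cdot)}(\mathbb R^n)$ and $f\in\dot B^{-\beta,\infty}_\infty(\mathbb R^n)$ satisfies $f\in\dot W^{s_1,q(\cdot)}(\mathbb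 R^n)$ and $$\|f\|_{\dot W^{s_1,q(\cdot)}(\mathbb R^n)}\le C\,\|f\|_{\dot W^{s,p(\cdot)}(\mathbb R^n)}^{1-\theta}\,\|f\|_{\dot B^{-\beta,\infty}_\infty(\mathbb R^n)}^{\theta}.$$ Here $\|g\|_{L^{p(\cdot)}}=\inf\{\lambda>0:\int_{\mathbb R^n}|g(x)/\lambda|^{p(x)}\,dx\le1\}$ is the Luxemburg norm. The tempered distribution $(-\Delta)^{\sigma/2}f$ has the Fourier transform $|\xi|^\sigma\widehat f(\xi)$, where the product is understood as the limit in $\mathcal S'(\mathbb R^n)$ of $(\varepsilon^2+|\xi|^2)^{\sigma/2}\widehat f$ as $\varepsilon\to0^+$ (so $(-\Delta)^{0}f=f$). We set $\|f\|_{\dot W^{\sigma,r(\cdot)}}=\|(-\Delta)^{\sigma/2}f\|_{L^{r(\cdot)}}$, which is $\infty$ if the limit does not exist or is not a function, and $\dot W^{\sigma,r(\cdot)}(\mathbb R^n)$ is the set of tempered distributions with finite norm that lie in the closure, with respect to this norm, of the smooth functions with finite norm. Finally, with $h_t(x)=(4\pi t)^{-n/2}e^{-|x|^2/(4t)}$,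 $\|f\|_{\dot B^{-\beta,\infty}_\infty}=\sup_{t>0}t^{\beta/2}\|h_t*f\|_{L^\infty(\mathbb R^n)}$, and $\dot B^{-\beta,\infty}_\infty(\mathbb R^n)$ is the set of tempered distributions for which this is finite. -/

import Mathlib

open MeasureTheory Filter Topology FourierTransform
open scoped SchwartzMap ENNReal ContDiff

noncomputable section

namespace VarSobolev

/-- Euclidean space `ℝⁿ`. -/
abbrev Rn (n : ℕ) := EuclideanSpace ℝ (Fin n)

variable {n : ℕ}

/-! ### Variable exponents and variable Lebesgue spaces -/

/-- The class `𝒫(ℝⁿ)` of measurable exponents with values in `[1, ∞]`. -/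
def IsExponent (p : Rn n → ℝ≥0∞) : Prop :=
  Measurable p ∧ ∀ x, 1 ≤ p x

/-- `p⁻`, the essential infimum of `p`. -/
def expMinus (p : Rn n → ℝ≥0∞) : ℝ≥0∞ := essInf p volume

/-- `p⁺`, the essential supremum of `p`. -/
def expPlus (p : Rn n → ℝ≥0∞) : ℝ≥0∞ := essSup p volume

/-- The real number `1 / p(x)`, with `1 / ∞ = 0`. -/
def recip (p : Rn n → ℝ≥0∞) (x : Rn n) : ℝ := ((p x)⁻¹).toReal

/-- The class `𝒫^log(ℝⁿ)`: `1/p` is locally log-Hölder continuous, has a limit `1/p_∞` at infinity,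
and satisfies the log-Hölder decay condition there. -/
def IsLogHolder (p : Rn n → ℝ≥0∞) : Prop :=
  IsExponent p ∧
  (∃ C : ℝ, ∀ x y, |recip p x - recip p y| ≤ C / Real.log (Real.exp 1 + 1 / ‖x - y‖)) ∧
  (∃ l : ℝ, Tendsto (recip p) (cocompact (Rn n)) (𝓝 l) ∧
    ∃ C : ℝ, ∀ x, |recip p x - l| ≤ C / Real.log (Real.exp 1 + ‖x‖))

/-- The modular `ϱ_{p(·)}(g) = ∫ |g(x)|^{p(x)} dx` (used for almost everywhere finite `p`). -/
def modular (p : Rn n → ℝ≥0∞) (g : Rn n → ℂ) : ℝ≥0∞ :=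
  ∫⁻ x, ‖g x‖ₑ ^ (p x).toReal

/-- The Luxemburg norm `inf {r > 0 : ϱ_{p(·)}(g / r) ≤ 1}`, equal to `∞` if there is no such `r`. -/
def luxNorm (p : Rn n → ℝ≥0∞) (g : Rn n → ℂ) : ℝ≥0∞ :=
  ⨅ (r : ℝ) (_ : 0 < r) (_ : modular p (fun x ↦ g x / (r : ℂ)) ≤ 1), ENNReal.ofReal r

/-! ### Fractional powers of the Laplacian on tempered distributions -/

/-- The tempered distribution `T` is given by integration against the function `g`. -/
def Represents (T : 𝓢'(Rn n, ℂ)) (g : Rn n → ℂ) : Prop :=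
  AEStronglyMeasurable g volume ∧
  ∀ φ : 𝓢(Rn n, ℂ), Integrable (fun x ↦ φ x * g x) volume ∧ T φ = ∫ x, φ x * g x

/-- The function `ξ ↦ (ε² + |2πξ|²)^{s/2}`: for `ε > 0` a smooth function of temperate growth, which
converges to `|2πξ|^s`, the symbol of `(-Δ)^{s/2}`, as `ε → 0` (the factor `2π` comes from the
normalization `∫ exp (-2πi x·ξ) f(x) dx` of the Fourier transform). -/
def regSymbol (s ε : ℝ) (ξ : Rn n) : ℂ :=
  (((ε ^ 2 + (2 * Real.pi * ‖ξ‖) ^ 2) ^ (s / 2) : ℝ) : ℂ)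

/-- So multiplication of tempered distributions by `regSymbol s ε` is the honest one. -/
theorem regSymbol_hasTemperateGrowth (s : ℝ) {ε : ℝ} (hε : 0 < ε) :
    (regSymbol (n := n) s ε).HasTemperateGrowth := by
  have h1 : (fun ξ : Rn n ↦ (1 + ‖((2 * Real.pi / ε) • ContinuousLinearMap.id ℝ (Rn n)) ξ‖ ^ 2) ^
      (s / 2)).HasTemperateGrowth :=
    (Function.hasTemperateGrowth_one_add_norm_sq_rpow (Rn n) (s / 2)).comp
      (ContinuousLinearMap.hasTemperateGrowth _)
  have h2 : (fun ξ : Rn n ↦ (((ε ^ 2) ^ (s / 2) *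
      (1 + ‖((2 * Real.pi / ε) • ContinuousLinearMap.id ℝ (Rn n)) ξ‖ ^ 2) ^ (s / 2) : ℝ) :
        ℂ)).HasTemperateGrowth :=
    Function.HasTemperateGrowth.comp Function.Complex.hasTemperateGrowth_ofReal
      ((Function.HasTemperateGrowth.const ((ε ^ 2) ^ (s / 2))).mul h1)
  convert h2 using 1
  funext ξ
  have : ‖((2 * Real.pi / ε) • ContinuousLinearMap.id ℝ (Rn n)) ξ‖ = 2 * Real.pi * ‖ξ‖ / ε := by
    simp only [_root_.smul_apply, ContinuousLinearMap.id_apply, norm_smul,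
      Real.norm_eq_abs]
    rw [abs_of_pos (by positivity)]
    ring
  rw [this, ← Real.mul_rpow (by positivity) (by positivity)]
  unfold regSymbol
  congr 3
  field_simp

/-- `U = (-Δ)^{s/2} T`, that is `Û = |2πξ|^s T̂`. As `|2πξ|^s` is not smooth at the origin, the
product is the limit in `𝓢'` of the products of `T̂` with the smooth functions
`(ε² + |2πξ|²)^{s/2}`, `ε → 0⁺`. -/
def IsFracLaplacian (s : ℝ) (T U : 𝓢'(Rn n, ℂ)) : Prop :=
  Tendsto (fun ε : ℝ ↦ TemperedDistribution.smulLeftCLM ℂ (regSymbol s ε) (𝓕 T)) (𝓝[>] 0)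
    (𝓝 (𝓕 U))

/-! ### Homogeneous Sobolev spaces of variable exponent -/

/-- `‖T‖_{Ẇ^{s,p(·)}} = ‖(-Δ)^{s/2} T‖_{L^{p(·)}}`, which is `∞` if `(-Δ)^{s/2} T` is not (given by)
a function. The function `g` below is unique almost everywhere if it exists, so that the infimum
just selects the norm of `g`. -/
def sobolevNorm (s : ℝ) (p : Rn n → ℝ≥0∞) (T : 𝓢'(Rn n, ℂ)) : ℝ≥0∞ :=
  ⨅ (g : Rn n → ℂ) (_ : ∃ U, IsFracLaplacian s T U ∧ Represents U g), luxNorm p g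

/-- `T` is given by a smooth function. -/
def IsSmooth (T : 𝓢'(Rn n, ℂ)) : Prop :=
  ∃ ψ : Rn n → ℂ, ContDiff ℝ ∞ ψ ∧ Represents T ψ

/-- `T ∈ Ẇ^{s,p(·)}(ℝⁿ)`: the tempered distribution `T` has a finite norm, and it belongs to the
closure of the smooth functions with finite norm with respect to that norm. -/
def MemSobolev (s : ℝ) (p : Rn n → ℝ≥0∞) (T : 𝓢'(Rn n, ℂ)) : Prop :=
  sobolevNorm s p T < ⊤ ∧
  ∀ δ : ℝ≥0∞, 0 < δ → ∃ S : 𝓢'(Rn n, ℂ), IsSmooth S ∧ sobolevNorm s p S < ⊤ ∧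
    sobolevNorm s p (T - S) < δ

/-! ### The heat kernel and Besov spaces of negative order -/

theorem gaussian_decay {a : ℝ} (ha : 0 < a) (N : ℕ) :
    ∃ C : ℝ, ∀ r : ℝ, 0 ≤ r → (1 + r) ^ N * Real.exp (-a * r ^ 2) ≤ C := by
  refine ⟨N.factorial * (2 / a) ^ N * Real.exp a, fun r hr ↦ ?_⟩
  have h1 : (1 + r) ^ N ≤ ((1 + r) ^ 2) ^ N := by
    gcongr
    nlinarith
  have h2 := Real.pow_div_factorial_le_exp (a / 2 * (1 + r) ^ 2) (by positivity) N
  have h3 : ((1 + r) ^ 2) ^ N ≤ N.factorial * (2 / a) ^ N * Real.exp (a / 2 * (1 + r) ^ 2) := by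
    rw [div_le_iff₀ (by positivity)] at h2
    calc ((1 + r) ^ 2) ^ N = (2 / a) ^ N * (a / 2 * (1 + r) ^ 2) ^ N := by
          rw [← mul_pow]
          congr 1
          field_simp
      _ ≤ (2 / a) ^ N * (Real.exp (a / 2 * (1 + r) ^ 2) * N.factorial) := by gcongr
      _ = _ := by ring
  calc (1 + r) ^ N * Real.exp (-a * r ^ 2)
      ≤ N.factorial * (2 / a) ^ N * Real.exp (a / 2 * (1 + r) ^ 2) * Real.exp (-a * r ^ 2) := by
        gcongr
        exact h1.trans h3
    _ = N.factorial * (2 / a) ^ N * Real.exp (a / 2 * (1 + r) ^ 2 + -a * r ^ 2) := by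
        rw [Real.exp_add]
        ring
    _ ≤ N.factorial * (2 / a) ^ N * Real.exp a := by
        gcongr
        nlinarith [mul_nonneg ha.le (sq_nonneg (1 - r))]

/-- The Schwartz function `y ↦ exp (-a|y|²)` with real values, for `a > 0`. -/
def gaussianFun {a : ℝ} (ha : 0 < a) : 𝓢(Rn n, ℝ) where
  toFun y := Real.exp (-a * ‖y‖ ^ 2)
  smooth' := Real.contDiff_exp.comp (contDiff_const.mul (contDiff_norm_sq ℝ))
  decay' := by
    intro k m
    have hf : (fun y : Rn n ↦ -a * ‖y‖ ^ 2).HasTemperateGrowth :=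
      (Function.HasTemperateGrowth.const (-a)).mul (Function.hasTemperateGrowth_norm_sq (Rn n))
    obtain ⟨j, K, hK, hbound⟩ := hf.norm_iteratedFDeriv_le_uniform m
    obtain ⟨C, hC⟩ := gaussian_decay ha (k + j * m)
    refine ⟨m.factorial * (max 1 K) ^ m * C, fun y ↦ ?_⟩
    have key : ‖iteratedFDeriv ℝ m (Real.exp ∘ fun y : Rn n ↦ -a * ‖y‖ ^ 2) y‖ ≤
        m.factorial * Real.exp (-a * ‖y‖ ^ 2) * (max 1 K * (1 + ‖y‖) ^ j) ^ m := by
      refine norm_iteratedFDeriv_comp_le (N := ∞) Real.contDiff_exp hf.1 (mod_cast le_top) y ?_ ?_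
      · intro i _
        rw [norm_iteratedFDeriv_eq_norm_iteratedDeriv, iteratedDeriv_eq_iterate,
          Real.iter_deriv_exp, Real.norm_eq_abs, Real.abs_exp]
      · intro i hi1 him
        have h1 : 1 ≤ max 1 K * (1 + ‖y‖) ^ j :=
          one_le_mul_of_one_le_of_one_le (le_max_left _ _)
            (one_le_pow₀ (by linarith [norm_nonneg y]))
        calc _ ≤ K * (1 + ‖y‖) ^ j := hbound i him y
          _ ≤ max 1 K * (1 + ‖y‖) ^ j := by
              gcongr
              exact le_max_right _ _
          _ ≤ _ := le_self_pow₀ h1 (by omega)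
    calc ‖y‖ ^ k * ‖iteratedFDeriv ℝ m (fun y : Rn n ↦ Real.exp (-a * ‖y‖ ^ 2)) y‖
        ≤ (1 + ‖y‖) ^ k *
          (m.factorial * Real.exp (-a * ‖y‖ ^ 2) * (max 1 K * (1 + ‖y‖) ^ j) ^ m) := by
          gcongr
          · linarith
          · exact key
      _ = m.factorial * (max 1 K) ^ m * ((1 + ‖y‖) ^ (k + j * m) * Real.exp (-a * ‖y‖ ^ 2)) := by
          rw [mul_pow, ← pow_mul, pow_add]
          ring
      _ ≤ m.factorial * (max 1 K) ^ m * C := by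
          gcongr
          exact hC _ (norm_nonneg y)

/-- The heat kernel centred at `x`, `y ↦ h_t(x - y) = (4πt)^{-n/2} exp (-|x - y|² / (4t))`, as a
Schwartz function. -/
def heatKernel {t : ℝ} (ht : 0 < t) (x : Rn n) : 𝓢(Rn n, ℂ) :=
  SchwartzMap.postcompCLM (𝕜 := ℝ) Complex.ofRealCLM
    (SchwartzMap.compSubConstCLM ℝ x
      ((4 * Real.pi * t) ^ (-(n : ℝ) / 2) • gaussianFun (inv_pos.2 (mul_pos four_pos ht))))

theorem heatKernel_apply {t : ℝ} (ht : 0 < t) (x y : Rn n) :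
    heatKernel ht x y =
      (((4 * Real.pi * t) ^ (-(n : ℝ) / 2) * Real.exp (-‖x - y‖ ^ 2 / (4 * t)) : ℝ) : ℂ) := by
  have h : -(4 * t)⁻¹ * ‖y - x‖ ^ 2 = -‖x - y‖ ^ 2 / (4 * t) := by
    rw [norm_sub_rev y x]
    ring
  rw [← h]
  rfl

/-- The thermic norm `‖T‖_{Ḃ^{-β,∞}_∞} = sup_{t > 0} t^{β/2} ‖h_t * T‖_{L^∞}`, where
`(h_t * T)(x) = T(h_t(x - ·))`, which is a continuous function of `x`. -/
def besovNorm (β : ℝ) (T : 𝓢'(Rn n, ℂ)) : ℝ≥0∞ :=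
  ⨆ (t : ℝ) (ht : 0 < t) (x : Rn n), ENNReal.ofReal (t ^ (β / 2)) * ‖T (heatKernel ht x)‖ₑ

/-- `T ∈ Ḃ^{-β,∞}_∞(ℝⁿ)`. -/
def MemBesov (β : ℝ) (T : 𝓢'(Rn n, ℂ)) : Prop := besovNorm β T < ⊤

end VarSobolev

end

/-!
The inequality is an interpolation along the heat flow. Let `U = (-Δ)^{s/2} T`, given by the
function `g`, and put `a = (s - s₁)/2`, `e = (s + β)/2`, so that `θ = a/e`. Then
`(-Δ)^{s₁/2} T = (-Δ)^{-a} U` is the function `Γ(a)⁻¹ ∫₀^∞ t^{a-1} e^{tΔ} U dt`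
(`rieszPotential`), and the integrand has two bounds.

* `|e^{tΔ} U| ≤ C Mg`, where `M` is the Hardy-Littlewood maximal operator
  (`exists_lintegral_heatKernel_le`, `enorm_heatFlow_le_of_represents`). It is used for short times.
* `|e^{tΔ} U| ≤ C K t^{-e}`, where `K` bounds the Besov norm of `T`
  (`exists_hasHeatBound_of_isSymbolLimit`). It is used for long times.

Splitting the integral at the best time gives `|(-Δ)^{s₁/2} T| ≤ C (Mg)^{1-θ} K^θ` pointwise
(`lintegral_rpow_mul_min_le`, `enorm_rieszPotential_le`). As `q = p/(1-θ)`, the estimate of the norm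
follows from the boundedness of `M` on `L^{p(·)}`. This is where log-Hölder continuity and `p⁻ > 1`
are needed: writing `p = p⁻ r`, one has `(Mf)^r ≤ C M(f^r)` up to a function in `L^{p⁻}`, and `M` is
bounded on `L^{p⁻}` (`IsLogHolderFn.exists_lintegral_maximalFn_rpow_le`). There `M` is the maximal
operator over the closed balls of radius `2^j`, which suffices to dominate the heat kernel.

Since fractional powers of the Laplacian are limits of regularized symbols in `𝓢'`, the formula for
`(-Δ)^{s₁/2} T` is proved on the Fourier side. For `ε > 0`,
`(ε² + λ)^{-a} = Γ(a)⁻¹ ∫₀^∞ t^{a-1} exp (-t(ε² + λ)) dt` with `λ = |2πξ|²`, and a tempered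
distribution commutes with integrals of families of Schwartz functions whose seminorms grow
polynomially in the parameter (`IsSmoothFamily.distribution_integral`): a distribution of finite
order extends by Hahn-Banach to a Banach space of bounded functions, in which the Bochner integral is
available. The limit `ε → 0` is taken by dominated convergence (`tendsto_Rg_of_isSymbolLimit`), for
which the long time bound has to be uniform in `ε` (`exists_norm_Rg_Ht_le`). It is obtained by
composing with an integer power of `ε² + λ`, for which the Fourier transform of
`(ε² + λ)^k exp (-t(ε² + λ))` has an `L¹` norm of order `t^{-k}`, and a negative fractional power.

Finally, `(-Δ)^{s₁/2} T` has to be approximated by smooth functions. The functions `e^{δΔ} T` are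
smooth (`isSmooth_heatDistribution`), they satisfy the same pointwise bound uniformly in `δ`, and
`(-Δ)^{s₁/2} e^{δΔ} T` tends to `(-Δ)^{s₁/2} T` almost everywhere as `δ → 0`
(`tendsto_rieszPotential`), so that the norms of the differences tend to zero by
dominated convergence (`tendsto_modular_div`).
-/

open MeasureTheory Filter Topology FourierTransform
open scoped SchwartzMap ENNReal ContDiff

noncomputable section

namespace VarSobolev

/-! ### Smooth families of Schwartz functions -/

section Families

variable {Y E : Type*} [NormedAddCommGroup Y] [NormedSpace ℝ Y]
  [NormedAddCommGroup E] [NormedSpace ℝ E]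

theorem norm_iteratedFDeriv_cexp_le (i : ℕ) (z : ℂ) :
    ‖iteratedFDeriv ℝ i Complex.exp z‖ ≤ ‖Complex.exp z‖ := by
  induction i with
  | zero => simp
  | succ i ih =>
    have h : fderiv ℝ Complex.exp = (ContinuousLinearMap.mul ℝ ℂ) ∘ Complex.exp := by
      funext w
      have h1 : HasFDerivAt Complex.exp (Complex.exp w • (1 : ℂ →L[ℝ] ℂ)) w :=
        (Complex.hasStrictDerivAt_exp w).complexToReal_fderiv.hasFDerivAt
      rw [h1.fderiv]
      ext1 v
      simp
    rw [← norm_iteratedFDeriv_fderiv, h]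
    have hexp : ContDiff ℝ i Complex.exp := Complex.contDiff_exp
    refine ((ContinuousLinearMap.mul ℝ ℂ).norm_iteratedFDeriv_comp_left hexp.contDiffAt
      le_rfl).trans ?_
    calc _ ≤ 1 * ‖Complex.exp z‖ := by
          gcongr
          exact ContinuousLinearMap.opNorm_mul_le ℝ ℂ
      _ = _ := one_mul _

/-- The derivatives of `P exp(q)` are polynomially bounded where `Re q ≤ 0`. -/
theorem exists_norm_iteratedFDeriv_mul_cexp_le {P q : E → ℂ} (hP : P.HasTemperateGrowth)
    (hq : q.HasTemperateGrowth) (n : ℕ) :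
    ∃ (N : ℕ) (C : ℝ), 0 ≤ C ∧ ∀ i ≤ n, ∀ z, (q z).re ≤ 0 →
      ‖iteratedFDeriv ℝ i (fun z ↦ P z * Complex.exp (q z)) z‖ ≤ C * (1 + ‖z‖) ^ N := by
  obtain ⟨a, A, hA, hPA⟩ := hP.norm_iteratedFDeriv_le_uniform n
  obtain ⟨b, B, hB, hqB⟩ := hq.norm_iteratedFDeriv_le_uniform n
  refine ⟨a + b * n, 2 ^ n * A * (n.factorial * (max 1 B) ^ n), by positivity,
    fun i hi z hz ↦ ?_⟩
  have h1z : 1 ≤ 1 + ‖z‖ := by linarith [norm_nonneg z]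
  have hexp : ∀ j ≤ n, ‖iteratedFDeriv ℝ j (Complex.exp ∘ q) z‖ ≤
      n.factorial * (max 1 B) ^ n * (1 + ‖z‖) ^ (b * n) := by
    intro j hj
    have h1 : 1 ≤ max 1 B * (1 + ‖z‖) ^ b :=
      one_le_mul_of_one_le_of_one_le (le_max_left _ _) (one_le_pow₀ h1z)
    have := norm_iteratedFDeriv_comp_le (n := j) (N := ∞) (g := Complex.exp) (C := 1)
      (D := max 1 B * (1 + ‖z‖) ^ b)
      Complex.contDiff_exp hq.1 (mod_cast le_top) z
      (fun i _ ↦ (norm_iteratedFDeriv_cexp_le i _).trans (by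
        rw [Complex.norm_exp]; exact Real.exp_le_one_iff.2 hz))
      (fun i hi1 hij ↦ by
        calc _ ≤ B * (1 + ‖z‖) ^ b := hqB i (hij.trans hj) z
          _ ≤ max 1 B * (1 + ‖z‖) ^ b := by
            gcongr
            exact le_max_right _ _
          _ ≤ _ := le_self_pow₀ h1 (by omega))
    calc _ ≤ j.factorial * 1 * (max 1 B * (1 + ‖z‖) ^ b) ^ j := this
      _ ≤ n.factorial * 1 * (max 1 B * (1 + ‖z‖) ^ b) ^ n := by
        gcongr
      _ = _ := by rw [mul_pow, ← pow_mul]; ring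
  have hmul := norm_iteratedFDeriv_mul_le (n := i) (N := ∞) (f := P) (g := Complex.exp ∘ q)
    hP.1 (Complex.contDiff_exp.comp hq.1) z (mod_cast le_top)
  calc _ ≤ _ := hmul
    _ ≤ ∑ j ∈ Finset.range (i + 1), (i.choose j : ℝ) * (A * (1 + ‖z‖) ^ a) *
        (n.factorial * (max 1 B) ^ n * (1 + ‖z‖) ^ (b * n)) := by
      gcongr with j hj
      · exact hPA j (by have := Finset.mem_range.1 hj; omega) z
      · exact hexp _ (by omega)
    _ = 2 ^ i * A * (n.factorial * (max 1 B) ^ n) * (1 + ‖z‖) ^ (a + b * n) := by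
      rw [← Finset.sum_mul, ← Finset.sum_mul, ← Nat.cast_sum, Nat.sum_range_choose, pow_add]
      push_cast
      ring
    _ ≤ _ := by
      gcongr
      norm_num

theorem iteratedFDeriv_slice {F : Type*} [NormedAddCommGroup F] [NormedSpace ℝ F]
    {f : Y × E → F} (hf : ContDiff ℝ ∞ f) (l : ℕ) (y : Y) (ξ : E) :
    iteratedFDeriv ℝ l (fun ξ ↦ f (y, ξ)) ξ =
      (iteratedFDeriv ℝ l f (y, ξ)).compContinuousLinearMap
        (fun _ ↦ ContinuousLinearMap.inr ℝ Y E) := by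
  have h1 : (fun ξ ↦ f (y, ξ)) = (fun z ↦ f ((y, 0) + z)) ∘ (ContinuousLinearMap.inr ℝ Y E) := by
    funext ξ
    simp
  have h2 : ContDiff ℝ ∞ (fun z : Y × E ↦ f ((y, 0) + z)) :=
    hf.comp (contDiff_const.add contDiff_id)
  rw [h1, ContinuousLinearMap.iteratedFDeriv_comp_right _ h2 _ (i := l) (mod_cast le_top),
    iteratedFDeriv_comp_add_left]
  simp

theorem norm_iteratedFDeriv_slice_le {F : Type*} [NormedAddCommGroup F] [NormedSpace ℝ F]
    {f : Y × E → F} (hf : ContDiff ℝ ∞ f) (l : ℕ) (y : Y) (ξ : E) :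
    ‖iteratedFDeriv ℝ l (fun ξ ↦ f (y, ξ)) ξ‖ ≤ ‖iteratedFDeriv ℝ l f (y, ξ)‖ := by
  rw [iteratedFDeriv_slice hf]
  refine (ContinuousMultilinearMap.norm_compContinuousLinearMap_le _ _).trans ?_
  refine mul_le_of_le_one_right (norm_nonneg _) ?_
  exact Finset.prod_le_one (fun _ _ ↦ norm_nonneg _)
    (fun _ _ ↦ ContinuousLinearMap.norm_inr_le_one ℝ Y E)

theorem continuous_iteratedFDeriv_slice {F : Type*} [NormedAddCommGroup F] [NormedSpace ℝ F]
    {f : Y × E → F} (hf : ContDiff ℝ ∞ f) (l : ℕ) :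
    Continuous (fun z : Y × E ↦ iteratedFDeriv ℝ l (fun ξ ↦ f (z.1, ξ)) z.2) := by
  simp_rw [iteratedFDeriv_slice hf]
  exact (ContinuousMultilinearMap.compContinuousLinearMapL (𝕜 := ℝ) (F := F)
    (fun _ : Fin l ↦ ContinuousLinearMap.inr ℝ Y E)).continuous.comp
    (hf.continuous_iteratedFDeriv (m := l) (mod_cast le_top))

/-- A family `(Φ y)` of Schwartz functions which depends smoothly on the parameter `y ∈ s`, jointly
with the space variable, and whose Schwartz seminorms grow at most polynomially in `y`. -/
structure IsSmoothFamily (s : Set Y) (Φ : Y → 𝓢(E, ℂ)) : Prop where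
  exists_contDiff : ∃ f : Y × E → ℂ, ContDiff ℝ ∞ f ∧ ∀ y ∈ s, ∀ ξ, Φ y ξ = f (y, ξ)
  exists_seminorm_le : ∀ k l : ℕ, ∃ (N : ℕ) (C : ℝ), 0 ≤ C ∧
    ∀ y ∈ s, SchwartzMap.seminorm ℝ k l (Φ y) ≤ C * (1 + ‖y‖) ^ N

theorem IsSmoothFamily.mono {s t : Set Y} {Φ : Y → 𝓢(E, ℂ)} (h : IsSmoothFamily s Φ)
    (hts : t ⊆ s) : IsSmoothFamily t Φ := by
  obtain ⟨⟨f, hf, hΦ⟩, h2⟩ := h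
  refine ⟨⟨f, hf, fun y hy ↦ hΦ y (hts hy)⟩, fun k l ↦ ?_⟩
  obtain ⟨N, C, hC, h⟩ := h2 k l
  exact ⟨N, C, hC, fun y hy ↦ h y (hts hy)⟩

theorem isSmoothFamily_mul_cexp {P q : Y × E → ℂ} (hP : P.HasTemperateGrowth)
    (hq : q.HasTemperateGrowth) (κ : 𝓢(E, ℂ)) {s : Set Y}
    (hs : ∀ y ∈ s, ∀ ξ, (q (y, ξ)).re ≤ 0) {Φ : Y → 𝓢(E, ℂ)}
    (hΦ : ∀ y ∈ s, ∀ ξ, Φ y ξ = P (y, ξ) * Complex.exp (q (y, ξ)) * κ ξ) :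
    IsSmoothFamily s Φ := by
  have hF : ContDiff ℝ ∞ (fun z : Y × E ↦ P z * Complex.exp (q z)) :=
    hP.1.mul (Complex.contDiff_exp.comp hq.1)
  refine ⟨⟨fun z ↦ P z * Complex.exp (q z) * κ z.2, hF.mul ((κ.smooth ⊤).comp contDiff_snd), hΦ⟩,
    fun k l ↦ ?_⟩
  obtain ⟨N, C, hC, hbd⟩ := exists_norm_iteratedFDeriv_mul_cexp_le hP hq l
  set S : ℝ := 2 ^ (k + N) *
    (Finset.Iic (k + N, l)).sup (fun m ↦ SchwartzMap.seminorm ℝ m.1 m.2) κ with hS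
  have hS0 : 0 ≤ S := by positivity
  refine ⟨N, 2 ^ l * C * S, by positivity, fun y hy ↦
    SchwartzMap.seminorm_le_bound ℝ k l _ (by positivity) fun ξ ↦ ?_⟩
  have hfun : (Φ y : E → ℂ) = fun ξ ↦ (P (y, ξ) * Complex.exp (q (y, ξ))) * κ ξ :=
    funext (hΦ y hy)
  have hFy : ContDiff ℝ ∞ (fun ξ ↦ P (y, ξ) * Complex.exp (q (y, ξ))) :=
    hF.comp (contDiff_const.prodMk contDiff_id)
  have h1ξ : 1 ≤ 1 + ‖ξ‖ := by linarith [norm_nonneg ξ]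
  have hz : 1 + ‖(y, ξ)‖ ≤ (1 + ‖y‖) * (1 + ‖ξ‖) := by
    have : ‖(y, ξ)‖ ≤ ‖y‖ + ‖ξ‖ := by
      rw [Prod.norm_def]
      exact max_le (by simp) (by simp)
    nlinarith [mul_nonneg (norm_nonneg y) (norm_nonneg ξ)]
  rw [hfun]
  have hmul := norm_iteratedFDeriv_mul_le (n := l) (N := ∞) hFy (κ.smooth ⊤) ξ (mod_cast le_top)
  calc _ ≤ ‖ξ‖ ^ k * ∑ j ∈ Finset.range (l + 1), (l.choose j : ℝ) *
        (C * ((1 + ‖y‖) * (1 + ‖ξ‖)) ^ N) * ‖iteratedFDeriv ℝ (l - j) κ ξ‖ := by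
        gcongr
        refine hmul.trans ?_
        gcongr with j hj
        refine (norm_iteratedFDeriv_slice_le hF j y ξ).trans ?_
        refine (hbd j (by have := Finset.mem_range.1 hj; omega) _ (hs y hy ξ)).trans ?_
        gcongr
    _ = ∑ j ∈ Finset.range (l + 1), (l.choose j : ℝ) * (C * (1 + ‖y‖) ^ N) *
          (‖ξ‖ ^ k * (1 + ‖ξ‖) ^ N * ‖iteratedFDeriv ℝ (l - j) κ ξ‖) := by
        rw [Finset.mul_sum]
        refine Finset.sum_congr rfl fun j _ ↦ ?_
        rw [mul_pow]
        ring
    _ ≤ ∑ j ∈ Finset.range (l + 1), (l.choose j : ℝ) * (C * (1 + ‖y‖) ^ N) * S := by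
        gcongr with j hj
        calc _ ≤ (1 + ‖ξ‖) ^ k * (1 + ‖ξ‖) ^ N * ‖iteratedFDeriv ℝ (l - j) κ ξ‖ := by
              gcongr
              linarith
          _ = (1 + ‖ξ‖) ^ (k + N) * ‖iteratedFDeriv ℝ (l - j) κ ξ‖ := by rw [pow_add]
          _ ≤ S := SchwartzMap.one_add_le_sup_seminorm_apply (𝕜 := ℝ) (m := (k + N, l)) le_rfl
              (by simp) κ ξ
    _ = _ := by
        rw [← Finset.sum_mul, ← Finset.sum_mul, ← Nat.cast_sum, Nat.sum_range_choose]
        push_cast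
        ring

theorem IsSmoothFamily.continuousOn [ProperSpace E] {s : Set Y} {Φ : Y → 𝓢(E, ℂ)}
    (h : IsSmoothFamily s Φ) : ContinuousOn Φ s := by
  obtain ⟨⟨f, hf, hΦ⟩, h2⟩ := h
  intro y₀ hy₀
  refine ((schwartz_withSeminorms ℝ E ℂ).tendsto_nhds Φ (Φ y₀)).2 ?_
  rintro ⟨k, l⟩ ε hε
  obtain ⟨N, C, hC, hb⟩ := h2 (k + 1) l
  set K : ℝ := C * (1 + (‖y₀‖ + 1)) ^ N with hK
  have hK0 : 0 ≤ K := by positivity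
  set R : ℝ := max 1 (4 * K / ε) with hR
  have hR1 : 1 ≤ R := le_max_left _ _
  have hnear : ∀ᶠ y in 𝓝 y₀, ‖y‖ ≤ ‖y₀‖ + 1 :=
    (continuous_norm.tendsto y₀).eventually_le_const (by linarith)
  -- inside the ball of radius `R`, joint continuity of the derivatives and compactness
  have hcomp : ∀ᶠ y in 𝓝 y₀, ∀ ξ ∈ Metric.closedBall (0 : E) R,
      ‖iteratedFDeriv ℝ l (fun ξ ↦ f (y, ξ)) ξ - iteratedFDeriv ℝ l (fun ξ ↦ f (y₀, ξ)) ξ‖ <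
        ε / (2 * R ^ k) := by
    refine (isCompact_closedBall (0 : E) R).eventually_forall_of_forall_eventually fun ξ _ ↦ ?_
    have hc := continuous_iteratedFDeriv_slice hf l
    have hc2 : Continuous fun z : Y × E ↦ ‖iteratedFDeriv ℝ l (fun ξ ↦ f (z.1, ξ)) z.2 -
        iteratedFDeriv ℝ l (fun ξ ↦ f (y₀, ξ)) z.2‖ :=
      (hc.sub (hc.comp (continuous_const.prodMk continuous_snd))).norm
    refine (hc2.tendsto (y₀, ξ)).eventually_lt_const ?_
    simp only [sub_self, norm_zero]
    positivity
  filter_upwards [nhdsWithin_le_nhds hnear, nhdsWithin_le_nhds hcomp, self_mem_nhdsWithin]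
    with y hy1 hy2 hys
  have key : SchwartzMap.seminorm ℝ k l (Φ y - Φ y₀) ≤ ε / 2 := by
    refine SchwartzMap.seminorm_le_bound ℝ k l _ (by positivity) fun ξ ↦ ?_
    have hsub : iteratedFDeriv ℝ l (Φ y - Φ y₀ : 𝓢(E, ℂ)) ξ =
        iteratedFDeriv ℝ l (Φ y) ξ - iteratedFDeriv ℝ l (Φ y₀) ξ := by
      have : ((Φ y - Φ y₀ : 𝓢(E, ℂ)) : E → ℂ) = (Φ y : E → ℂ) - Φ y₀ := by ext; simp
      rw [this]
      exact congrFun (iteratedFDeriv_sub ((Φ y).smooth l) ((Φ y₀).smooth l)) ξ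
    rw [hsub]
    rcases le_or_gt ‖ξ‖ R with hξ | hξ
    · have e1 : (Φ y : E → ℂ) = fun ξ ↦ f (y, ξ) := funext (hΦ y hys)
      have e2 : (Φ y₀ : E → ℂ) = fun ξ ↦ f (y₀, ξ) := funext (hΦ y₀ hy₀)
      rw [e1, e2]
      calc _ ≤ R ^ k * (ε / (2 * R ^ k)) := by
            gcongr
            exact (hy2 ξ (by simpa using hξ)).le
        _ = ε / 2 := by field_simp
    · have hb' : ∀ y' ∈ s, ‖y'‖ ≤ ‖y₀‖ + 1 →
          ‖ξ‖ ^ (k + 1) * ‖iteratedFDeriv ℝ l (Φ y') ξ‖ ≤ K := by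
        intro y' hy' hn
        refine (SchwartzMap.le_seminorm ℝ (k + 1) l (Φ y') ξ).trans ((hb y' hy').trans ?_)
        rw [hK]
        gcongr
      have hA := hb' y hys hy1
      have hB := hb' y₀ hy₀ (by linarith)
      have hξ0 : 0 < ‖ξ‖ := by linarith
      have hRK : 4 * K ≤ ε * ‖ξ‖ := by
        have : 4 * K / ε ≤ ‖ξ‖ := (le_max_right _ _).trans hξ.le
        rw [div_le_iff₀ hε] at this
        linarith
      have h3 : ‖ξ‖ * (‖ξ‖ ^ k * ‖iteratedFDeriv ℝ l (Φ y) ξ - iteratedFDeriv ℝ l (Φ y₀) ξ‖) ≤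
          ‖ξ‖ * (ε / 2) := by
        calc _ = ‖ξ‖ ^ (k + 1) * ‖iteratedFDeriv ℝ l (Φ y) ξ - iteratedFDeriv ℝ l (Φ y₀) ξ‖ := by
              ring
          _ ≤ ‖ξ‖ ^ (k + 1) * (‖iteratedFDeriv ℝ l (Φ y) ξ‖ + ‖iteratedFDeriv ℝ l (Φ y₀) ξ‖) := by
              gcongr
              exact norm_sub_le _ _
          _ ≤ 2 * K := by rw [mul_add]; linarith
          _ ≤ _ := by linarith
      exact le_of_mul_le_mul_left h3 hξ0
  calc _ ≤ ε / 2 := key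
    _ < ε := by linarith

end Families

/-! ### Tempered distributions and integrals of families of Schwartz functions -/

section RapidWeight

variable {Y : Type*} [NormedAddCommGroup Y] [MeasurableSpace Y] [BorelSpace Y]
  [SecondCountableTopology Y]

/-- The weight `c` is integrable on `s` against all polynomials. -/
def IsRapidWeight (c : Y → ℂ) (s : Set Y) (μ : Measure Y) : Prop :=
  AEStronglyMeasurable c (μ.restrict s) ∧
    ∀ N : ℕ, IntegrableOn (fun y ↦ ‖c y‖ * (1 + ‖y‖) ^ N) s μ

theorem IsRapidWeight.integrableOn_smul {c : Y → ℂ} {s : Set Y} {μ : Measure Y}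
    (hc : IsRapidWeight c s μ) (hs : MeasurableSet s) {X : Type*} [NormedAddCommGroup X]
    [NormedSpace ℂ X] {u : Y → X} (hu : ContinuousOn u s) {N : ℕ} {C : ℝ}
    (hb : ∀ y ∈ s, ‖u y‖ ≤ C * (1 + ‖y‖) ^ N) :
    IntegrableOn (fun y ↦ c y • u y) s μ := by
  refine ((hc.2 N).const_mul C).mono' (hc.1.smul (hu.aestronglyMeasurable hs)) ?_
  refine (ae_restrict_iff' hs).2 (.of_forall fun y hy ↦ ?_)
  rw [norm_smul]
  calc _ ≤ ‖c y‖ * (C * (1 + ‖y‖) ^ N) := by gcongr; exact hb y hy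
    _ = _ := by ring

end RapidWeight

section Pettis

variable {Y E : Type*} [NormedAddCommGroup Y] [NormedSpace ℝ Y]
  [NormedAddCommGroup E] [NormedSpace ℝ E]

theorem IsSmoothFamily.exists_le_of_continuous {s : Set Y} {Φ : Y → 𝓢(E, ℂ)}
    (h : IsSmoothFamily s Φ) (p : Seminorm ℝ 𝓢(E, ℂ)) (hp : Continuous p) :
    ∃ (N : ℕ) (C : ℝ), 0 ≤ C ∧ ∀ y ∈ s, p (Φ y) ≤ C * (1 + ‖y‖) ^ N := by
  obtain ⟨S, K, -, hK⟩ := Seminorm.bound_of_continuous (schwartz_withSeminorms ℝ E ℂ) p hp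
  choose N C hC hb using h.exists_seminorm_le
  refine ⟨∑ i ∈ S, N i.1 i.2, K * ∑ i ∈ S, C i.1 i.2,
    mul_nonneg K.2 (Finset.sum_nonneg fun i _ ↦ hC _ _), fun y hy ↦ ?_⟩
  have h1y : 1 ≤ 1 + ‖y‖ := by linarith [norm_nonneg y]
  calc p (Φ y) ≤ (K • S.sup (schwartzSeminormFamily ℝ E ℂ)) (Φ y) := hK _
    _ = K * (S.sup (schwartzSeminormFamily ℝ E ℂ)) (Φ y) := rfl
    _ ≤ K * ((∑ i ∈ S, C i.1 i.2) * (1 + ‖y‖) ^ (∑ i ∈ S, N i.1 i.2)) := by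
        refine mul_le_mul_of_nonneg_left ?_ K.2
        refine Seminorm.finset_sup_apply_le
          (mul_nonneg (Finset.sum_nonneg fun i _ ↦ hC _ _) (by positivity)) fun i hi ↦ ?_
        refine (hb i.1 i.2 y hy).trans ?_
        gcongr
        · exact Finset.sum_nonneg fun i _ ↦ hC _ _
        · exact Finset.single_le_sum (f := fun i : ℕ × ℕ ↦ C i.1 i.2) (fun i _ ↦ hC _ _) hi
        · exact Finset.single_le_sum (f := fun i : ℕ × ℕ ↦ N i.1 i.2) (fun i _ ↦ Nat.zero_le _) hi
    _ = _ := by ring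

theorem IsSmoothFamily.exists_norm_clm_le {s : Set Y} {Φ : Y → 𝓢(E, ℂ)}
    (h : IsSmoothFamily s Φ) {X : Type*} [NormedAddCommGroup X] [NormedSpace ℂ X]
    (A : 𝓢(E, ℂ) →L[ℂ] X) :
    ∃ (N : ℕ) (C : ℝ), 0 ≤ C ∧ ∀ y ∈ s, ‖A (Φ y)‖ ≤ C * (1 + ‖y‖) ^ N :=
  h.exists_le_of_continuous ((normSeminorm ℝ X).comp (A.toLinearMap.restrictScalars ℝ))
    (continuous_norm.comp A.continuous)

open LineDeriv in
theorem IsSmoothFamily.lineDeriv {s : Set Y} {Φ : Y → 𝓢(E, ℂ)}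
    (h : IsSmoothFamily s Φ) (v : E) : IsSmoothFamily s (fun y ↦ ∂_{v} (Φ y)) := by
  obtain ⟨f, hf, hΦ⟩ := h.exists_contDiff
  refine ⟨⟨fun z ↦ fderiv ℝ f z (0, v), ?_, fun y hy ξ ↦ ?_⟩, fun k l ↦ ?_⟩
  · exact (hf.fderiv_right (m := ∞) le_rfl).clm_apply contDiff_const
  · rw [SchwartzMap.lineDerivOp_apply_eq_fderiv]
    have e : (Φ y : E → ℂ) = f ∘ fun ξ ↦ (y, ξ) := funext (hΦ y hy)
    have h1 : HasFDerivAt (fun ξ : E ↦ (y, ξ)) (ContinuousLinearMap.inr ℝ Y E) ξ :=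
      hasFDerivAt_prodMk_right y ξ
    have h2 : HasFDerivAt f (fderiv ℝ f (y, ξ)) (y, ξ) :=
      (hf.differentiable (by simp) _).hasFDerivAt
    rw [e, (h2.comp ξ h1).fderiv]
    simp
  · exact h.exists_le_of_continuous
      ((schwartzSeminormFamily ℝ E ℂ (k, l)).comp (lineDerivOpCLM ℝ 𝓢(E, ℂ) v).toLinearMap)
      (((schwartz_withSeminorms ℝ E ℂ).continuous_seminorm (k, l)).comp
        (lineDerivOpCLM ℝ 𝓢(E, ℂ) v).continuous)

theorem IsSmoothFamily.continuousOn_apply {s : Set Y} {Φ : Y → 𝓢(E, ℂ)}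
    (h : IsSmoothFamily s Φ) (ξ : E) : ContinuousOn (fun y ↦ Φ y ξ) s := by
  obtain ⟨f, hf, hΦ⟩ := h.exists_contDiff
  have : Continuous fun y ↦ f (y, ξ) := hf.continuous.comp (by fun_prop)
  exact this.continuousOn.congr fun y hy ↦ hΦ y hy ξ

theorem continuous_temperedDistribution (Θ : 𝓢'(E, ℂ)) : Continuous Θ :=
  ContinuousLinearMap.continuous (show 𝓢(E, ℂ) →L[ℂ] ℂ from Θ)

theorem IsSmoothFamily.exists_norm_apply_le {s : Set Y} {Φ : Y → 𝓢(E, ℂ)}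
    (h : IsSmoothFamily s Φ) (Θ : 𝓢'(E, ℂ)) :
    ∃ (N : ℕ) (C : ℝ), 0 ≤ C ∧ ∀ y ∈ s, ‖Θ (Φ y)‖ ≤ C * (1 + ‖y‖) ^ N :=
  h.exists_norm_clm_le (show 𝓢(E, ℂ) →L[ℂ] ℂ from Θ)

theorem IsSmoothFamily.continuousOn_distribution [ProperSpace E] {s : Set Y} {Φ : Y → 𝓢(E, ℂ)}
    (h : IsSmoothFamily s Φ) (Θ : 𝓢'(E, ℂ)) : ContinuousOn (fun y ↦ Θ (Φ y)) s :=
  (continuous_temperedDistribution Θ).comp_continuousOn h.continuousOn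

variable [MeasurableSpace Y] [BorelSpace Y] [SecondCountableTopology Y]

open LineDeriv in
theorem lineDeriv_eq_integral {c : Y → ℂ} {s : Set Y} {μ : Measure Y}
    (hc : IsRapidWeight c s μ) (hs : MeasurableSet s) {Φ : Y → 𝓢(E, ℂ)}
    (hΦ : IsSmoothFamily s Φ) {φ : 𝓢(E, ℂ)} (hφ : ∀ ξ, φ ξ = ∫ y in s, c y • Φ y ξ ∂μ)
    (v ξ : E) : (∂_{v} φ) ξ = ∫ y in s, c y • (∂_{v} (Φ y)) ξ ∂μ := by
  obtain ⟨N, C, hC, hb⟩ := (hΦ.lineDeriv v).exists_seminorm_le 0 0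
  obtain ⟨N', C', hC', hb'⟩ := hΦ.exists_seminorm_le 0 0
  have hbd : ∀ y ∈ s, ∀ η, ‖(∂_{v} (Φ y)) η‖ ≤ C * (1 + ‖y‖) ^ N := fun y hy η ↦
    (SchwartzMap.norm_le_seminorm ℝ _ η).trans (hb y hy)
  have hd : ∀ ψ : 𝓢(E, ℂ), ∀ r : ℝ,
      HasDerivAt (fun r : ℝ ↦ ψ (ξ + r • v)) ((∂_{v} ψ) (ξ + r • v)) r := by
    intro ψ r
    rw [SchwartzMap.lineDerivOp_apply_eq_fderiv]
    have h1 : HasDerivAt (fun r : ℝ ↦ ξ + r • v) v r := by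
      simpa using ((hasDerivAt_id r).smul_const v).const_add ξ
    exact (ψ.hasFDerivAt (ξ + r • v)).comp_hasDerivAt r h1
  have hmeas : ∀ r : ℝ, AEStronglyMeasurable (fun y ↦ c y • Φ y (ξ + r • v)) (μ.restrict s) :=
    fun r ↦ hc.1.smul ((hΦ.continuousOn_apply (ξ + r • v)).aestronglyMeasurable hs)
  have hmeas' : AEStronglyMeasurable (fun y ↦ c y • (∂_{v} (Φ y)) (ξ + (0 : ℝ) • v))
      (μ.restrict s) :=
    hc.1.smul (((hΦ.lineDeriv v).continuousOn_apply (ξ + (0 : ℝ) • v)).aestronglyMeasurable hs)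
  have hint : IntegrableOn (fun y ↦ c y • Φ y (ξ + (0 : ℝ) • v)) s μ :=
    hc.integrableOn_smul hs (hΦ.continuousOn_apply _)
      fun y hy ↦ (SchwartzMap.norm_le_seminorm ℝ _ _).trans (hb' y hy)
  have hbound : ∀ᵐ y ∂(μ.restrict s), ∀ r ∈ (Set.univ : Set ℝ),
      ‖c y • (∂_{v} (Φ y)) (ξ + r • v)‖ ≤ C * (‖c y‖ * (1 + ‖y‖) ^ N) := by
    refine (ae_restrict_iff' hs).2 (.of_forall fun y hy r _ ↦ ?_)
    rw [norm_smul]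
    calc _ ≤ ‖c y‖ * (C * (1 + ‖y‖) ^ N) := by gcongr; exact hbd y hy _
      _ = _ := by ring
  have hderiv : ∀ᵐ y ∂(μ.restrict s), ∀ r ∈ (Set.univ : Set ℝ),
      HasDerivAt (fun r : ℝ ↦ c y • Φ y (ξ + r • v)) (c y • (∂_{v} (Φ y)) (ξ + r • v)) r :=
    .of_forall fun y r _ ↦ (hd (Φ y) r).const_smul (c y)
  have key := (hasDerivAt_integral_of_dominated_loc_of_deriv_le (x₀ := (0 : ℝ)) univ_mem
    (.of_forall hmeas) hint hmeas' hbound ((hc.2 N).const_mul C) hderiv).2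
  have h1 : (fun r : ℝ ↦ ∫ y in s, c y • Φ y (ξ + r • v) ∂μ) = fun r : ℝ ↦ φ (ξ + r • v) :=
    funext fun r ↦ (hφ _).symm
  rw [h1] at key
  have h2 := (hd φ 0).unique key
  simpa only [zero_smul, add_zero] using h2

open LineDeriv in
theorem iteratedLineDeriv_eq_integral {c : Y → ℂ} {s : Set Y} {μ : Measure Y}
    (hc : IsRapidWeight c s μ) (hs : MeasurableSet s) {l : ℕ} (m : Fin l → E)
    {Φ : Y → 𝓢(E, ℂ)} (hΦ : IsSmoothFamily s Φ) {φ : 𝓢(E, ℂ)}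
    (hφ : ∀ ξ, φ ξ = ∫ y in s, c y • Φ y ξ ∂μ) (ξ : E) :
    (∂^{m} φ) ξ = ∫ y in s, c y • (∂^{m} (Φ y)) ξ ∂μ := by
  induction l generalizing Φ φ ξ with
  | zero => simpa using hφ ξ
  | succ l ih =>
    simp_rw [iteratedLineDerivOp_succ_right]
    exact ih _ (hΦ.lineDeriv _) (fun ξ ↦ lineDeriv_eq_integral hc hs hΦ hφ _ ξ) ξ

/-- The bounded continuous functions with values in the `l`-linear forms. -/
abbrev BoundedForms (E : Type*) [NormedAddCommGroup E] [NormedSpace ℝ E] (l : ℕ) :=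
  BoundedContinuousFunction E (ContinuousMultilinearMap ℝ (fun _ : Fin l ↦ E) ℂ)

/-- The map `φ ↦ |ξ|^k D^l φ` from the Schwartz space to a Banach space, whose norm is the Schwartz
seminorm of index `(k, l)`. -/
def derivEmbedding (k l : ℕ) : 𝓢(E, ℂ) →L[ℂ] BoundedForms E l :=
  SchwartzMap.mkCLMtoNormedSpace (σ := RingHom.id ℂ) (D := E) (E := ℂ) (G := BoundedForms E l)
    (fun φ ↦ BoundedContinuousFunction.ofNormedAddCommGroup
      (fun ξ ↦ ‖ξ‖ ^ k • iteratedFDeriv ℝ l φ ξ)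
      ((continuous_norm.pow k).smul ((φ.smooth l).continuous_iteratedFDeriv le_rfl))
      (SchwartzMap.seminorm ℂ k l φ)
      (fun ξ ↦ by
        rw [norm_smul, norm_pow, norm_norm]
        exact SchwartzMap.le_seminorm ℂ k l φ ξ))
    (fun φ ψ ↦ by
      ext1 ξ
      have : iteratedFDeriv ℝ l (φ + ψ : 𝓢(E, ℂ)) ξ =
          iteratedFDeriv ℝ l φ ξ + iteratedFDeriv ℝ l ψ ξ :=
        congrFun (iteratedFDeriv_add (φ.smooth l) (ψ.smooth l)) ξ
      simp only [BoundedContinuousFunction.coe_ofNormedAddCommGroup,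
        BoundedContinuousFunction.coe_add, Pi.add_apply, this, smul_add])
    (fun a φ ↦ by
      ext1 ξ
      have : iteratedFDeriv ℝ l (a • φ : 𝓢(E, ℂ)) ξ = a • iteratedFDeriv ℝ l φ ξ :=
        iteratedFDeriv_const_smul_apply (φ.smooth l).contDiffAt
      simp only [BoundedContinuousFunction.coe_ofNormedAddCommGroup,
        BoundedContinuousFunction.coe_smul, this, RingHom.id_apply]
      exact smul_comm _ _ _)
    ⟨{(k, l)}, 1, zero_le_one, fun φ ↦ by
      rw [Finset.sup_singleton, one_mul]
      refine (BoundedContinuousFunction.norm_le (apply_nonneg _ _)).2 fun ξ ↦ ?_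
      rw [BoundedContinuousFunction.coe_ofNormedAddCommGroup, norm_smul, norm_pow, norm_norm]
      exact SchwartzMap.le_seminorm ℂ k l φ ξ⟩

theorem derivEmbedding_apply (k l : ℕ) (φ : 𝓢(E, ℂ)) (ξ : E) :
    derivEmbedding k l φ ξ = ‖ξ‖ ^ k • iteratedFDeriv ℝ l φ ξ := rfl

theorem seminorm_le_norm_derivEmbedding (k l : ℕ) (φ : 𝓢(E, ℂ)) :
    SchwartzMap.seminorm ℂ k l φ ≤ ‖derivEmbedding k l φ‖ := by
  refine SchwartzMap.seminorm_le_bound ℂ k l φ (norm_nonneg (derivEmbedding k l φ)) fun ξ ↦ ?_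
  have := (derivEmbedding k l φ).norm_coe_le_norm ξ
  rwa [derivEmbedding_apply, norm_smul, norm_pow, norm_norm] at this

/-- The Hahn-Banach theorem for a functional `f` which is bounded by the norm pulled back under a
linear map `j`. -/
theorem exists_extension_of_norm_le {V X : Type*} [AddCommGroup V] [Module ℂ V]
    [NormedAddCommGroup X] [NormedSpace ℂ X] (f : V →ₗ[ℂ] ℂ) (j : V →ₗ[ℂ] X) (K : ℝ)
    (hj : ∀ v, ‖f v‖ ≤ K * ‖j v‖) : ∃ Λ : X →L[ℂ] ℂ, ∀ v, f v = Λ (j v) := by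
  have hker : LinearMap.ker j ≤ LinearMap.ker f := by
    intro v hv
    have h1 := hj v
    rw [LinearMap.mem_ker.1 hv, norm_zero, mul_zero] at h1
    exact norm_le_zero_iff.1 h1
  let f₀ : LinearMap.range j →ₗ[ℂ] ℂ :=
    ((LinearMap.ker j).liftQ f hker) ∘ₗ j.quotKerEquivRange.symm.toLinearMap
  have hf₀ : ∀ v, f₀ ⟨j v, v, rfl⟩ = f v := by
    intro v
    have : j.quotKerEquivRange.symm ⟨j v, v, rfl⟩ = (LinearMap.ker j).mkQ v := by
      rw [LinearEquiv.symm_apply_eq]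
      rfl
    simp [f₀, this]
  have hf₀b : ∀ x, ‖f₀ x‖ ≤ K * ‖x‖ := by
    rintro ⟨-, v, rfl⟩
    rw [hf₀]
    exact hj v
  obtain ⟨Λ, hΛ, -⟩ := exists_extension_norm_eq (LinearMap.range j) (f₀.mkContinuous K hf₀b)
  refine ⟨Λ, fun v ↦ ?_⟩
  have := hΛ ⟨j v, v, rfl⟩
  rw [LinearMap.mkContinuous_apply, hf₀] at this
  exact this.symm

/-- A finite product of the spaces `BoundedForms E l`. -/
def PiForms (E : Type*) [NormedAddCommGroup E] [NormedSpace ℝ E] (S : Finset (ℕ × ℕ)) :=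
  ∀ i : S, BoundedForms E i.1.2

instance (S : Finset (ℕ × ℕ)) : NormedAddCommGroup (PiForms E S) :=
  inferInstanceAs (NormedAddCommGroup (∀ i : S, BoundedForms E i.1.2))

instance (S : Finset (ℕ × ℕ)) : NormedSpace ℂ (PiForms E S) :=
  inferInstanceAs (NormedSpace ℂ (∀ i : S, BoundedForms E i.1.2))

instance (S : Finset (ℕ × ℕ)) : CompleteSpace (PiForms E S) :=
  inferInstanceAs (CompleteSpace (∀ i : S, BoundedForms E i.1.2))

/-- Evaluation of an element of `PiForms E S` at an index, a point and a tuple of vectors. -/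
def evalForms {S : Finset (ℕ × ℕ)} (i : S) (ξ : E) (m : Fin i.1.2 → E) : PiForms E S →L[ℂ] ℂ where
  toFun x := x i ξ m
  map_add' _ _ := rfl
  map_smul' _ _ := rfl
  cont := (ContinuousMultilinearMap.apply ℝ (fun _ : Fin i.1.2 ↦ E) ℂ m).continuous.comp
    (((BoundedContinuousFunction.evalCLM ℝ ξ).continuous).comp
      (continuous_apply (A := fun i : S ↦ BoundedForms E i.1.2) i))

/-- The embedding of the Schwartz space defined by finitely many of the maps `φ ↦ |ξ|^k D^l φ`. -/
def piEmbedding (S : Finset (ℕ × ℕ)) : 𝓢(E, ℂ) →L[ℂ] PiForms E S :=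
  ContinuousLinearMap.pi (φ := fun i : S ↦ BoundedForms E i.1.2)
    fun i ↦ derivEmbedding i.1.1 i.1.2

theorem exists_extension_piEmbedding (Θ : 𝓢(E, ℂ) →L[ℂ] ℂ) :
    ∃ (S : Finset (ℕ × ℕ)) (Λ : PiForms E S →L[ℂ] ℂ),
      ∀ φ, Θ φ = Λ (piEmbedding S φ) := by
  obtain ⟨S, K, -, hK⟩ := Seminorm.bound_of_continuous (schwartz_withSeminorms ℂ E ℂ)
    ((normSeminorm ℂ ℂ).comp Θ.toLinearMap) (continuous_norm.comp Θ.continuous)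
  refine ⟨S, exists_extension_of_norm_le Θ.toLinearMap (piEmbedding S).toLinearMap K fun φ ↦ ?_⟩
  calc ‖Θ φ‖ ≤ K * (S.sup (schwartzSeminormFamily ℂ E ℂ)) φ := hK φ
    _ ≤ K * ‖piEmbedding S φ‖ := by
      refine mul_le_mul_of_nonneg_left ?_ K.2
      refine Seminorm.finset_sup_apply_le (norm_nonneg (piEmbedding S φ)) fun i hi ↦ ?_
      exact (seminorm_le_norm_derivEmbedding i.1 i.2 φ).trans
        (norm_le_pi_norm (fun i : S ↦ derivEmbedding i.1.1 i.1.2 φ) ⟨i, hi⟩)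

variable [ProperSpace E]

theorem IsSmoothFamily.integrableOn_distribution {s : Set Y} {Φ : Y → 𝓢(E, ℂ)}
    (hΦ : IsSmoothFamily s Φ) (Θ : 𝓢'(E, ℂ)) {c : Y → ℂ} {μ : Measure Y}
    (hc : IsRapidWeight c s μ) (hs : MeasurableSet s) :
    IntegrableOn (fun y ↦ c y • Θ (Φ y)) s μ := by
  obtain ⟨N, C, -, hb⟩ := hΦ.exists_norm_apply_le Θ
  exact hc.integrableOn_smul hs (hΦ.continuousOn_distribution Θ) hb

/-- A tempered distribution commutes with the integral of a smooth family of Schwartz functions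
against a rapidly decreasing weight. -/
theorem IsSmoothFamily.distribution_integral {s : Set Y} {Φ : Y → 𝓢(E, ℂ)}
    (hΦ : IsSmoothFamily s Φ) (Θ : 𝓢'(E, ℂ)) {c : Y → ℂ} {μ : Measure Y}
    (hc : IsRapidWeight c s μ) (hs : MeasurableSet s) {φ : 𝓢(E, ℂ)}
    (hφ : ∀ ξ, φ ξ = ∫ y in s, c y • Φ y ξ ∂μ) :
    Θ φ = ∫ y in s, c y • Θ (Φ y) ∂μ := by
  obtain ⟨S, Λ, hΛ⟩ := exists_extension_piEmbedding (show 𝓢(E, ℂ) →L[ℂ] ℂ from Θ)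
  have hΛ' : ∀ φ, Θ φ = Λ (piEmbedding S φ) := hΛ
  obtain ⟨N, C, -, hb⟩ := hΦ.exists_norm_clm_le (piEmbedding S)
  have hint : IntegrableOn (fun y ↦ c y • piEmbedding S (Φ y)) s μ :=
    hc.integrableOn_smul hs ((piEmbedding S).continuous.comp_continuousOn hΦ.continuousOn) hb
  have hj : piEmbedding S φ = ∫ y in s, c y • piEmbedding S (Φ y) ∂μ := by
    funext i
    ext ξ m
    have hev : ∀ x, evalForms i ξ m x = x i ξ m := fun x ↦ rfl
    have hevj : ∀ φ, evalForms i ξ m (piEmbedding S φ) =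
        ‖ξ‖ ^ i.1.1 • iteratedFDeriv ℝ i.1.2 φ ξ m := fun φ ↦ rfl
    rw [← hev, ← hev, ← (evalForms i ξ m).integral_comp_comm hint, hevj,
      ← SchwartzMap.iteratedLineDerivOp_eq_iteratedFDeriv,
      iteratedLineDeriv_eq_integral hc hs m hΦ hφ, ← integral_smul]
    refine integral_congr_ae (.of_forall fun y ↦ ?_)
    simp only [map_smul, hevj, SchwartzMap.iteratedLineDerivOp_eq_iteratedFDeriv]
    rw [smul_comm]
  rw [hΛ', hj, ← Λ.integral_comp_comm hint]
  simp [hΛ']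

end Pettis

/-! ### Symbols: plane waves, heat semigroup, powers of the regularized Laplacian -/

section Symbols

variable {n : ℕ}

/-- The function `ξ ↦ exp (2πi x·ξ)`. -/
def planeWave (x ξ : Rn n) : ℂ := Complex.exp (2 * Real.pi * Complex.I * (inner ℝ x ξ : ℝ))

/-- The symbol `ξ ↦ exp (-t|2πξ|²)` of the heat semigroup. -/
def heatSymbol (t : ℝ) (ξ : Rn n) : ℂ := Complex.exp ((-(t * (2 * Real.pi * ‖ξ‖) ^ 2) : ℝ) : ℂ)

theorem hasTemperateGrowth_planeWave_exponent :
    (fun z : Rn n × Rn n ↦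
      2 * Real.pi * Complex.I * ((inner ℝ z.1 z.2 : ℝ) : ℂ)).HasTemperateGrowth := by
  have h1 : (fun z : Rn n × Rn n ↦ z.1).HasTemperateGrowth :=
    (ContinuousLinearMap.fst ℝ (Rn n) (Rn n)).hasTemperateGrowth
  have h2 : (fun z : Rn n × Rn n ↦ z.2).HasTemperateGrowth :=
    (ContinuousLinearMap.snd ℝ (Rn n) (Rn n)).hasTemperateGrowth
  have h3 : (fun z : Rn n × Rn n ↦ (inner ℝ z.1 z.2 : ℝ)).HasTemperateGrowth :=
    (innerSL ℝ (E := Rn n)).bilinear_hasTemperateGrowth h1 h2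
  exact (Function.HasTemperateGrowth.const (2 * Real.pi * Complex.I)).mul
    (Function.HasTemperateGrowth.comp Function.Complex.hasTemperateGrowth_ofReal h3)

theorem hasTemperateGrowth_heat_exponent :
    (fun z : ℝ × Rn n ↦ ((-(z.1 * (2 * Real.pi * ‖z.2‖) ^ 2) : ℝ) : ℂ)).HasTemperateGrowth := by
  have h1 : (fun z : ℝ × Rn n ↦ z.1).HasTemperateGrowth :=
    (ContinuousLinearMap.fst ℝ ℝ (Rn n)).hasTemperateGrowth
  have h2 : (fun z : ℝ × Rn n ↦ ‖z.2‖ ^ 2).HasTemperateGrowth :=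
    (Function.hasTemperateGrowth_norm_sq (Rn n)).comp
      (ContinuousLinearMap.snd ℝ ℝ (Rn n)).hasTemperateGrowth
  have h3 : (fun z : ℝ × Rn n ↦ (z.1 * (-(2 * Real.pi) ^ 2 * ‖z.2‖ ^ 2) : ℝ)).HasTemperateGrowth :=
    h1.mul ((Function.HasTemperateGrowth.const (-(2 * Real.pi) ^ 2)).mul h2)
  have e : (fun z : ℝ × Rn n ↦ ((-(z.1 * (2 * Real.pi * ‖z.2‖) ^ 2) : ℝ) : ℂ)) =
      Complex.ofReal ∘ fun z : ℝ × Rn n ↦ (z.1 * (-(2 * Real.pi) ^ 2 * ‖z.2‖ ^ 2) : ℝ) := by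
    funext z
    simp only [Function.comp_apply]
    congr 1
    ring
  rw [e]
  exact Function.HasTemperateGrowth.comp Function.Complex.hasTemperateGrowth_ofReal h3

theorem hasTemperateGrowth_prodMk_const {Y : Type*} [NormedAddCommGroup Y] [NormedSpace ℝ Y]
    (y : Y) : (fun ξ : Rn n ↦ (y, ξ)).HasTemperateGrowth := by
  have : (fun ξ : Rn n ↦ (y, ξ)) =
      (fun _ : Rn n ↦ (y, (0 : Rn n))) + (ContinuousLinearMap.inr ℝ Y (Rn n)) := by
    funext ξ; simp
  rw [this]
  exact (Function.HasTemperateGrowth.const _).add (ContinuousLinearMap.hasTemperateGrowth _)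

/-- If `Re q ≤ 0`, then `exp q` has temperate growth. -/
theorem hasTemperateGrowth_cexp {q : Rn n → ℂ} (hq : q.HasTemperateGrowth)
    (h0 : ∀ ξ, (q ξ).re ≤ 0) : (fun ξ ↦ Complex.exp (q ξ)).HasTemperateGrowth := by
  refine ⟨Complex.contDiff_exp.comp hq.1, fun l ↦ ?_⟩
  obtain ⟨N, C, -, h⟩ :=
    exists_norm_iteratedFDeriv_mul_cexp_le (Function.HasTemperateGrowth.const 1) hq l
  refine ⟨N, C, fun ξ ↦ ?_⟩
  simpa using h l le_rfl ξ (h0 ξ)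

theorem hasTemperateGrowth_planeWave (x : Rn n) : (planeWave x).HasTemperateGrowth :=
  hasTemperateGrowth_cexp (hasTemperateGrowth_planeWave_exponent.comp
    (hasTemperateGrowth_prodMk_const x)) (fun ξ ↦ by simp)

theorem heat_exponent_nonpos {t : ℝ} (ht : 0 ≤ t) (ξ : Rn n) :
    (((-(t * (2 * Real.pi * ‖ξ‖) ^ 2) : ℝ) : ℂ)).re ≤ 0 := by
  rw [Complex.ofReal_re]
  exact neg_nonpos.2 (by positivity)

theorem hasTemperateGrowth_heatSymbol {t : ℝ} (ht : 0 ≤ t) :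
    (heatSymbol (n := n) t).HasTemperateGrowth :=
  hasTemperateGrowth_cexp (hasTemperateGrowth_heat_exponent.comp
    (hasTemperateGrowth_prodMk_const t)) (heat_exponent_nonpos ht)

/-- Multiplication of Schwartz functions by the plane wave `exp (2πi x·ξ)`. -/
def Pw (x : Rn n) : 𝓢(Rn n, ℂ) →L[ℂ] 𝓢(Rn n, ℂ) := SchwartzMap.smulLeftCLM ℂ (planeWave x)

/-- Multiplication of Schwartz functions by the heat symbol `exp (-t|2πξ|²)`, `t ≥ 0`. -/
def Ht (t : ℝ) : 𝓢(Rn n, ℂ) →L[ℂ] 𝓢(Rn n, ℂ) := SchwartzMap.smulLeftCLM ℂ (heatSymbol t)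

/-- Multiplication of Schwartz functions by `(ε² + |2πξ|²)^{s/2}`, `ε > 0`. -/
def Rg (s ε : ℝ) : 𝓢(Rn n, ℂ) →L[ℂ] 𝓢(Rn n, ℂ) := SchwartzMap.smulLeftCLM ℂ (regSymbol s ε)

/-- The product of two Schwartz functions. -/
def Mu (κ : 𝓢(Rn n, ℂ)) : 𝓢(Rn n, ℂ) →L[ℂ] 𝓢(Rn n, ℂ) := SchwartzMap.smulLeftCLM ℂ κ

theorem Pw_apply (x : Rn n) (χ : 𝓢(Rn n, ℂ)) (ξ : Rn n) : Pw x χ ξ = planeWave x ξ * χ ξ :=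
  SchwartzMap.smulLeftCLM_apply_apply (hasTemperateGrowth_planeWave x) χ ξ

theorem Ht_apply {t : ℝ} (ht : 0 ≤ t) (χ : 𝓢(Rn n, ℂ)) (ξ : Rn n) :
    Ht t χ ξ = heatSymbol t ξ * χ ξ :=
  SchwartzMap.smulLeftCLM_apply_apply (hasTemperateGrowth_heatSymbol ht) χ ξ

theorem Rg_apply (s : ℝ) {ε : ℝ} (hε : 0 < ε) (χ : 𝓢(Rn n, ℂ)) (ξ : Rn n) :
    Rg s ε χ ξ = regSymbol s ε ξ * χ ξ :=
  SchwartzMap.smulLeftCLM_apply_apply (regSymbol_hasTemperateGrowth s hε) χ ξ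

theorem Mu_apply (κ χ : 𝓢(Rn n, ℂ)) (ξ : Rn n) : Mu κ χ ξ = κ ξ * χ ξ :=
  SchwartzMap.smulLeftCLM_apply_apply κ.hasTemperateGrowth χ ξ

theorem heatSymbol_add (t r : ℝ) (ξ : Rn n) :
    heatSymbol (t + r) ξ = heatSymbol t ξ * heatSymbol r ξ := by
  rw [heatSymbol, heatSymbol, heatSymbol, ← Complex.exp_add, ← Complex.ofReal_add]
  congr 2
  ring

theorem reg_pos {ε : ℝ} (hε : 0 < ε) (ξ : Rn n) : 0 < ε ^ 2 + (2 * Real.pi * ‖ξ‖) ^ 2 := by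
  positivity

theorem regSymbol_add (s s' : ℝ) {ε : ℝ} (hε : 0 < ε) (ξ : Rn n) :
    regSymbol (s + s') ε ξ = regSymbol s ε ξ * regSymbol s' ε ξ := by
  rw [regSymbol, regSymbol, regSymbol, ← Complex.ofReal_mul, ← Real.rpow_add (reg_pos hε ξ)]
  congr 2
  ring

theorem Ht_Ht {t r : ℝ} (ht : 0 ≤ t) (hr : 0 ≤ r) (χ : 𝓢(Rn n, ℂ)) :
    Ht t (Ht r χ) = Ht (t + r) χ := by
  ext ξ
  rw [Ht_apply ht, Ht_apply hr, Ht_apply (by positivity), heatSymbol_add, mul_assoc]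

theorem Ht_zero (χ : 𝓢(Rn n, ℂ)) : Ht 0 χ = χ := by
  ext ξ
  rw [Ht_apply le_rfl]
  simp [heatSymbol]

theorem Rg_Rg (s s' : ℝ) {ε : ℝ} (hε : 0 < ε) (χ : 𝓢(Rn n, ℂ)) :
    Rg s ε (Rg s' ε χ) = Rg (s + s') ε χ := by
  ext ξ
  rw [Rg_apply s hε, Rg_apply s' hε, Rg_apply _ hε, regSymbol_add s s' hε, mul_assoc]

theorem Ht_Rg {t : ℝ} (ht : 0 ≤ t) (s : ℝ) {ε : ℝ} (hε : 0 < ε) (χ : 𝓢(Rn n, ℂ)) :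
    Ht t (Rg s ε χ) = Rg s ε (Ht t χ) := by
  ext ξ
  rw [Ht_apply ht, Rg_apply s hε, Rg_apply s hε, Ht_apply ht, mul_left_comm]

theorem Pw_Rg (x : Rn n) (s : ℝ) {ε : ℝ} (hε : 0 < ε) (χ : 𝓢(Rn n, ℂ)) :
    Pw x (Rg s ε χ) = Rg s ε (Pw x χ) := by
  ext ξ
  rw [Pw_apply, Rg_apply s hε, Rg_apply s hε, Pw_apply, mul_left_comm]

theorem Pw_Ht (x : Rn n) {t : ℝ} (ht : 0 ≤ t) (χ : 𝓢(Rn n, ℂ)) :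
    Pw x (Ht t χ) = Ht t (Pw x χ) := by
  ext ξ
  rw [Pw_apply, Ht_apply ht, Ht_apply ht, Pw_apply, mul_left_comm]

/-- The frequency side of the heat kernel: the Schwartz function `ξ ↦ exp (-t|2πξ|²)`, `t > 0`. -/
def Gs {t : ℝ} (ht : 0 < t) : 𝓢(Rn n, ℂ) :=
  SchwartzMap.postcompCLM (𝕜 := ℝ) Complex.ofRealCLM
    (gaussianFun (a := (2 * Real.pi) ^ 2 * t) (by positivity))

theorem Gs_apply {t : ℝ} (ht : 0 < t) (ξ : Rn n) : Gs ht ξ = heatSymbol t ξ := by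
  have : Gs ht ξ = ((Real.exp (-((2 * Real.pi) ^ 2 * t) * ‖ξ‖ ^ 2) : ℝ) : ℂ) := rfl
  rw [this, heatSymbol, Complex.ofReal_exp]
  congr 2
  ring

theorem Ht_Gs {t r : ℝ} (ht : 0 < t) (hr : 0 ≤ r) :
    Ht r (Gs ht : 𝓢(Rn n, ℂ)) = Gs (add_pos_of_pos_of_nonneg ht hr) := by
  ext ξ
  rw [Ht_apply hr, Gs_apply, Gs_apply, heatSymbol_add, mul_comm]

theorem Mu_Gs {t : ℝ} (ht : 0 < t) (χ : 𝓢(Rn n, ℂ)) : Mu (Gs ht) χ = Ht t χ := by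
  ext ξ
  rw [Mu_apply, Ht_apply ht.le, Gs_apply]

open Real in
/-- The Fourier transform of `exp (-t|2πξ|² + 2πi x·ξ)` is the heat kernel centred at `x`. -/
theorem fourier_Pw_Gs {t : ℝ} (ht : 0 < t) (x : Rn n) : 𝓕 (Pw x (Gs ht)) = heatKernel ht x := by
  ext w
  rw [SchwartzMap.fourier_coe]
  have hb : 0 < (((2 * π) ^ 2 * t : ℝ) : ℂ).re := by
    rw [Complex.ofReal_re]; positivity
  have h1 : (Pw x (Gs ht) : Rn n → ℂ) = fun v ↦
      Complex.exp (-(((2 * π) ^ 2 * t : ℝ) : ℂ) * ‖v‖ ^ 2 +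
        2 * π * Complex.I * (inner ℝ x v : ℝ)) := by
    funext v
    rw [Pw_apply, Gs_apply, heatSymbol, planeWave, ← Complex.exp_add]
    congr 1
    push_cast
    ring
  rw [h1, fourier_gaussian_innerProductSpace' hb, heatKernel_apply]
  push_cast
  congr 1
  · have e1 : (π : ℂ) / ((2 * π) ^ 2 * t) = ((4 * π * t : ℝ) : ℂ)⁻¹ := by
      have : (π : ℂ) ≠ 0 := by exact_mod_cast Real.pi_ne_zero
      have : (t : ℂ) ≠ 0 := by exact_mod_cast ht.ne'
      push_cast
      field_simp
      norm_num
    have e2 : ((Module.finrank ℝ (Rn n) : ℕ) : ℂ) / 2 = (((n : ℝ) / 2 : ℝ) : ℂ) := by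
      simp
    rw [e1, e2, ← Complex.ofReal_inv, ← Complex.ofReal_cpow (by positivity),
      Real.inv_rpow (by positivity), ← Real.rpow_neg (by positivity), neg_div]
  · congr 1
    have : (π : ℂ) ≠ 0 := by exact_mod_cast Real.pi_ne_zero
    have : (t : ℂ) ≠ 0 := by exact_mod_cast ht.ne'
    field_simp
    ring

theorem fourier_Pw (x : Rn n) (χ : 𝓢(Rn n, ℂ)) (w : Rn n) :
    𝓕 (Pw x χ) w = 𝓕 χ (w - x) := by
  rw [SchwartzMap.fourier_coe, SchwartzMap.fourier_coe, Real.fourier_eq', Real.fourier_eq']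
  refine integral_congr_ae (.of_forall fun ξ ↦ ?_)
  simp only [Pw_apply, planeWave, smul_eq_mul, ← mul_assoc, ← Complex.exp_add]
  congr 2
  rw [inner_sub_right, real_inner_comm x ξ]
  push_cast
  ring

theorem isSmoothFamily_Pw (κ : 𝓢(Rn n, ℂ)) : IsSmoothFamily Set.univ (fun x : Rn n ↦ Pw x κ) := by
  refine isSmoothFamily_mul_cexp (Function.HasTemperateGrowth.const 1)
    hasTemperateGrowth_planeWave_exponent κ (fun x _ ξ ↦ by simp) (fun x _ ξ ↦ ?_)
  rw [Pw_apply, planeWave, one_mul]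

theorem isSmoothFamily_Ht (κ : 𝓢(Rn n, ℂ)) :
    IsSmoothFamily (Set.Ici (0 : ℝ)) (fun t ↦ Ht t κ) := by
  refine isSmoothFamily_mul_cexp (Function.HasTemperateGrowth.const 1)
    hasTemperateGrowth_heat_exponent κ (fun t ht ξ ↦ heat_exponent_nonpos ht ξ) (fun t ht ξ ↦ ?_)
  rw [Ht_apply ht, heatSymbol, one_mul]

theorem isRapidWeight_schwartz (ψ : 𝓢(Rn n, ℂ)) :
    IsRapidWeight (fun x ↦ ψ x) Set.univ (volume : Measure (Rn n)) := by
  refine ⟨ψ.continuous.aestronglyMeasurable, fun N ↦ ?_⟩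
  rw [integrableOn_univ]
  have h : Integrable (fun x : Rn n ↦ 2 ^ N * (‖ψ x‖ + ‖x‖ ^ N * ‖ψ x‖)) :=
    ((ψ.integrable (μ := volume)).norm.add (ψ.integrable_pow_mul volume N)).const_mul _
  refine h.mono' (by fun_prop) (.of_forall fun x ↦ ?_)
  rw [norm_mul, norm_norm, norm_pow, Real.norm_of_nonneg (by positivity)]
  have : (1 + ‖x‖) ^ N ≤ 2 ^ N * (1 + ‖x‖ ^ N) := by
    have h1 := add_pow_le (zero_le_one (α := ℝ)) (norm_nonneg x) N
    rw [one_pow] at h1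
    refine h1.trans ?_
    gcongr
    · norm_num
    · omega
  calc _ ≤ ‖ψ x‖ * (2 ^ N * (1 + ‖x‖ ^ N)) := by gcongr
    _ = _ := by ring

/-- `⟨Θ, κχ⟩ = ∫ χ̂(x) ⟨Θ, κ exp (2πi x·ξ)⟩ dx`: for `Θ = 𝓕 T`, this says that the convolution of
`T` with a Schwartz function is given by a function. -/
theorem distribution_Mu (Θ : 𝓢'(Rn n, ℂ)) (κ χ : 𝓢(Rn n, ℂ)) :
    Θ (Mu κ χ) = ∫ x, 𝓕 χ x * Θ (Pw x κ) := by
  have h := (isSmoothFamily_Pw κ).distribution_integral Θ (isRapidWeight_schwartz (𝓕 χ))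
    MeasurableSet.univ (φ := Mu κ χ) (fun ξ ↦ ?_)
  · simpa using h
  · have h1 : χ ξ = 𝓕⁻ (𝓕 χ) ξ := by rw [FourierTransform.fourierInv_fourier_eq]
    rw [Measure.restrict_univ, Mu_apply, h1, SchwartzMap.fourierInv_coe, Real.fourierInv_eq',
      ← integral_const_mul]
    refine integral_congr_ae (.of_forall fun x ↦ ?_)
    simp only [Pw_apply, planeWave, smul_eq_mul]
    have : Complex.exp (((2 * Real.pi * (inner ℝ x ξ : ℝ) : ℝ) : ℂ) * Complex.I) =
      Complex.exp (2 * Real.pi * Complex.I * ((inner ℝ x ξ : ℝ) : ℂ)) := by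
      congr 1; push_cast; ring
    rw [this]
    ring

theorem integrable_distribution_Mu (Θ : 𝓢'(Rn n, ℂ)) (κ ψ : 𝓢(Rn n, ℂ)) :
    Integrable (fun x ↦ ψ x * Θ (Pw x κ)) := by
  have := (isSmoothFamily_Pw κ).integrableOn_distribution Θ (isRapidWeight_schwartz ψ)
    MeasurableSet.univ
  simpa using this

theorem isRapidWeight_gamma {a ε : ℝ} (ha : 0 < a) (hε : 0 < ε) :
    IsRapidWeight (fun t : ℝ ↦ ((t ^ (a - 1) * Real.exp (-(ε ^ 2 * t)) : ℝ) : ℂ)) (Set.Ioi 0)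
      volume := by
  refine ⟨by fun_prop, fun N ↦ ?_⟩
  have h1 : ∀ b : ℝ, 0 < b → IntegrableOn (fun t : ℝ ↦ t ^ (b - 1) * Real.exp (-(ε ^ 2 * t)))
      (Set.Ioi 0) := fun b hb ↦ by
    have := integrableOn_rpow_mul_exp_neg_mul_rpow (s := b - 1) (p := 1) (b := ε ^ 2)
      (by linarith) one_pos (by positivity)
    simpa using this
  have h2 : IntegrableOn (fun t : ℝ ↦ 2 ^ N * (t ^ (a - 1) * Real.exp (-(ε ^ 2 * t)) +
      t ^ (a + N - 1) * Real.exp (-(ε ^ 2 * t)))) (Set.Ioi 0) :=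
    ((h1 a ha).add (h1 (a + N) (by positivity))).const_mul _
  refine h2.mono' (by fun_prop) ((ae_restrict_iff' measurableSet_Ioi).2 (.of_forall fun t ht ↦ ?_))
  have ht' : 0 < t := ht
  rw [norm_mul, norm_norm, norm_pow, Real.norm_of_nonneg (by positivity), Complex.norm_real,
    Real.norm_of_nonneg (by positivity), Real.norm_of_nonneg ht'.le]
  have h3 : (1 + t) ^ N ≤ 2 ^ N * (1 + t ^ N) := by
    have h1 := add_pow_le (zero_le_one (α := ℝ)) ht'.le N
    rw [one_pow] at h1
    refine h1.trans ?_
    gcongr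
    · norm_num
    · omega
  have h4 : t ^ (a + N - 1) = t ^ (a - 1) * t ^ N := by
    rw [← Real.rpow_natCast, ← Real.rpow_add ht']
    congr 1
    ring
  calc _ ≤ t ^ (a - 1) * Real.exp (-(ε ^ 2 * t)) * (2 ^ N * (1 + t ^ N)) := by gcongr
    _ = _ := by rw [h4]; ring

/-- The formula `(ε² + λ)^{-a} = Γ(a)⁻¹ ∫₀^∞ t^{a-1} exp (-ε²t) exp (-tλ) dt`, `λ = |2πξ|²`, applied
to a tempered distribution. -/
theorem distribution_Rg_neg (Θ : 𝓢'(Rn n, ℂ)) (κ : 𝓢(Rn n, ℂ)) {a ε : ℝ} (ha : 0 < a)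
    (hε : 0 < ε) :
    Θ (Rg (-2 * a) ε κ) = ((Real.Gamma a)⁻¹ : ℂ) *
      ∫ t in Set.Ioi (0 : ℝ), ((t ^ (a - 1) * Real.exp (-(ε ^ 2 * t)) : ℝ) : ℂ) * Θ (Ht t κ) := by
  have hΓ : (Real.Gamma a : ℂ) ≠ 0 := by exact_mod_cast (Real.Gamma_pos_of_pos ha).ne'
  have h := ((isSmoothFamily_Ht κ).mono Set.Ioi_subset_Ici_self).distribution_integral Θ
    (isRapidWeight_gamma ha hε) measurableSet_Ioi (φ := (Real.Gamma a : ℂ) • Rg (-2 * a) ε κ)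
    (fun ξ ↦ ?_)
  · rw [map_smul, smul_eq_mul] at h
    simp only [smul_eq_mul] at h
    rw [← h, inv_mul_cancel_left₀ hΓ]
  · have h1 : ((Real.Gamma a : ℂ) • Rg (-2 * a) ε κ) ξ =
        (Real.Gamma a : ℂ) * (regSymbol (-2 * a) ε ξ * κ ξ) := by
      rw [← Rg_apply _ hε]; rfl
    set L : ℝ := ε ^ 2 + (2 * Real.pi * ‖ξ‖) ^ 2 with hL
    have hL0 : 0 < L := reg_pos hε ξ
    have h2 : ∀ t ∈ Set.Ioi (0 : ℝ), ((t ^ (a - 1) * Real.exp (-(ε ^ 2 * t)) : ℝ) : ℂ) •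
        Ht t κ ξ = ((t ^ (a - 1) * Real.exp (-(L * t)) : ℝ) : ℂ) * κ ξ := by
      intro t ht
      rw [Ht_apply (le_of_lt ht), heatSymbol, smul_eq_mul, ← mul_assoc, ← Complex.ofReal_exp,
        ← Complex.ofReal_mul, mul_assoc, ← Real.exp_add]
      congr 4
      rw [hL]
      ring
    rw [h1, setIntegral_congr_fun measurableSet_Ioi h2, integral_mul_const, integral_complex_ofReal,
      Real.integral_rpow_mul_exp_neg_mul_Ioi ha hL0, ← mul_assoc, regSymbol, ← hL,
      ← Complex.ofReal_mul]
    congr 2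
    rw [one_div, Real.inv_rpow hL0.le, ← Real.rpow_neg hL0.le, mul_comm]
    congr 2
    ring

end Symbols

/-! ### Decay of the heat flow of a distribution in a negative Besov space -/

section BesovDecay

theorem integrableOn_rpow_mul_one_add_rpow {a e : ℝ} (ha : 0 < a) (hae : a < e) :
    IntegrableOn (fun u : ℝ ↦ u ^ (a - 1) * (1 + u) ^ (-e)) (Set.Ioi 0) := by
  have h1 : IntegrableOn (fun u : ℝ ↦ u ^ (a - 1)) (Set.Ioc 0 1) :=
    (intervalIntegrable_iff_integrableOn_Ioc_of_le zero_le_one).1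
      (intervalIntegral.intervalIntegrable_rpow' (by linarith))
  have h2 : IntegrableOn (fun u : ℝ ↦ u ^ (a - 1 - e)) (Set.Ioi 1) :=
    integrableOn_Ioi_rpow_of_lt (by linarith) one_pos
  rw [← Set.Ioc_union_Ioi_eq_Ioi (zero_le_one' ℝ)]
  refine IntegrableOn.union (h1.mono' (by fun_prop) ?_) (h2.mono' (by fun_prop) ?_)
  · refine (ae_restrict_iff' measurableSet_Ioc).2 (.of_forall fun u hu ↦ ?_)
    have hu0 : 0 < u := hu.1
    rw [Real.norm_of_nonneg (by positivity)]
    exact mul_le_of_le_one_right (by positivity)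
      (Real.rpow_le_one_of_one_le_of_nonpos (by linarith) (by linarith))
  · refine (ae_restrict_iff' measurableSet_Ioi).2 (.of_forall fun u hu ↦ ?_)
    have hu0 : (0 : ℝ) < u := zero_lt_one.trans hu
    rw [Real.norm_of_nonneg (by positivity), sub_eq_add_neg (a - 1) e, Real.rpow_add hu0]
    gcongr u ^ (a - 1) * ?_
    exact Real.rpow_le_rpow_of_nonpos hu0 (by linarith) (by linarith)

theorem rpow_mul_add_rpow_scaling {a e c u : ℝ} (hc : 0 < c) (hu : 0 < u) :
    (c * u) ^ (a - 1) * (c + c * u) ^ (-e) =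
      c ^ (a - 1 - e) * (u ^ (a - 1) * (1 + u) ^ (-e)) := by
  have : c + c * u = c * (1 + u) := by ring
  rw [this, Real.mul_rpow hc.le hu.le, Real.mul_rpow hc.le (by positivity),
    sub_eq_add_neg (a - 1) e, Real.rpow_add hc]
  ring

theorem integrableOn_rpow_mul_add_rpow {a e c : ℝ} (ha : 0 < a) (hae : a < e) (hc : 0 < c) :
    IntegrableOn (fun u : ℝ ↦ u ^ (a - 1) * (c + u) ^ (-e)) (Set.Ioi 0) := by
  have := (integrableOn_Ioi_comp_mul_left_iff
    (fun u : ℝ ↦ u ^ (a - 1) * (c + u) ^ (-e)) 0 hc).1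
  rw [mul_zero] at this
  have h2 : IntegrableOn (fun u : ℝ ↦ c ^ (a - 1 - e) * (u ^ (a - 1) * (1 + u) ^ (-e)))
      (Set.Ioi 0) := (integrableOn_rpow_mul_one_add_rpow ha hae).const_mul _
  exact this (h2.congr_fun (fun u hu ↦ (rpow_mul_add_rpow_scaling hc hu).symm) measurableSet_Ioi)

/-- The Beta integral `∫₀^∞ u^{a-1} (1 + u)^{-e} du`. -/
def betaConst (a e : ℝ) : ℝ := ∫ u in Set.Ioi (0 : ℝ), u ^ (a - 1) * (1 + u) ^ (-e)

theorem betaConst_nonneg (a e : ℝ) : 0 ≤ betaConst a e :=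
  setIntegral_nonneg measurableSet_Ioi fun u hu ↦ by
    have hu0 : (0 : ℝ) < u := hu
    positivity

theorem integral_rpow_mul_add_rpow {a e c : ℝ} (hc : 0 < c) :
    ∫ u in Set.Ioi (0 : ℝ), u ^ (a - 1) * (c + u) ^ (-e) = betaConst a e * c ^ (a - e) := by
  have h := integral_comp_mul_left_Ioi' (fun u : ℝ ↦ u ^ (a - 1) * (c + u) ^ (-e)) 0 hc
  rw [mul_zero] at h
  rw [← h, setIntegral_congr_fun measurableSet_Ioi
    (fun u hu ↦ rpow_mul_add_rpow_scaling hc hu), integral_const_mul, smul_eq_mul, betaConst,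
    ← mul_assoc, mul_comm _ (c ^ (a - e))]
  congr 1
  nth_rewrite 1 [← Real.rpow_one c]
  rw [← Real.rpow_add hc]
  congr 1
  ring

variable {n : ℕ}

/-- The `L¹` norm of the Fourier transform. -/
def fourierL1 (χ : 𝓢(Rn n, ℂ)) : ℝ := ∫ x, ‖𝓕 χ x‖

theorem fourierL1_nonneg (χ : 𝓢(Rn n, ℂ)) : 0 ≤ fourierL1 χ :=
  integral_nonneg fun _ ↦ norm_nonneg _

theorem fourierL1_Pw (x : Rn n) (χ : 𝓢(Rn n, ℂ)) : fourierL1 (Pw x χ) = fourierL1 χ := by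
  simp only [fourierL1, fourier_Pw]
  exact integral_sub_right_eq_self (fun w ↦ ‖𝓕 χ w‖) x

theorem fourierL1_eq_of_comp_smul {χ χ' : 𝓢(Rn n, ℂ)} {c : ℝ} {r : ℝ} (hc : 0 < c) (hr : 0 ≤ r)
    (h : ∀ ξ, χ ξ = (r : ℂ) * χ' (c • ξ)) : fourierL1 χ = r * fourierL1 χ' := by
  have h1 : ∀ w, 𝓕 χ w = (r : ℂ) * (((c ^ n)⁻¹ : ℝ) • 𝓕 χ' (c⁻¹ • w)) := by
    intro w
    rw [SchwartzMap.fourier_coe, SchwartzMap.fourier_coe, Real.fourier_eq, Real.fourier_eq]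
    have h2 := Measure.integral_comp_smul_of_nonneg (volume : Measure (Rn n))
      (fun v : Rn n ↦ Real.fourierChar (-inner ℝ v (c⁻¹ • w)) • χ' v) c (hR := hc.le)
    rw [finrank_euclideanSpace_fin] at h2
    rw [← h2, ← integral_const_mul]
    refine integral_congr_ae (.of_forall fun v ↦ ?_)
    simp only [h v]
    rw [inner_smul_left, inner_smul_right, conj_trivial, mul_inv_cancel_left₀ hc.ne', mul_smul_comm]
  have h3 : ∀ w, ‖𝓕 χ w‖ = (r * (c ^ n)⁻¹) * ‖𝓕 χ' (c⁻¹ • w)‖ := by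
    intro w
    rw [h1, norm_mul, norm_smul, Complex.norm_real, Real.norm_of_nonneg hr,
      Real.norm_of_nonneg (by positivity), mul_assoc]
  rw [fourierL1, fourierL1]
  simp_rw [h3]
  rw [integral_const_mul, Measure.integral_comp_inv_smul_of_nonneg volume
    (fun w ↦ ‖𝓕 χ' w‖) hc.le, finrank_euclideanSpace_fin, smul_eq_mul]
  have : c ^ n ≠ 0 := by positivity
  field_simp

theorem fourierL1_Rg_Gs (s : ℝ) {ε τ : ℝ} (hε : 0 < ε) (hτ : 0 < τ) :
    fourierL1 (Rg s ε (Gs hτ) : 𝓢(Rn n, ℂ)) =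
      τ ^ (-(s / 2)) * fourierL1 (Rg s (ε * √τ) (Gs one_pos) : 𝓢(Rn n, ℂ)) := by
  have hs : 0 < √τ := Real.sqrt_pos.2 hτ
  refine fourierL1_eq_of_comp_smul hs (by positivity) fun ξ ↦ ?_
  have h1 : ‖√τ • ξ‖ = √τ * ‖ξ‖ := by rw [norm_smul, Real.norm_of_nonneg hs.le]
  have h2 : (ε * √τ) ^ 2 + (2 * Real.pi * (√τ * ‖ξ‖)) ^ 2 =
      τ * (ε ^ 2 + (2 * Real.pi * ‖ξ‖) ^ 2) := by
    have := Real.sq_sqrt hτ.le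
    linear_combination (ε ^ 2 + (2 * Real.pi * ‖ξ‖) ^ 2) * this
  have h3 : (1 : ℝ) * (2 * Real.pi * (√τ * ‖ξ‖)) ^ 2 = τ * (2 * Real.pi * ‖ξ‖) ^ 2 := by
    have := Real.sq_sqrt hτ.le
    linear_combination (2 * Real.pi * ‖ξ‖) ^ 2 * this
  rw [Rg_apply s hε, Rg_apply s (by positivity), Gs_apply, Gs_apply, regSymbol, regSymbol,
    heatSymbol, heatSymbol, h1, h2, h3, Real.mul_rpow hτ.le (reg_pos hε ξ).le, ← mul_assoc,
    ← Complex.ofReal_mul, ← mul_assoc, ← Real.rpow_add hτ, neg_add_cancel, Real.rpow_zero, one_mul]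

theorem regSymbol_two_mul_nat (k : ℕ) (ε : ℝ) (ξ : Rn n) :
    regSymbol (2 * k) ε ξ = (((ε ^ 2 + (2 * Real.pi * ‖ξ‖) ^ 2) ^ k : ℝ) : ℂ) := by
  rw [regSymbol, mul_div_cancel_left₀ _ (two_ne_zero), Real.rpow_natCast]

theorem hasTemperateGrowth_reg_pow {Y : Type*} [NormedAddCommGroup Y] [NormedSpace ℝ Y] (k : ℕ)
    (u : Y →L[ℝ] ℝ) :
    (fun z : Y × Rn n ↦
      (((u z.1 ^ 2 + (2 * Real.pi * ‖z.2‖) ^ 2) ^ k : ℝ) : ℂ)).HasTemperateGrowth := by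
  have h1 : (fun z : Y × Rn n ↦ u z.1).HasTemperateGrowth :=
    (u.comp (ContinuousLinearMap.fst ℝ Y (Rn n))).hasTemperateGrowth
  have h2 : (fun z : Y × Rn n ↦ ‖z.2‖ ^ 2).HasTemperateGrowth :=
    (Function.hasTemperateGrowth_norm_sq (Rn n)).comp
      (ContinuousLinearMap.snd ℝ Y (Rn n)).hasTemperateGrowth
  have h3 : (fun z : Y × Rn n ↦
      (u z.1 ^ 2 + (2 * Real.pi) ^ 2 * ‖z.2‖ ^ 2) ^ k).HasTemperateGrowth :=
    ((h1.pow 2).add ((Function.HasTemperateGrowth.const ((2 * Real.pi) ^ 2)).mul h2)).pow k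
  have e : (fun z : Y × Rn n ↦ (((u z.1 ^ 2 + (2 * Real.pi * ‖z.2‖) ^ 2) ^ k : ℝ) : ℂ)) =
      Complex.ofReal ∘ fun z : Y × Rn n ↦ (u z.1 ^ 2 + (2 * Real.pi) ^ 2 * ‖z.2‖ ^ 2) ^ k := by
    funext z
    simp only [Function.comp_apply, mul_pow]
  rw [e]
  exact Function.HasTemperateGrowth.comp Function.Complex.hasTemperateGrowth_ofReal h3

theorem exists_fourierL1_Rg_Gs_le (n k : ℕ) :
    ∃ C : ℝ, 0 ≤ C ∧ ∀ (ε τ : ℝ) (_ : 0 < ε) (hτ : 0 < τ),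
      fourierL1 (Rg (2 * k) ε (Gs hτ) : 𝓢(Rn n, ℂ)) ≤
        C * τ ^ (-(k : ℝ)) * Real.exp (τ * ε ^ 2) := by
  have hfam : IsSmoothFamily (Set.Ioi (0 : ℝ))
      (fun ε ↦ (Rg (2 * k) ε (Gs one_pos) : 𝓢(Rn n, ℂ))) := by
    refine isSmoothFamily_mul_cexp (hasTemperateGrowth_reg_pow k (ContinuousLinearMap.id ℝ ℝ))
      (Function.HasTemperateGrowth.const 0) (Gs one_pos) (fun _ _ _ ↦ by simp) (fun ε hε ξ ↦ ?_)
    rw [Rg_apply _ hε, regSymbol_two_mul_nat]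
    simp
  obtain ⟨N, C, hC, hb⟩ := hfam.exists_norm_clm_le
    ((SchwartzMap.toLpCLM ℂ ℂ 1 (volume : Measure (Rn n))).comp (fourierCLM ℂ 𝓢(Rn n, ℂ)))
  have hb' : ∀ ε ∈ Set.Ioi (0 : ℝ),
      fourierL1 (Rg (2 * k) ε (Gs one_pos) : 𝓢(Rn n, ℂ)) ≤ C * (1 + ‖ε‖) ^ N := by
    intro ε hε
    refine le_trans (le_of_eq ?_) (hb ε hε)
    rw [ContinuousLinearMap.comp_apply, SchwartzMap.toLpCLM_apply, SchwartzMap.norm_toLp_one]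
    rfl
  obtain ⟨C', hC'⟩ := gaussian_decay (one_pos) N
  have hC'0 : 0 ≤ C' := le_trans (by positivity) (hC' 0 le_rfl)
  refine ⟨C * C', by positivity, fun ε τ hε hτ ↦ ?_⟩
  have hετ : 0 < ε * √τ := mul_pos hε (Real.sqrt_pos.2 hτ)
  have h1 : (1 + ‖ε * √τ‖) ^ N ≤ C' * Real.exp (τ * ε ^ 2) := by
    rw [Real.norm_of_nonneg hετ.le]
    have h2 := hC' (ε * √τ) hετ.le
    have h3 : -1 * (ε * √τ) ^ 2 = -(τ * ε ^ 2) := by rw [mul_pow, Real.sq_sqrt hτ.le]; ring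
    rwa [h3, Real.exp_neg, ← div_eq_mul_inv, div_le_iff₀ (Real.exp_pos _)] at h2
  rw [fourierL1_Rg_Gs _ hε hτ, mul_div_cancel_left₀ _ two_ne_zero]
  calc _ ≤ τ ^ (-(k : ℝ)) * (C * (C' * Real.exp (τ * ε ^ 2))) := by
        gcongr
        exact (hb' _ hετ).trans (by gcongr)
    _ = _ := by ring

theorem norm_distribution_Mu_le (Θ : 𝓢'(Rn n, ℂ)) {κ : 𝓢(Rn n, ℂ)} {A : ℝ}
    (hA : ∀ x, ‖Θ (Pw x κ)‖ ≤ A) (χ : 𝓢(Rn n, ℂ)) : ‖Θ (Mu κ χ)‖ ≤ A * fourierL1 χ := by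
  rw [distribution_Mu, fourierL1, ← integral_const_mul]
  refine norm_integral_le_of_norm_le (((𝓕 χ).integrable.norm).const_mul A) (.of_forall fun x ↦ ?_)
  rw [norm_mul, mul_comm]
  gcongr
  exact hA x

/-- The bound `|(h_t * T)(x)| ≤ K t^{-b}`, for `Θ = 𝓕 T`. -/
def HasHeatBound (Θ : 𝓢'(Rn n, ℂ)) (K b : ℝ) : Prop :=
  ∀ (t : ℝ) (ht : 0 < t) (x : Rn n), ‖Θ (Pw x (Gs ht))‖ ≤ K * t ^ (-b)

theorem HasHeatBound.nonneg {Θ : 𝓢'(Rn n, ℂ)} {K b : ℝ} (h : HasHeatBound Θ K b) : 0 ≤ K := by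
  have := (norm_nonneg _).trans (h 1 one_pos 0)
  simpa using this

theorem exists_norm_Rg_nat_Pw_Gs_le (n k : ℕ) (b : ℝ) :
    ∃ C : ℝ, 0 ≤ C ∧ ∀ (Θ : 𝓢'(Rn n, ℂ)) (K : ℝ), HasHeatBound Θ K b →
      ∀ (ε v : ℝ) (_ : 0 < ε) (hv : 0 < v) (x : Rn n),
        ‖Θ (Rg (2 * k) ε (Pw x (Gs hv)))‖ ≤ C * K * v ^ (-(k + b)) * Real.exp (v * ε ^ 2) := by
  obtain ⟨C, hC, hL⟩ := exists_fourierL1_Rg_Gs_le n k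
  refine ⟨C * (2 : ℝ)⁻¹ ^ (-(k + b)), by positivity, fun Θ K hΘ ε v hε hv x ↦ ?_⟩
  have hK := hΘ.nonneg
  have hv2 : 0 < v / 2 := by positivity
  have h1 : Rg (2 * k) ε (Pw x (Gs hv)) = Mu (Gs hv2) (Pw x (Rg (2 * k) ε (Gs hv2))) := by
    rw [Mu_Gs, Pw_Rg x _ hε, Ht_Rg hv2.le _ hε, ← Pw_Ht x hv2.le, Ht_Gs hv2 hv2.le]
    congr 3
    simp
  rw [h1]
  refine (norm_distribution_Mu_le Θ (fun x ↦ hΘ _ hv2 x) _).trans ?_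
  rw [fourierL1_Pw]
  calc _ ≤ K * (v / 2) ^ (-b) * (C * (v / 2) ^ (-(k : ℝ)) * Real.exp (v / 2 * ε ^ 2)) := by
        gcongr
        exact hL ε _ hε hv2
    _ ≤ K * (v / 2) ^ (-b) * (C * (v / 2) ^ (-(k : ℝ)) * Real.exp (v * ε ^ 2)) := by
        gcongr
        linarith
    _ = C * K * (v / 2) ^ (-(k + b)) * Real.exp (v * ε ^ 2) := by
        rw [neg_add, Real.rpow_add hv2]
        ring
    _ = _ := by
        rw [div_eq_mul_inv, Real.mul_rpow hv.le (by norm_num)]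
        ring

/-- Passage from the integer power `k` of the regularized Laplacian to the power `σ < k`. -/
theorem norm_Rg_le_of_forall_Ht {Θ : 𝓢'(Rn n, ℂ)} {κ : 𝓢(Rn n, ℂ)} {k : ℕ} {σ b ε c M : ℝ}
    (hσ : 0 < σ) (hσk : σ < k) (hb : 0 < b) (hε : 0 < ε) (hc : 0 < c)
    (h : ∀ v, 0 ≤ v →
      ‖Θ (Rg (2 * k) ε (Ht v κ))‖ ≤ M * (c + v) ^ (-(k + b)) * Real.exp (v * ε ^ 2)) :
    ‖Θ (Rg (2 * σ) ε κ)‖ ≤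
      (Real.Gamma (k - σ))⁻¹ * betaConst (k - σ) (k + b) * M * c ^ (-(σ + b)) := by
  have ha : 0 < k - σ := by linarith
  have hΓ := Real.Gamma_pos_of_pos ha
  have h1 : Rg (2 * σ) ε κ = Rg (-2 * (k - σ)) ε (Rg (2 * k) ε κ) := by
    rw [Rg_Rg _ _ hε]
    congr 2
    ring
  rw [h1, distribution_Rg_neg Θ _ ha hε, norm_mul, norm_inv, Complex.norm_real,
    Real.norm_of_nonneg hΓ.le, mul_assoc, mul_assoc]
  gcongr
  have h2 : betaConst (k - σ) (k + b) * (M * c ^ (-(σ + b))) =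
      ∫ u in Set.Ioi (0 : ℝ), M * (u ^ (k - σ - 1) * (c + u) ^ (-(k + b))) := by
    rw [integral_const_mul, integral_rpow_mul_add_rpow hc]
    ring_nf
  rw [h2]
  refine norm_integral_le_of_norm_le
    ((integrableOn_rpow_mul_add_rpow ha (by linarith) hc).const_mul M)
    ((ae_restrict_iff' measurableSet_Ioi).2 (.of_forall fun u hu ↦ ?_))
  have hu0 : (0 : ℝ) < u := hu
  rw [norm_mul, Complex.norm_real, Real.norm_of_nonneg (by positivity), Ht_Rg hu0.le _ hε]
  calc _ ≤ u ^ (k - σ - 1) * Real.exp (-(ε ^ 2 * u)) *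
        (M * (c + u) ^ (-(k + b)) * Real.exp (u * ε ^ 2)) := by
        gcongr
        exact h u hu0.le
    _ = M * (u ^ (k - σ - 1) * (c + u) ^ (-(k + b))) *
        (Real.exp (-(ε ^ 2 * u)) * Real.exp (u * ε ^ 2)) := by ring
    _ = _ := by
        rw [← Real.exp_add]
        simp [mul_comm]

/-- If `|h_t * T| ≤ K t^{-b}`, then `|(ε² - Δ)^σ h_t * T| ≤ C K t^{-σ-b}` up to a factor which tends
to one as `ε → 0`. -/
theorem exists_norm_Rg_Pw_Gs_le (n : ℕ) {σ b : ℝ} (hσ : 0 < σ) (hb : 0 < b) :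
    ∃ C : ℝ, 0 ≤ C ∧ ∀ (Θ : 𝓢'(Rn n, ℂ)) (K : ℝ), HasHeatBound Θ K b →
      ∀ (ε t : ℝ) (_ : 0 < ε) (ht : 0 < t) (x : Rn n),
        ‖Θ (Rg (2 * σ) ε (Pw x (Gs ht)))‖ ≤ C * K * t ^ (-(σ + b)) * Real.exp (t * ε ^ 2) := by
  obtain ⟨k, hk⟩ := exists_nat_gt σ
  obtain ⟨C, hC, h⟩ := exists_norm_Rg_nat_Pw_Gs_le n k b
  have hΓ := Real.Gamma_pos_of_pos (sub_pos.2 hk)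
  refine ⟨(Real.Gamma (k - σ))⁻¹ * betaConst (k - σ) (k + b) * C,
    mul_nonneg (mul_nonneg (inv_nonneg.2 hΓ.le) (betaConst_nonneg _ _)) hC,
    fun Θ K hΘ ε t hε ht x ↦ ?_⟩
  refine (norm_Rg_le_of_forall_Ht (M := C * K * Real.exp (t * ε ^ 2)) hσ hk hb hε ht
    fun v hv ↦ ?_).trans (le_of_eq (by ring))
  rw [← Pw_Ht x hv, Ht_Gs ht hv]
  refine (h Θ K hΘ ε (t + v) hε _ x).trans (le_of_eq ?_)
  rw [add_mul, Real.exp_add]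
  ring

theorem exists_norm_Rg_nat_Ht_le {Θ : 𝓢'(Rn n, ℂ)} {K b : ℝ} (hb : 0 < b)
    (hΘ : HasHeatBound Θ K b) (k : ℕ) (χ : 𝓢(Rn n, ℂ)) :
    ∃ M : ℝ, 0 ≤ M ∧ ∀ ε ∈ Set.Ioc (0 : ℝ) 1, ∀ v, 0 ≤ v →
      ‖Θ (Rg (2 * k) ε (Ht v χ))‖ ≤ M * (1 + v) ^ (-(k + b)) * Real.exp (v * ε ^ 2) := by
  obtain ⟨C, hC, h⟩ := exists_norm_Rg_nat_Pw_Gs_le n k b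
  have hK := hΘ.nonneg
  have hkb : 0 ≤ k + b := by positivity
  -- for bounded times, the family is bounded in the Schwartz space
  have hfam : IsSmoothFamily {z : ℝ × ℝ | 0 < z.1 ∧ 0 ≤ z.2}
      (fun z ↦ Rg (2 * k) z.1 (Ht z.2 χ)) := by
    have hq : (fun z : (ℝ × ℝ) × Rn n ↦
        ((-(z.1.2 * (2 * Real.pi * ‖z.2‖) ^ 2) : ℝ) : ℂ)).HasTemperateGrowth :=
      hasTemperateGrowth_heat_exponent.comp (((ContinuousLinearMap.snd ℝ ℝ ℝ).prodMap
        (ContinuousLinearMap.id ℝ (Rn n))).hasTemperateGrowth)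
    refine isSmoothFamily_mul_cexp (hasTemperateGrowth_reg_pow k (ContinuousLinearMap.fst ℝ ℝ ℝ))
      hq χ (fun z hz ξ ↦ heat_exponent_nonpos hz.2 ξ) (fun z hz ξ ↦ ?_)
    rw [Rg_apply _ hz.1, Ht_apply hz.2, regSymbol_two_mul_nat, heatSymbol, ← mul_assoc]
    rfl
  obtain ⟨N, A, hA, hN⟩ := hfam.exists_norm_apply_le Θ
  refine ⟨(A * 2 ^ N + C * K * fourierL1 χ) * 2 ^ (k + b),
    mul_nonneg (add_nonneg (by positivity) (mul_nonneg (by positivity) (fourierL1_nonneg _)))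
      (by positivity), fun ε hε v hv ↦ ?_⟩
  have hexp : 1 ≤ Real.exp (v * ε ^ 2) := Real.one_le_exp (by positivity)
  have hχ := fourierL1_nonneg χ
  rcases le_or_gt v 1 with hv1 | hv1
  · have h1 : ‖((ε, v) : ℝ × ℝ)‖ ≤ 1 := by
      rw [Prod.norm_def, Real.norm_of_nonneg hε.1.le, Real.norm_of_nonneg hv]
      exact max_le hε.2 hv1
    have h2 : 1 ≤ (2 : ℝ) ^ (k + b) * (1 + v) ^ (-(k + b)) := by
      rw [Real.rpow_neg (by positivity), ← div_eq_mul_inv, one_le_div (by positivity)]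
      exact Real.rpow_le_rpow (by positivity) (by linarith) hkb
    calc _ ≤ A * (1 + ‖((ε, v) : ℝ × ℝ)‖) ^ N := hN (ε, v) ⟨hε.1, hv⟩
      _ ≤ A * 2 ^ N * 1 * 1 := by
        rw [mul_one, mul_one]
        gcongr
        linarith
      _ ≤ (A * 2 ^ N + C * K * fourierL1 χ) * ((2 : ℝ) ^ (k + b) * (1 + v) ^ (-(k + b))) *
          Real.exp (v * ε ^ 2) := by
        gcongr
        exact le_add_of_nonneg_right (by positivity)
      _ = _ := by ring
  · have hv0 : 0 < v := by linarith
    have h1 : Rg (2 * k) ε (Ht v χ) = Mu (Rg (2 * k) ε (Gs hv0)) χ := by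
      ext ξ
      rw [Rg_apply _ hε.1, Ht_apply hv, Mu_apply, Rg_apply _ hε.1, Gs_apply, mul_assoc]
    have h2 : v ^ (-(k + b)) ≤ (2 : ℝ) ^ (k + b) * (1 + v) ^ (-(k + b)) := by
      rw [Real.rpow_neg hv, Real.rpow_neg (by positivity), ← div_eq_mul_inv,
        ← Real.div_rpow (by norm_num) (by positivity), ← Real.inv_rpow hv]
      refine Real.rpow_le_rpow (by positivity) ?_ hkb
      rw [inv_eq_one_div, div_le_div_iff₀ hv0 (by positivity)]
      linarith
    rw [h1]
    refine (norm_distribution_Mu_le Θ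
      (A := C * K * v ^ (-(k + b)) * Real.exp (v * ε ^ 2)) (fun x ↦ ?_) χ).trans ?_
    · rw [Pw_Rg x _ hε.1]
      exact h Θ K hΘ ε v hε.1 hv0 x
    · calc _ = C * K * fourierL1 χ * v ^ (-(k + b)) * Real.exp (v * ε ^ 2) := by ring
        _ ≤ (A * 2 ^ N + C * K * fourierL1 χ) * ((2 : ℝ) ^ (k + b) * (1 + v) ^ (-(k + b))) *
          Real.exp (v * ε ^ 2) := by
          gcongr
          exact le_add_of_nonneg_left (by positivity)
        _ = _ := by ring

theorem exists_norm_Rg_Ht_le {Θ : 𝓢'(Rn n, ℂ)} {K σ b : ℝ} (hσ : 0 < σ) (hb : 0 < b)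
    (hΘ : HasHeatBound Θ K b) (χ : 𝓢(Rn n, ℂ)) :
    ∃ M : ℝ, 0 ≤ M ∧ ∀ ε ∈ Set.Ioc (0 : ℝ) 1, ∀ t, 0 ≤ t →
      ‖Θ (Rg (2 * σ) ε (Ht t χ))‖ ≤ M * (1 + t) ^ (-(σ + b)) * Real.exp (t * ε ^ 2) := by
  obtain ⟨k, hk⟩ := exists_nat_gt σ
  obtain ⟨M, hM, h⟩ := exists_norm_Rg_nat_Ht_le hb hΘ k χ
  have hΓ := Real.Gamma_pos_of_pos (sub_pos.2 hk)
  refine ⟨(Real.Gamma (k - σ))⁻¹ * betaConst (k - σ) (k + b) * M,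
    mul_nonneg (mul_nonneg (inv_nonneg.2 hΓ.le) (betaConst_nonneg _ _)) hM,
    fun ε hε t ht ↦ ?_⟩
  refine (norm_Rg_le_of_forall_Ht (M := M * Real.exp (t * ε ^ 2)) (c := 1 + t) hσ hk hb hε.1
    (by positivity) fun v hv ↦ ?_).trans (le_of_eq (by ring))
  rw [Ht_Ht hv ht]
  refine (h ε hε (v + t) (by positivity)).trans (le_of_eq ?_)
  rw [add_mul, Real.exp_add]
  have : 1 + (v + t) = 1 + t + v := by ring
  rw [this]
  ring

end BesovDecay

/-! ### Removing the regularization of the fractional Laplacian -/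

section RemoveRegularization

variable {n : ℕ}

/-- `V` is the limit of `(ε² + |2πξ|²)^{s/2} Θ` as `ε → 0⁺`, tested against Schwartz functions. For
`Θ = 𝓕 T` and `V = 𝓕 U`, this says that `U = (-Δ)^{s/2} T`. -/
def IsSymbolLimit (s : ℝ) (Θ V : 𝓢'(Rn n, ℂ)) : Prop :=
  ∀ χ : 𝓢(Rn n, ℂ), Tendsto (fun ε : ℝ ↦ Θ (Rg s ε χ)) (𝓝[>] 0) (𝓝 (V χ))

theorem isFracLaplacian_iff {s : ℝ} {T U : 𝓢'(Rn n, ℂ)} :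
    IsFracLaplacian s T U ↔ IsSymbolLimit s (𝓕 T) (𝓕 U) := by
  rw [IsFracLaplacian, PointwiseConvergenceCLM.tendsto_iff_forall_tendsto]
  rfl

/-- The operator `(-Δ)^σ` maps distributions with `|h_t * T| ≤ K t^{-b}` to distributions with
`|h_t * U| ≤ C K t^{-σ-b}`. -/
theorem exists_hasHeatBound_of_isSymbolLimit (n : ℕ) {σ b : ℝ} (hσ : 0 < σ) (hb : 0 < b) :
    ∃ C : ℝ, 0 ≤ C ∧ ∀ (Θ V : 𝓢'(Rn n, ℂ)) (K : ℝ), IsSymbolLimit (2 * σ) Θ V →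
      HasHeatBound Θ K b → HasHeatBound V (C * K) (σ + b) := by
  obtain ⟨C, hC, h⟩ := exists_norm_Rg_Pw_Gs_le n hσ hb
  refine ⟨C, hC, fun Θ V K hV hΘ t ht x ↦ ?_⟩
  have h1 : Tendsto (fun ε : ℝ ↦ C * K * t ^ (-(σ + b)) * Real.exp (t * ε ^ 2)) (𝓝[>] 0)
      (𝓝 (C * K * t ^ (-(σ + b)) * Real.exp (t * 0 ^ 2))) :=
    (Continuous.tendsto (by fun_prop) 0).mono_left nhdsWithin_le_nhds
  have h2 : C * K * t ^ (-(σ + b)) * Real.exp (t * 0 ^ 2) = C * K * t ^ (-(σ + b)) := by simp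
  rw [h2] at h1
  exact le_of_tendsto_of_tendsto (hV _).norm h1
    (eventually_nhdsWithin_of_forall fun ε hε ↦ h Θ K hΘ ε t hε ht x)

/-- `(-Δ)^{σ-a} T = Γ(a)⁻¹ ∫₀^∞ t^{a-1} e^{tΔ} U dt` for `U = (-Δ)^σ T`, the integral converging as
`T` lies in a Besov space of negative order. -/
theorem tendsto_Rg_of_isSymbolLimit {Θ V : 𝓢'(Rn n, ℂ)} {K σ a b : ℝ} (hσ : 0 < σ) (ha : 0 < a)
    (haσ : a ≤ σ) (hb : 0 < b) (hV : IsSymbolLimit (2 * σ) Θ V) (hΘ : HasHeatBound Θ K b)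
    (χ : 𝓢(Rn n, ℂ)) :
    Tendsto (fun ε : ℝ ↦ Θ (Rg (2 * (σ - a)) ε χ)) (𝓝[>] 0)
      (𝓝 (((Real.Gamma a)⁻¹ : ℂ) *
        ∫ t in Set.Ioi (0 : ℝ), ((t ^ (a - 1) : ℝ) : ℂ) * V (Ht t χ))) := by
  obtain ⟨M, hM, h⟩ := exists_norm_Rg_Ht_le hσ hb hΘ χ
  have h1 : ∀ᶠ ε : ℝ in 𝓝[>] 0, ((Real.Gamma a)⁻¹ : ℂ) * ∫ t in Set.Ioi (0 : ℝ),
      ((t ^ (a - 1) * Real.exp (-(ε ^ 2 * t)) : ℝ) : ℂ) * Θ (Ht t (Rg (2 * σ) ε χ)) =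
      Θ (Rg (2 * (σ - a)) ε χ) := by
    refine eventually_nhdsWithin_of_forall fun ε hε ↦ ?_
    rw [← distribution_Rg_neg Θ _ ha hε, Rg_Rg _ _ hε]
    congr 3
    ring
  refine Tendsto.congr' h1 (Tendsto.const_mul _ ?_)
  refine tendsto_integral_filter_of_dominated_convergence
    (fun t ↦ M * (t ^ (a - 1) * (1 + t) ^ (-(σ + b)))) ?_ ?_ ?_ ?_
  · refine eventually_nhdsWithin_of_forall fun ε hε ↦ ?_
    have := ((isSmoothFamily_Ht (Rg (2 * σ) ε χ)).continuousOn_distribution Θ).mono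
      Set.Ioi_subset_Ici_self
    exact (by fun_prop : Measurable fun t : ℝ ↦
      ((t ^ (a - 1) * Real.exp (-(ε ^ 2 * t)) : ℝ) : ℂ)).aestronglyMeasurable.mul
      (this.aestronglyMeasurable measurableSet_Ioi)
  · filter_upwards [Ioc_mem_nhdsGT (zero_lt_one (α := ℝ))] with ε hε
    refine (ae_restrict_iff' measurableSet_Ioi).2 (.of_forall fun t ht ↦ ?_)
    have ht0 : 0 < t := ht
    rw [norm_mul, Complex.norm_real, Real.norm_of_nonneg (by positivity), Ht_Rg ht0.le _ hε.1]
    calc _ ≤ t ^ (a - 1) * Real.exp (-(ε ^ 2 * t)) *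
          (M * (1 + t) ^ (-(σ + b)) * Real.exp (t * ε ^ 2)) := by
          gcongr
          exact h ε hε t ht0.le
      _ = M * (t ^ (a - 1) * (1 + t) ^ (-(σ + b))) *
          (Real.exp (-(ε ^ 2 * t)) * Real.exp (t * ε ^ 2)) := by ring
      _ = _ := by
          rw [← Real.exp_add]
          simp [mul_comm]
  · exact (integrableOn_rpow_mul_one_add_rpow ha (by linarith)).const_mul M
  · refine (ae_restrict_iff' measurableSet_Ioi).2 (.of_forall fun t ht ↦ ?_)
    have ht0 : 0 < t := ht
    refine Tendsto.mul ?_ ?_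
    · have : Tendsto (fun ε : ℝ ↦ ((t ^ (a - 1) * Real.exp (-(ε ^ 2 * t)) : ℝ) : ℂ)) (𝓝[>] 0)
          (𝓝 ((t ^ (a - 1) * Real.exp (-(0 ^ 2 * t)) : ℝ) : ℂ)) :=
        (Continuous.tendsto (by fun_prop) 0).mono_left nhdsWithin_le_nhds
      simpa using this
    · refine Tendsto.congr' (eventually_nhdsWithin_of_forall fun ε hε ↦ ?_) (hV (Ht t χ))
      beta_reduce
      rw [Ht_Rg ht0.le _ hε]

end RemoveRegularization

/-! ### The Hardy-Littlewood maximal function -/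

section Maximal

variable {n : ℕ}

/-- The Hardy-Littlewood maximal function, with the supremum over the balls with centre `x` whose
radius is a power of two. This countable supremum is measurable, and comparable with the supremum
over all radii. -/
def maximalFn (f : Rn n → ℝ≥0∞) (x : Rn n) : ℝ≥0∞ :=
  ⨆ j : ℤ, (volume (Metric.closedBall x (2 ^ j : ℝ)))⁻¹ *
    ∫⁻ y in Metric.closedBall x (2 ^ j : ℝ), f y

theorem volume_closedBall_eq (x : Rn n) {r : ℝ} (hr : 0 ≤ r) :
    volume (Metric.closedBall x r) =
      ENNReal.ofReal (r ^ n) * volume (Metric.closedBall (0 : Rn n) 1) := by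
  have := Measure.addHaar_closedBall_mul (volume : Measure (Rn n)) x hr (zero_le_one)
  rwa [mul_one, finrank_euclideanSpace_fin] at this

theorem volume_closedBall_pos (x : Rn n) {r : ℝ} (hr : 0 < r) :
    volume (Metric.closedBall x r) ≠ 0 :=
  (Metric.measure_closedBall_pos volume x hr).ne'

theorem volume_closedBall_ne_top (x : Rn n) (r : ℝ) : volume (Metric.closedBall x r) ≠ ⊤ :=
  measure_closedBall_lt_top.ne

theorem measurable_lintegral_closedBall {f : Rn n → ℝ≥0∞} (hf : Measurable f) (r : ℝ) :
    Measurable (fun x ↦ ∫⁻ y in Metric.closedBall x r, f y) := by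
  have h1 : ∀ x : Rn n, ∫⁻ y in Metric.closedBall x r, f y =
      ∫⁻ y, {z : Rn n × Rn n | dist z.2 z.1 ≤ r}.indicator (fun z ↦ f z.2) (x, y) := by
    intro x
    rw [← lintegral_indicator Metric.isClosed_closedBall.measurableSet]
    rfl
  simp_rw [h1]
  refine Measurable.lintegral_prod_right' ?_
  exact (hf.comp measurable_snd).indicator
    (measurableSet_le (measurable_snd.dist measurable_fst) measurable_const)

theorem measurable_maximalFn {f : Rn n → ℝ≥0∞} (hf : Measurable f) : Measurable (maximalFn f) := by
  refine Measurable.iSup fun j ↦ Measurable.mul ?_ (measurable_lintegral_closedBall hf _)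
  have : (fun x : Rn n ↦ (volume (Metric.closedBall x (2 ^ j : ℝ)))⁻¹) =
      fun _ ↦ (volume (Metric.closedBall (0 : Rn n) (2 ^ j : ℝ)))⁻¹ := by
    funext x
    rw [Measure.addHaar_closedBall_center]
  rw [this]
  exact measurable_const

theorem maximalFn_mono_ae {f g : Rn n → ℝ≥0∞} (h : f ≤ᵐ[volume] g) (x : Rn n) :
    maximalFn f x ≤ maximalFn g x :=
  iSup_mono fun _ ↦ mul_le_mul_right (lintegral_mono_ae (ae_restrict_of_ae h)) _

theorem maximalFn_mono {f g : Rn n → ℝ≥0∞} (h : f ≤ g) (x : Rn n) :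
    maximalFn f x ≤ maximalFn g x :=
  maximalFn_mono_ae (.of_forall h) x

theorem maximalFn_add_le {f g : Rn n → ℝ≥0∞} (hf : Measurable f) (x : Rn n) :
    maximalFn (fun y ↦ f y + g y) x ≤ maximalFn f x + maximalFn g x := by
  refine iSup_le fun j ↦ ?_
  rw [lintegral_add_left hf, mul_add]
  exact add_le_add (le_iSup (fun j : ℤ ↦ (volume (Metric.closedBall x (2 ^ j : ℝ)))⁻¹ *
    ∫⁻ y in Metric.closedBall x (2 ^ j : ℝ), f y) j) (le_iSup (fun j : ℤ ↦
    (volume (Metric.closedBall x (2 ^ j : ℝ)))⁻¹ *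
    ∫⁻ y in Metric.closedBall x (2 ^ j : ℝ), g y) j)

theorem maximalFn_const_le (c : ℝ≥0∞) (x : Rn n) : maximalFn (fun _ ↦ c) x ≤ c := by
  refine iSup_le fun j ↦ ?_
  rw [setLIntegral_const, mul_comm c, ← mul_assoc,
    ENNReal.inv_mul_cancel (volume_closedBall_pos x (by positivity)) (volume_closedBall_ne_top x _),
    one_mul]

/-- Integrals over balls of arbitrary radius are controlled by the maximal function. -/
theorem lintegral_closedBall_le (f : Rn n → ℝ≥0∞) (x : Rn n) {r : ℝ} (hr : 0 < r) :
    ∫⁻ y in Metric.closedBall x r, f y ≤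
      ENNReal.ofReal ((2 * r) ^ n) * volume (Metric.closedBall (0 : Rn n) 1) * maximalFn f x := by
  obtain ⟨j, hj1, hj2⟩ := exists_mem_Ioc_zpow hr (one_lt_two : (1 : ℝ) < 2)
  have h0 : (0 : ℝ) < 2 ^ (j + 1) := by positivity
  have h1 : (2 : ℝ) ^ (j + 1) ≤ 2 * r := by
    rw [zpow_add_one₀ two_ne_zero]
    linarith
  calc ∫⁻ y in Metric.closedBall x r, f y
      ≤ ∫⁻ y in Metric.closedBall x (2 ^ (j + 1) : ℝ), f y :=
        lintegral_mono_set (Metric.closedBall_subset_closedBall hj2)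
    _ = volume (Metric.closedBall x (2 ^ (j + 1) : ℝ)) *
        ((volume (Metric.closedBall x (2 ^ (j + 1) : ℝ)))⁻¹ *
          ∫⁻ y in Metric.closedBall x (2 ^ (j + 1) : ℝ), f y) := by
        rw [← mul_assoc, ENNReal.mul_inv_cancel (volume_closedBall_pos x h0)
          (volume_closedBall_ne_top x _), one_mul]
    _ ≤ volume (Metric.closedBall x (2 ^ (j + 1) : ℝ)) * maximalFn f x := by
        gcongr
        exact le_iSup (fun j : ℤ ↦ (volume (Metric.closedBall x (2 ^ j : ℝ)))⁻¹ *
          ∫⁻ y in Metric.closedBall x (2 ^ j : ℝ), f y) (j + 1)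
    _ ≤ _ := by
        rw [volume_closedBall_eq x h0.le]
        gcongr

/-- The weak type (1,1) bound, for the balls of radius at most `2 ^ J`. -/
theorem volume_exists_avg_gt_le (f : Rn n → ℝ≥0∞) {l : ℝ≥0∞} (hl : l ≠ 0) (hl' : l ≠ ⊤) (J : ℤ) :
    volume {x | ∃ j ≤ J, l < (volume (Metric.closedBall x (2 ^ j : ℝ)))⁻¹ *
      ∫⁻ y in Metric.closedBall x (2 ^ j : ℝ), f y} ≤ 5 ^ n * (l⁻¹ * ∫⁻ y, f y) := by
  set t : Set (Rn n × ℤ) := {z | z.2 ≤ J ∧ l < (volume (Metric.closedBall z.1 (2 ^ z.2 : ℝ)))⁻¹ *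
      ∫⁻ y in Metric.closedBall z.1 (2 ^ z.2 : ℝ), f y} with ht
  obtain ⟨u, hut, hdisj, hcov⟩ := Vitali.exists_disjoint_subfamily_covering_enlargement_closedBall
    t (fun z ↦ z.1) (fun z ↦ (2 ^ z.2 : ℝ)) (2 ^ J)
    (fun z hz ↦ zpow_le_zpow_right₀ one_le_two hz.1) 5 (by norm_num)
  have hu : u.Countable := by
    refine hdisj.countable_of_nonempty_interior fun z _ ↦ ?_
    exact ⟨z.1, Metric.ball_subset_interior_closedBall (Metric.mem_ball_self (by positivity))⟩
  have hball : ∀ z ∈ u, volume (Metric.closedBall z.1 (5 * 2 ^ z.2 : ℝ)) ≤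
      5 ^ n * (l⁻¹ * ∫⁻ y in Metric.closedBall z.1 (2 ^ z.2 : ℝ), f y) := by
    intro z hz
    have h1 := (hut hz).2
    have hp := volume_closedBall_pos z.1 (r := (2 : ℝ) ^ z.2) (by positivity)
    have hf := volume_closedBall_ne_top z.1 ((2 : ℝ) ^ z.2)
    have h2 : volume (Metric.closedBall z.1 (5 * 2 ^ z.2 : ℝ)) =
        5 ^ n * volume (Metric.closedBall z.1 (2 ^ z.2 : ℝ)) := by
      rw [volume_closedBall_eq z.1 (r := 5 * 2 ^ z.2) (by positivity),
        volume_closedBall_eq z.1 (r := 2 ^ z.2) (by positivity), mul_pow,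
        ENNReal.ofReal_mul (by positivity), mul_assoc, ENNReal.ofReal_pow (by norm_num),
        ENNReal.ofReal_ofNat]
    rw [h2]
    gcongr
    rw [mul_comm, ← div_eq_mul_inv, ENNReal.lt_div_iff_mul_lt (.inl hp) (.inl hf)] at h1
    rw [mul_comm, ← div_eq_mul_inv, ENNReal.le_div_iff_mul_le (.inl hl) (.inl hl'), mul_comm]
    exact h1.le
  calc _ ≤ volume (⋃ z ∈ u, Metric.closedBall z.1 (5 * 2 ^ z.2 : ℝ)) := by
        refine measure_mono fun x hx ↦ ?_
        obtain ⟨j, hj, hx⟩ := hx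
        obtain ⟨z, hz, hsub⟩ := hcov (x, j) ⟨hj, hx⟩
        exact Set.mem_biUnion hz (hsub (Metric.mem_closedBall_self (by positivity)))
    _ ≤ ∑' z : u, volume (Metric.closedBall z.1.1 (5 * 2 ^ z.1.2 : ℝ)) :=
        measure_biUnion_le volume hu _
    _ ≤ ∑' z : u, 5 ^ n * (l⁻¹ * ∫⁻ y in Metric.closedBall z.1.1 (2 ^ z.1.2 : ℝ), f y) :=
        ENNReal.tsum_le_tsum fun z ↦ hball z.1 z.2
    _ = 5 ^ n * (l⁻¹ * ∫⁻ y in ⋃ z ∈ u, Metric.closedBall z.1 (2 ^ z.2 : ℝ), f y) := by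
        rw [ENNReal.tsum_mul_left, ENNReal.tsum_mul_left, lintegral_biUnion hu
          (fun z _ ↦ Metric.isClosed_closedBall.measurableSet) hdisj]
    _ ≤ _ := by
        gcongr
        exact Measure.restrict_le_self

/-- The weak type (1,1) bound. -/
theorem volume_lt_maximalFn_le (f : Rn n → ℝ≥0∞) {l : ℝ≥0∞} (hl : l ≠ 0) (hl' : l ≠ ⊤) :
    volume {x | l < maximalFn f x} ≤ 5 ^ n * (l⁻¹ * ∫⁻ y, f y) := by
  have h1 : {x | l < maximalFn f x} = ⋃ J : ℤ, {x | ∃ j ≤ J,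
      l < (volume (Metric.closedBall x (2 ^ j : ℝ)))⁻¹ *
      ∫⁻ y in Metric.closedBall x (2 ^ j : ℝ), f y} := by
    ext x
    simp only [Set.mem_ofPred_eq, maximalFn, lt_iSup_iff, Set.mem_iUnion]
    exact ⟨fun ⟨j, hj⟩ ↦ ⟨j, j, le_rfl, hj⟩, fun ⟨_, j, _, hj⟩ ↦ ⟨j, hj⟩⟩
  rw [h1, Monotone.measure_iUnion]
  · exact iSup_le fun J ↦ volume_exists_avg_gt_le f hl hl' J
  · intro J J' hJ x ⟨j, hj, hx⟩
    exact ⟨j, hj.trans hJ, hx⟩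

theorem lintegral_Ioo_rpow {e : ℝ} (he : 0 < e) {A : ℝ} (hA : 0 ≤ A) :
    ∫⁻ l in Set.Ioo (0 : ℝ) A, ENNReal.ofReal (l ^ (e - 1)) =
      (ENNReal.ofReal e)⁻¹ * ENNReal.ofReal A ^ e := by
  have h1 : IntervalIntegrable (fun l : ℝ ↦ l ^ (e - 1)) volume 0 A :=
    intervalIntegral.intervalIntegrable_rpow' (by linarith)
  have h2 := integral_rpow (a := 0) (b := A) (r := e - 1) (.inl (by linarith))
  rw [sub_add_cancel, Real.zero_rpow he.ne', sub_zero, intervalIntegral.integral_of_le hA,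
    integral_Ioc_eq_integral_Ioo] at h2
  rw [intervalIntegrable_iff_integrableOn_Ioo_of_le hA] at h1
  rw [← ofReal_integral_eq_lintegral_ofReal h1 ((ae_restrict_iff' measurableSet_Ioo).2
    (.of_forall fun l hl ↦ Real.rpow_nonneg hl.1.le _)), h2, ENNReal.ofReal_rpow_of_nonneg hA he.le,
    ← ENNReal.ofReal_inv_of_pos he, ← ENNReal.ofReal_mul (by positivity), div_eq_inv_mul]

/-- The layer cake formula `a^e = e ∫₀^a l^{e-1} dl`, also for `a = ∞`. -/
theorem lintegral_rpow_mul_indicator {e : ℝ} (he : 0 < e) (a : ℝ≥0∞) :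
    ∫⁻ l in Set.Ioi (0 : ℝ), ENNReal.ofReal (l ^ (e - 1)) *
      {l : ℝ | ENNReal.ofReal l < a}.indicator 1 l = (ENNReal.ofReal e)⁻¹ * a ^ e := by
  have h0 : ∀ A : ℝ, 0 ≤ A → ∫⁻ l in Set.Ioi (0 : ℝ), ENNReal.ofReal (l ^ (e - 1)) *
      {l : ℝ | ENNReal.ofReal l < ENNReal.ofReal A}.indicator 1 l =
      (ENNReal.ofReal e)⁻¹ * ENNReal.ofReal A ^ e := by
    intro A hA
    rw [← lintegral_Ioo_rpow he hA, ← lintegral_indicator measurableSet_Ioi,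
      ← lintegral_indicator measurableSet_Ioo]
    refine lintegral_congr fun l ↦ ?_
    by_cases hl : 0 < l
    · by_cases hlA : l < A
      · simp [Set.indicator, hl, hlA, (ENNReal.ofReal_lt_ofReal_iff_of_nonneg hl.le)]
      · simp [Set.indicator, hl, hlA, (ENNReal.ofReal_lt_ofReal_iff_of_nonneg hl.le)]
    · simp [Set.indicator, hl]
  induction a with
  | coe a => simpa using h0 a a.2
  | top =>
    have hc : (ENNReal.ofReal e)⁻¹ ≠ 0 := by simp
    rw [ENNReal.top_rpow_of_pos he, ENNReal.mul_top hc]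
    refine ENNReal.eq_top_of_forall_nnreal_le fun r ↦ ?_
    obtain ⟨A, hA0, hA⟩ : ∃ A : ℝ, 0 ≤ A ∧
        (r : ℝ≥0∞) = (ENNReal.ofReal e)⁻¹ * ENNReal.ofReal A ^ e := by
      refine ⟨(e * r) ^ e⁻¹, by positivity, ?_⟩
      rw [ENNReal.ofReal_rpow_of_nonneg (by positivity) he.le, Real.rpow_inv_rpow (by positivity)
        he.ne', ← ENNReal.ofReal_inv_of_pos he, ← ENNReal.ofReal_mul (by positivity),
        inv_mul_cancel_left₀ he.ne', ENNReal.ofReal_coe_nnreal]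
    rw [hA, ← h0 A hA0]
    refine lintegral_mono fun l ↦ ?_
    gcongr
    simp

theorem lintegral_rpow_eq_layercake {f : Rn n → ℝ≥0∞} (hf : Measurable f) {e : ℝ} (he : 0 < e)
    {w : Rn n → ℝ≥0∞} (hw : Measurable w) :
    (ENNReal.ofReal e)⁻¹ * ∫⁻ x, w x * f x ^ e =
      ∫⁻ l in Set.Ioi (0 : ℝ), ENNReal.ofReal (l ^ (e - 1)) *
        ∫⁻ x in {x | ENNReal.ofReal l < f x}, w x := by
  have hmeas : Measurable (fun z : Rn n × ℝ ↦
      {z : Rn n × ℝ | ENNReal.ofReal z.2 < f z.1}.indicator (1 : Rn n × ℝ → ℝ≥0∞) z) :=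
    measurable_one.indicator (measurableSet_lt (by fun_prop) (by fun_prop))
  calc _ = ∫⁻ x, w x * ∫⁻ l in Set.Ioi (0 : ℝ), ENNReal.ofReal (l ^ (e - 1)) *
          {l : ℝ | ENNReal.ofReal l < f x}.indicator 1 l := by
        rw [← lintegral_const_mul' _ _ (by simp [he])]
        refine lintegral_congr fun x ↦ ?_
        rw [lintegral_rpow_mul_indicator he]
        ring
    _ = ∫⁻ x, ∫⁻ l in Set.Ioi (0 : ℝ), w x * (ENNReal.ofReal (l ^ (e - 1)) *
          {z : Rn n × ℝ | ENNReal.ofReal z.2 < f z.1}.indicator 1 (x, l)) := by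
        refine lintegral_congr fun x ↦ ?_
        rw [← lintegral_const_mul]
        · rfl
        · exact (by fun_prop : Measurable fun l : ℝ ↦ ENNReal.ofReal (l ^ (e - 1))).mul
            (hmeas.comp measurable_prodMk_left)
    _ = ∫⁻ l in Set.Ioi (0 : ℝ), ∫⁻ x, w x * (ENNReal.ofReal (l ^ (e - 1)) *
          {z : Rn n × ℝ | ENNReal.ofReal z.2 < f z.1}.indicator 1 (x, l)) := by
        refine lintegral_lintegral_swap (Measurable.aemeasurable ?_)
        exact (hw.comp measurable_fst).mul
          ((by fun_prop : Measurable fun z : Rn n × ℝ ↦ ENNReal.ofReal (z.2 ^ (e - 1))).mul hmeas)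
    _ = _ := by
        refine lintegral_congr fun l ↦ ?_
        rw [← lintegral_indicator (measurableSet_lt measurable_const hf),
          ← lintegral_const_mul' _ _ ENNReal.ofReal_ne_top]
        refine lintegral_congr fun x ↦ ?_
        by_cases hx : ENNReal.ofReal l < f x <;> simp [Set.indicator, hx, mul_comm]

/-- The maximal function is bounded on `L^q`, `1 < q < ∞`. -/
theorem exists_lintegral_maximalFn_rpow_le (n : ℕ) {q : ℝ} (hq : 1 < q) :
    ∃ C : ℝ≥0∞, C ≠ ⊤ ∧ ∀ f : Rn n → ℝ≥0∞, Measurable f →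
      ∫⁻ x, maximalFn f x ^ q ≤ C * ∫⁻ x, f x ^ q := by
  have hq0 : 0 < q := by linarith
  have hq1 : 0 < q - 1 := by linarith
  refine ⟨ENNReal.ofReal q * (5 ^ n * 2 * ((ENNReal.ofReal (q - 1))⁻¹ * 2 ^ (q - 1))), ?_,
    fun f hf ↦ ?_⟩
  · refine ENNReal.mul_ne_top ENNReal.ofReal_ne_top (ENNReal.mul_ne_top
      (ENNReal.mul_ne_top (by finiteness) (by simp)) (ENNReal.mul_ne_top (by simp [hq]) ?_))
    exact ENNReal.rpow_ne_top_of_nonneg hq1.le (by simp)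
  have hM := measurable_maximalFn hf
  have h1 := lintegral_rpow_eq_layercake hM hq0 (w := fun _ ↦ 1) measurable_const
  have h2 := lintegral_rpow_eq_layercake (f := fun x ↦ 2 * f x) (by fun_prop) hq1 hf
  simp only [one_mul, setLIntegral_one] at h1
  -- split `f` at height `l / 2`
  have h3 : ∀ l : ℝ, 0 < l → volume {x | ENNReal.ofReal l < maximalFn f x} ≤
      5 ^ n * 2 * (ENNReal.ofReal l⁻¹ * ∫⁻ x in {x | ENNReal.ofReal l < 2 * f x}, f x) := by
    intro l hl
    set S : Set (Rn n) := {x | ENNReal.ofReal l < 2 * f x} with hS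
    have hSm : MeasurableSet S := measurableSet_lt measurable_const (by fun_prop)
    have hle : ∀ x, f x ≤ S.indicator f x + ENNReal.ofReal (l / 2) := by
      intro x
      by_cases hx : x ∈ S
      · rw [Set.indicator_of_mem hx]
        exact le_self_add
      · rw [Set.indicator_of_notMem hx, zero_add]
        rw [hS, Set.mem_ofPred_eq, not_lt] at hx
        rw [ENNReal.ofReal_div_of_pos two_pos, ENNReal.ofReal_ofNat,
          ENNReal.le_div_iff_mul_le (by simp) (by simp), mul_comm]
        exact hx
    have hsub : {x | ENNReal.ofReal l < maximalFn f x} ⊆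
        {x | ENNReal.ofReal (l / 2) < maximalFn (S.indicator f) x} := by
      intro x hx
      by_contra hcon
      rw [Set.mem_ofPred_eq, not_lt] at hcon
      have : maximalFn f x ≤ ENNReal.ofReal l := by
        calc maximalFn f x
            ≤ maximalFn (fun x ↦ S.indicator f x + ENNReal.ofReal (l / 2)) x :=
              maximalFn_mono hle x
          _ ≤ maximalFn (S.indicator f) x + maximalFn (fun _ ↦ ENNReal.ofReal (l / 2)) x :=
              maximalFn_add_le (hf.indicator hSm) x
          _ ≤ ENNReal.ofReal (l / 2) + ENNReal.ofReal (l / 2) :=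
              add_le_add hcon (maximalFn_const_le _ x)
          _ = ENNReal.ofReal l := by
              rw [← ENNReal.ofReal_add (by positivity) (by positivity), add_halves]
      exact absurd hx (not_lt.2 this)
    refine (measure_mono hsub).trans ((volume_lt_maximalFn_le _ (by simpa using hl)
      ENNReal.ofReal_ne_top).trans (le_of_eq ?_))
    rw [lintegral_indicator hSm, ENNReal.ofReal_div_of_pos two_pos, ENNReal.inv_div (by simp)
      (by simp), ENNReal.ofReal_inv_of_pos hl, div_eq_mul_inv, ENNReal.ofReal_ofNat]
    ring
  have h4 : (ENNReal.ofReal q)⁻¹ * ∫⁻ x, maximalFn f x ^ q ≤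
      5 ^ n * 2 * ((ENNReal.ofReal (q - 1))⁻¹ * ∫⁻ x, f x * (2 * f x) ^ (q - 1)) := by
    rw [h1, h2, ← lintegral_const_mul' _ _ (by finiteness)]
    refine setLIntegral_mono' measurableSet_Ioi fun l hl ↦ ?_
    have hl0 : 0 < l := hl
    have h5 : l ^ (q - 1 - 1) = l ^ (q - 1) * l⁻¹ := by
      rw [Real.rpow_sub_one hl0.ne', div_eq_mul_inv]
    rw [h5, ENNReal.ofReal_mul (by positivity)]
    calc _ ≤ ENNReal.ofReal (l ^ (q - 1)) * (5 ^ n * 2 * (ENNReal.ofReal l⁻¹ *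
          ∫⁻ x in {x | ENNReal.ofReal l < 2 * f x}, f x)) := by
          gcongr
          exact h3 l hl0
      _ = _ := by ring
  have h6 : ∫⁻ x, f x * (2 * f x) ^ (q - 1) = 2 ^ (q - 1) * ∫⁻ x, f x ^ q := by
    rw [← lintegral_const_mul _ (hf.pow_const q)]
    refine lintegral_congr fun x ↦ ?_
    rw [ENNReal.mul_rpow_of_nonneg _ _ hq1.le, mul_left_comm]
    congr 1
    nth_rewrite 1 [← ENNReal.rpow_one (f x)]
    rw [← ENNReal.rpow_add_of_nonneg _ _ zero_le_one hq1.le]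
    congr 1
    ring
  have h7 : ENNReal.ofReal q * (ENNReal.ofReal q)⁻¹ = 1 :=
    ENNReal.mul_inv_cancel (by simpa using hq0) ENNReal.ofReal_ne_top
  calc _ = ENNReal.ofReal q * ((ENNReal.ofReal q)⁻¹ * ∫⁻ x, maximalFn f x ^ q) := by
        rw [← mul_assoc, h7, one_mul]
    _ ≤ ENNReal.ofReal q * (5 ^ n * 2 * ((ENNReal.ofReal (q - 1))⁻¹ *
        ∫⁻ x, f x * (2 * f x) ^ (q - 1))) := by gcongr
    _ = _ := by
        rw [h6]
        ring

/-- Kernels with the decay `(1 + u)^{-n-1}` are sums of characteristic functions of balls with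
summable coefficients. -/
theorem inv_one_add_pow_le_tsum (n : ℕ) {u : ℝ} (hu : 0 ≤ u) :
    ENNReal.ofReal (((1 + u) ^ (n + 1))⁻¹) ≤ ∑' k : ℕ, ENNReal.ofReal (2 ^ (n + 1) *
      ((2 : ℝ)⁻¹ ^ k) ^ (n + 1)) * {u : ℝ | u ≤ 2 ^ k}.indicator 1 u := by
  have hex : ∃ k : ℕ, u ≤ 2 ^ k := by
    obtain ⟨k, hk⟩ := pow_unbounded_of_one_lt u (one_lt_two : (1 : ℝ) < 2)
    exact ⟨k, hk.le⟩
  classical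
  set k := Nat.find hex with hk
  have hk1 : u ≤ 2 ^ k := Nat.find_spec hex
  refine le_trans ?_ (ENNReal.le_tsum k)
  rw [Set.indicator_of_mem (by exact hk1), Pi.one_apply, mul_one]
  refine ENNReal.ofReal_le_ofReal ?_
  rw [← mul_pow, ← inv_pow]
  refine pow_le_pow_left₀ (by positivity) ?_ _
  rcases Nat.eq_zero_or_pos k with h0 | h0
  · rw [h0, pow_zero, mul_one]
    exact (inv_le_one_of_one_le₀ (by linarith)).trans (by norm_num)
  · have h1 : ¬ u ≤ 2 ^ (k - 1) := Nat.find_min hex (by omega)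
    obtain ⟨m, hm⟩ : ∃ m, k = m + 1 := ⟨k - 1, by omega⟩
    rw [hm, Nat.add_sub_cancel, not_le] at h1
    have h2 : (2 : ℝ) * 2⁻¹ ^ k = (2 ^ m)⁻¹ := by
      rw [hm, pow_succ, inv_pow]
      field_simp
    rw [h2]
    exact inv_anti₀ (by positivity) (by linarith)

/-- Averages with respect to the kernel `ρ^{-n} (1 + |x - y| / ρ)^{-n-1}` are controlled by the
maximal function. -/
theorem lintegral_poly_kernel_le {f : Rn n → ℝ≥0∞} (hf : Measurable f) (x : Rn n) {ρ : ℝ}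
    (hρ : 0 < ρ) :
    ∫⁻ y, ENNReal.ofReal ((ρ ^ n)⁻¹ * ((1 + ‖x - y‖ / ρ) ^ (n + 1))⁻¹) * f y ≤
      ENNReal.ofReal (2 ^ (2 * n + 2)) * volume (Metric.closedBall (0 : Rn n) 1) *
        maximalFn f x := by
  set v := volume (Metric.closedBall (0 : Rn n) 1) with hv
  have hball : ∀ k : ℕ, ∀ y, {u : ℝ | u ≤ 2 ^ k}.indicator (1 : ℝ → ℝ≥0∞) (‖x - y‖ / ρ) * f y =
      (Metric.closedBall x (2 ^ k * ρ)).indicator f y := by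
    intro k y
    have : ‖x - y‖ / ρ ≤ 2 ^ k ↔ y ∈ Metric.closedBall x (2 ^ k * ρ) := by
      rw [div_le_iff₀ hρ, Metric.mem_closedBall, dist_comm, dist_eq_norm]
    by_cases h : ‖x - y‖ / ρ ≤ 2 ^ k
    · rw [Set.indicator_of_mem (by exact h), Set.indicator_of_mem (this.1 h)]
      simp
    · rw [Set.indicator_of_notMem (by exact h), Set.indicator_of_notMem (fun h' ↦ h (this.2 h'))]
      simp
  calc _ ≤ ∫⁻ y, ∑' k : ℕ, ENNReal.ofReal ((ρ ^ n)⁻¹ * (2 ^ (n + 1) * ((2 : ℝ)⁻¹ ^ k) ^ (n + 1))) *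
        (Metric.closedBall x (2 ^ k * ρ)).indicator f y := by
        refine lintegral_mono fun y ↦ ?_
        rw [ENNReal.ofReal_mul (by positivity)]
        calc _ ≤ ENNReal.ofReal ((ρ ^ n)⁻¹) * (∑' k : ℕ, ENNReal.ofReal (2 ^ (n + 1) *
              ((2 : ℝ)⁻¹ ^ k) ^ (n + 1)) * {u : ℝ | u ≤ 2 ^ k}.indicator 1 (‖x - y‖ / ρ)) *
                f y := by
              gcongr
              exact inv_one_add_pow_le_tsum n (by positivity)
          _ = _ := by
              rw [← ENNReal.tsum_mul_left, ← ENNReal.tsum_mul_right]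
              refine tsum_congr fun k ↦ ?_
              rw [← mul_assoc, mul_assoc, hball,
                ENNReal.ofReal_mul (p := (ρ ^ n)⁻¹) (by positivity)]
    _ = ∑' k : ℕ, ENNReal.ofReal ((ρ ^ n)⁻¹ * (2 ^ (n + 1) * ((2 : ℝ)⁻¹ ^ k) ^ (n + 1))) *
        ∫⁻ y in Metric.closedBall x (2 ^ k * ρ), f y := by
        rw [lintegral_tsum]
        · refine tsum_congr fun k ↦ ?_
          rw [lintegral_const_mul' _ _ ENNReal.ofReal_ne_top,
            lintegral_indicator Metric.isClosed_closedBall.measurableSet]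
        · intro k
          exact ((hf.indicator Metric.isClosed_closedBall.measurableSet).const_mul _).aemeasurable
    _ ≤ ∑' k : ℕ, ENNReal.ofReal (2 ^ (2 * n + 1)) * v * maximalFn f x * (2 : ℝ≥0∞)⁻¹ ^ k := by
        refine ENNReal.tsum_le_tsum fun k ↦ ?_
        calc _ ≤ ENNReal.ofReal ((ρ ^ n)⁻¹ * (2 ^ (n + 1) * ((2 : ℝ)⁻¹ ^ k) ^ (n + 1))) *
              (ENNReal.ofReal ((2 * (2 ^ k * ρ)) ^ n) * v * maximalFn f x) := by
              gcongr
              exact lintegral_closedBall_le f x (by positivity)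
          _ = ENNReal.ofReal (((ρ ^ n)⁻¹ * (2 ^ (n + 1) * ((2 : ℝ)⁻¹ ^ k) ^ (n + 1))) *
              (2 * (2 ^ k * ρ)) ^ n) * v * maximalFn f x := by
              rw [ENNReal.ofReal_mul (p := ((ρ ^ n)⁻¹ * (2 ^ (n + 1) * ((2 : ℝ)⁻¹ ^ k) ^ (n + 1))))
                (by positivity)]
              ring
          _ = ENNReal.ofReal (2 ^ (2 * n + 1) * (2 : ℝ)⁻¹ ^ k) * v * maximalFn f x := by
              congr 3
              have h1 : ((2 : ℝ)⁻¹ ^ k) ^ n * (2 ^ k) ^ n = 1 := by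
                rw [← mul_pow, ← mul_pow, inv_mul_cancel₀ two_ne_zero, one_pow, one_pow]
              have h2 : (ρ ^ n)⁻¹ * ρ ^ n = 1 := inv_mul_cancel₀ (by positivity)
              rw [mul_pow, mul_pow, pow_succ ((2 : ℝ)⁻¹ ^ k) n]
              calc _ = 2 ^ (n + 1) * (2 : ℝ) ^ n * 2⁻¹ ^ k *
                    (((2 : ℝ)⁻¹ ^ k) ^ n * (2 ^ k) ^ n) * ((ρ ^ n)⁻¹ * ρ ^ n) := by ring
                _ = _ := by
                  rw [h1, h2]
                  ring
          _ = _ := by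
              rw [ENNReal.ofReal_mul (by positivity),
                ENNReal.ofReal_pow (p := (2 : ℝ)⁻¹) (by norm_num),
                ENNReal.ofReal_inv_of_pos two_pos, ENNReal.ofReal_ofNat]
              ring
    _ = _ := by
        rw [ENNReal.tsum_mul_left, ENNReal.tsum_geometric, ENNReal.one_sub_inv_two, inv_inv,
          pow_succ (2 : ℝ) (2 * n + 1), ENNReal.ofReal_mul (by positivity), ENNReal.ofReal_ofNat]
        ring

/-- The heat flow is controlled by the maximal function. -/
theorem exists_lintegral_heatKernel_le (n : ℕ) :
    ∃ C : ℝ, 0 ≤ C ∧ ∀ f : Rn n → ℝ≥0∞, Measurable f → ∀ (t : ℝ) (ht : 0 < t) (x : Rn n),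
      ∫⁻ y, ‖heatKernel ht x y‖ₑ * f y ≤ ENNReal.ofReal C * maximalFn f x := by
  obtain ⟨C, hC⟩ := gaussian_decay (a := 1 / 4) (by norm_num) (n + 1)
  have hC0 : 0 ≤ C := le_trans (by positivity) (hC 0 le_rfl)
  set v := volume (Metric.closedBall (0 : Rn n) 1) with hv
  have hvt : v ≠ ⊤ := volume_closedBall_ne_top _ _
  set c : ℝ := (4 * Real.pi) ^ (-(n : ℝ) / 2) * C with hc
  refine ⟨c * (2 ^ (2 * n + 2) * v.toReal), by positivity, fun f hf t ht x ↦ ?_⟩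
  have hst : 0 < √t := Real.sqrt_pos.2 ht
  have hk : ∀ y, ‖heatKernel ht x y‖ₑ ≤ ENNReal.ofReal c *
      ENNReal.ofReal (((√t) ^ n)⁻¹ * ((1 + ‖x - y‖ / √t) ^ (n + 1))⁻¹) := by
    intro y
    rw [heatKernel_apply, ← ofReal_norm, Complex.norm_real,
      Real.norm_of_nonneg (by positivity), ← ENNReal.ofReal_mul (by positivity)]
    refine ENNReal.ofReal_le_ofReal ?_
    have h1 := hC (‖x - y‖ / √t) (by positivity)
    have h2 : -(1 / 4) * (‖x - y‖ / √t) ^ 2 = -‖x - y‖ ^ 2 / (4 * t) := by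
      rw [div_pow, Real.sq_sqrt ht.le]
      field_simp
    rw [h2, mul_comm, ← le_div_iff₀ (by positivity), div_eq_mul_inv C] at h1
    have h3 : (4 * Real.pi * t) ^ (-(n : ℝ) / 2) =
        (4 * Real.pi) ^ (-(n : ℝ) / 2) * ((√t) ^ n)⁻¹ := by
      rw [Real.mul_rpow (by positivity) ht.le, neg_div, Real.rpow_neg ht.le, Real.sqrt_eq_rpow,
        ← Real.rpow_natCast, ← Real.rpow_mul ht.le]
      congr 3
      ring
    rw [h3]
    calc _ ≤ (4 * Real.pi) ^ (-(n : ℝ) / 2) * ((√t) ^ n)⁻¹ *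
          (C * ((1 + ‖x - y‖ / √t) ^ (n + 1))⁻¹) := by gcongr
      _ = _ := by rw [hc]; ring
  calc _ ≤ ∫⁻ y, ENNReal.ofReal c *
        (ENNReal.ofReal (((√t) ^ n)⁻¹ * ((1 + ‖x - y‖ / √t) ^ (n + 1))⁻¹) * f y) := by
        refine lintegral_mono fun y ↦ ?_
        rw [← mul_assoc]
        gcongr
        exact hk y
    _ ≤ ENNReal.ofReal c * (ENNReal.ofReal (2 ^ (2 * n + 2)) * v * maximalFn f x) := by
        rw [lintegral_const_mul' _ _ ENNReal.ofReal_ne_top]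
        gcongr
        exact lintegral_poly_kernel_le hf x hst
    _ = _ := by
        rw [ENNReal.ofReal_mul (p := c) (by positivity),
          ENNReal.ofReal_mul (p := 2 ^ (2 * n + 2)) (by positivity),
          ENNReal.ofReal_toReal hvt]
        ring

end Maximal

/-! ### The maximal function on variable Lebesgue spaces -/

section VariableMaximal

variable {n : ℕ}

/-- Jensen's inequality for averages. -/
theorem avg_rpow_le {f : Rn n → ℝ≥0∞} (hf : Measurable f) {m : ℝ} (hm : 1 ≤ m) {B : Set (Rn n)}
    (hB0 : volume B ≠ 0) (hB : volume B ≠ ⊤) :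
    ((volume B)⁻¹ * ∫⁻ y in B, f y) ^ m ≤ (volume B)⁻¹ * ∫⁻ y in B, f y ^ m := by
  have hm0 : 0 < m := by linarith
  have := ProbabilityTheory.cond_isProbabilityMeasure_of_finite hB0 hB
  have h := eLpNorm'_le_eLpNorm'_of_exponent_le (f := f) one_pos hm
    (ProbabilityTheory.cond volume B) hf.aestronglyMeasurable
  rw [eLpNorm', eLpNorm', one_div m, ENNReal.le_rpow_inv_iff hm0] at h
  simpa [ProbabilityTheory.cond, lintegral_smul_measure] using h

/-- The exponent `r ≥ 1` is locally log-Hölder continuous, and satisfies the log-Hölder decay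
condition with limit `l ≥ 1`. -/
structure IsLogHolderFn (r : Rn n → ℝ) (c l : ℝ) : Prop where
  one_le : ∀ x, 1 ≤ r x
  one_le_limit : 1 ≤ l
  abs_sub_le : ∀ x y, |r x - r y| ≤ c / Real.log (Real.exp 1 + 1 / ‖x - y‖)
  abs_sub_limit_le : ∀ x, |r x - l| ≤ c / Real.log (Real.exp 1 + ‖x‖)

theorem one_le_log_exp_one_add {u : ℝ} (hu : 0 ≤ u) : 1 ≤ Real.log (Real.exp 1 + u) := by
  rw [Real.le_log_iff_exp_le (by positivity)]
  linarith

theorem exp_one_add_rpow_div_log {u : ℝ} (hu : 0 ≤ u) (c : ℝ) :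
    (Real.exp 1 + u) ^ (c / Real.log (Real.exp 1 + u)) = Real.exp c := by
  have h := one_le_log_exp_one_add hu
  rw [Real.rpow_def_of_pos (by positivity), mul_div_cancel₀]
  linarith

theorem IsLogHolderFn.nonneg {r : Rn n → ℝ} {c l : ℝ} (h : IsLogHolderFn r c l) : 0 ≤ c := by
  have h1 := (abs_nonneg _).trans (h.abs_sub_limit_le 0)
  have h2 := one_le_log_exp_one_add (norm_nonneg (0 : Rn n))
  by_contra hc
  exact absurd h1 (not_le.2 (div_neg_of_neg_of_pos (not_le.1 hc) (by linarith)))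

/-- On a ball of radius `ρ`, the exponent oscillates by at most `c / log (e + 1 / ρ)`. -/
theorem IsLogHolderFn.abs_sub_le_of_norm_le {r : Rn n → ℝ} {c l : ℝ} (h : IsLogHolderFn r c l)
    {x y : Rn n} {ρ : ℝ} (hρ : 0 < ρ) (hxy : ‖x - y‖ ≤ ρ) :
    |r x - r y| ≤ c / Real.log (Real.exp 1 + 1 / ρ) := by
  have hc := h.nonneg
  have h1 := one_le_log_exp_one_add (u := 1 / ρ) (by positivity)
  rcases eq_or_ne x y with rfl | hne
  · rw [sub_self, abs_zero]
    positivity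
  · have h2 : 0 < ‖x - y‖ := norm_pos_iff.2 (sub_ne_zero.2 hne)
    refine (h.abs_sub_le x y).trans ?_
    gcongr

/-- The local log-Hölder condition enters here: `|B|^{-d}` is bounded for all balls `B`, if `d` is at
most the oscillation on `B` of a log-Hölder continuous exponent. -/
theorem inv_volume_rpow_le (x : Rn n) {ρ c d : ℝ} (hρ : 0 < ρ) (hc : 0 ≤ c) (hd0 : 0 ≤ d)
    (hd : d ≤ c / Real.log (Real.exp 1 + 1 / ρ)) {A : ℝ≥0∞}
    (hA : A ≤ (volume (Metric.closedBall x ρ))⁻¹) :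
    A ^ d ≤ ENNReal.ofReal
      ((1 + (volume (Metric.closedBall (0 : Rn n) 1)).toReal⁻¹) ^ c * Real.exp (n * c)) := by
  set V := (volume (Metric.closedBall (0 : Rn n) 1)).toReal with hV
  have hV0 : 0 < V := ENNReal.toReal_pos (volume_closedBall_pos _ one_pos)
    (volume_closedBall_ne_top _ _)
  set L := Real.exp 1 + 1 / ρ with hL
  have hlog : 1 ≤ Real.log L := one_le_log_exp_one_add (by positivity)
  have hL1 : 1 ≤ L := (Real.one_le_exp zero_le_one).trans (le_add_of_nonneg_right (by positivity))
  have h1 : (volume (Metric.closedBall x ρ))⁻¹ = ENNReal.ofReal ((ρ ^ n * V)⁻¹) := by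
    rw [volume_closedBall_eq x hρ.le, ENNReal.ofReal_inv_of_pos (by positivity),
      ENNReal.ofReal_mul (by positivity), ENNReal.ofReal_toReal (volume_closedBall_ne_top _ _)]
  have h2 : (ρ ^ n * V)⁻¹ ≤ (1 + V⁻¹) * L ^ n := by
    have h3 : (ρ ^ n)⁻¹ ≤ L ^ n := by
      rw [← inv_pow]
      gcongr
      rw [hL, one_div]
      linarith [Real.exp_pos 1]
    calc (ρ ^ n * V)⁻¹ = V⁻¹ * (ρ ^ n)⁻¹ := by rw [mul_inv, mul_comm]
      _ ≤ (1 + V⁻¹) * L ^ n := by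
        gcongr
        linarith
  have hdc : d ≤ c := hd.trans (div_le_self hc hlog)
  have h0 : 1 ≤ 1 + V⁻¹ := le_add_of_nonneg_right (by positivity)
  calc A ^ d ≤ ENNReal.ofReal ((1 + V⁻¹) * L ^ n) ^ d := by
        gcongr
        exact (hA.trans_eq h1).trans (ENNReal.ofReal_le_ofReal h2)
    _ = ENNReal.ofReal ((1 + V⁻¹) ^ d * (L ^ d) ^ n) := by
        rw [ENNReal.ofReal_rpow_of_nonneg (by positivity) hd0,
          Real.mul_rpow (by positivity) (by positivity), ← Real.rpow_natCast, ← Real.rpow_natCast,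
          ← Real.rpow_mul (by positivity), ← Real.rpow_mul (by positivity), mul_comm d]
    _ ≤ ENNReal.ofReal ((1 + V⁻¹) ^ c * (Real.exp c) ^ n) := by
        refine ENNReal.ofReal_le_ofReal ?_
        gcongr
        · rw [← exp_one_add_rpow_div_log (u := 1 / ρ) (by positivity) c]
          exact Real.rpow_le_rpow_of_exponent_le hL1 hd
    _ = _ := by rw [← Real.exp_nat_mul]

/-- The part of `f` with large values. -/
theorem IsLogHolderFn.maximalFn_rpow_le_of_large {r : Rn n → ℝ} {c l : ℝ}
    (h : IsLogHolderFn r c l) {f : Rn n → ℝ≥0∞} (hf : Measurable f)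
    (hf1 : ∀ y, f y = 0 ∨ 1 ≤ f y) (hint : ∫⁻ y, f y ^ r y ≤ 1) (x : Rn n) :
    maximalFn f x ^ r x ≤ ENNReal.ofReal
      ((1 + (volume (Metric.closedBall (0 : Rn n) 1)).toReal⁻¹) ^ c * Real.exp (n * c)) *
        maximalFn (fun y ↦ f y ^ r y) x := by
  have hr0 : ∀ y, 0 < r y := fun y ↦ one_pos.trans_le (h.one_le y)
  rw [← ENNReal.le_rpow_inv_iff (hr0 x)]
  refine iSup_le fun j ↦ ?_
  rw [ENNReal.le_rpow_inv_iff (hr0 x)]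
  set ρ : ℝ := 2 ^ j with hρdef
  have hρ : 0 < ρ := by positivity
  set B := Metric.closedBall x ρ with hB
  have hB0 : volume B ≠ 0 := volume_closedBall_pos x hρ
  have hBt : volume B ≠ ⊤ := volume_closedBall_ne_top x ρ
  set d := c / Real.log (Real.exp 1 + 1 / ρ) with hd
  have hd0 : 0 ≤ d := by
    have := one_le_log_exp_one_add (u := 1 / ρ) (by positivity)
    have := h.nonneg
    positivity
  set m := max 1 (r x - d) with hm
  have hmx : m ≤ r x := max_le (h.one_le x) (by linarith)
  have hmy : ∀ y ∈ B, m ≤ r y := by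
    intro y hy
    refine max_le (h.one_le y) ?_
    rw [hB, Metric.mem_closedBall, dist_comm, dist_eq_norm] at hy
    have := (abs_le.1 (h.abs_sub_le_of_norm_le hρ hy)).2
    linarith
  have h1m : 1 ≤ m := le_max_left _ _
  have hA : (volume B)⁻¹ * ∫⁻ y in B, f y ≤ (volume B)⁻¹ := by
    refine mul_le_of_le_one_right' ((setLIntegral_le_lintegral _ _).trans
      ((lintegral_mono fun y ↦ ?_).trans hint))
    rcases hf1 y with h0 | h1
    · simp [h0]
    · nth_rewrite 1 [← ENNReal.rpow_one (f y)]
      exact ENNReal.rpow_le_rpow_of_exponent_le h1 (h.one_le y)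
  have h2 : ((volume B)⁻¹ * ∫⁻ y in B, f y) ^ m ≤ maximalFn (fun y ↦ f y ^ r y) x := by
    refine ((avg_rpow_le hf h1m hB0 hBt).trans ?_).trans (le_iSup
      (fun j : ℤ ↦ (volume (Metric.closedBall x (2 ^ j : ℝ)))⁻¹ *
        ∫⁻ y in Metric.closedBall x (2 ^ j : ℝ), f y ^ r y) j)
    gcongr 1
    refine setLIntegral_mono' Metric.isClosed_closedBall.measurableSet fun y hy ↦ ?_
    rcases hf1 y with h0 | h1
    · rw [h0, ENNReal.zero_rpow_of_pos (by linarith), ENNReal.zero_rpow_of_pos (hr0 y)]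
    · exact ENNReal.rpow_le_rpow_of_exponent_le h1 (hmy y hy)
  have h3 : r x = (r x - m) + m := by ring
  rw [h3, ENNReal.rpow_add_of_nonneg _ _ (by linarith) (by linarith)]
  refine mul_le_mul' (inv_volume_rpow_le x hρ h.nonneg (by linarith) ?_ hA) h2
  have : r x - d ≤ m := le_max_right _ _
  linarith

/-- The error term in the comparison of exponents with their limit at infinity. -/
def decayFn (x : Rn n) : ℝ≥0∞ := ENNReal.ofReal (((Real.exp 1 + ‖x‖) ^ (n + 1))⁻¹)

theorem measurable_decayFn : Measurable (decayFn (n := n)) := by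
  unfold decayFn
  fun_prop

theorem lintegral_decayFn_rpow_lt_top (n : ℕ) {q : ℝ} (hq : 1 ≤ q) :
    ∫⁻ x : Rn n, decayFn x ^ q < ⊤ := by
  refine lt_of_le_of_lt (lintegral_mono fun x ↦ ?_)
    (finite_integral_one_add_norm (E := Rn n) (μ := volume) (r := n + 1) (by simp))
  have h1 : (1 : ℝ) ≤ Real.exp 1 + ‖x‖ :=
    (Real.one_le_exp zero_le_one).trans (le_add_of_nonneg_right (norm_nonneg x))
  have h2 : (decayFn x) ^ q ≤ decayFn x := by
    nth_rewrite 2 [← ENNReal.rpow_one (decayFn x)]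
    refine ENNReal.rpow_le_rpow_of_exponent_ge ?_ hq
    rw [decayFn, ENNReal.ofReal_le_one]
    exact inv_le_one_of_one_le₀ (one_le_pow₀ h1)
  refine h2.trans (ENNReal.ofReal_le_ofReal ?_)
  rw [Real.rpow_neg (by positivity)]
  have h3 : (1 + ‖x‖) ^ ((n : ℝ) + 1) = (1 + ‖x‖) ^ (n + 1) := by
    rw [← Real.rpow_natCast]
    push_cast
    rfl
  rw [h3]
  gcongr
  exact Real.one_le_exp zero_le_one

/-- The decay condition at infinity enters here: up to the error `(e + |y|)^{-n-1}`, powers of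
numbers in `[0, 1]` with the exponents `r(y)` and `l` are comparable. -/
theorem rpow_le_rpow_add_decayFn {a : ℝ≥0∞} (ha : a ≤ 1) {u v c : ℝ} (hu : 1 ≤ u)
    (y : Rn n) (huv : |u - v| ≤ c / Real.log (Real.exp 1 + ‖y‖)) :
    a ^ u ≤ ENNReal.ofReal (Real.exp ((n + 1) * c)) * a ^ v + decayFn y := by
  set L := Real.exp 1 + ‖y‖ with hL
  have hL1 : 1 ≤ L := (Real.one_le_exp zero_le_one).trans (le_add_of_nonneg_right (norm_nonneg y))
  have hL0 : 0 < L := by linarith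
  rcases le_or_gt (decayFn y) a with h | h
  · refine le_add_right ?_
    have hd0 : 0 < decayFn y := by
      rw [decayFn, ENNReal.ofReal_pos]
      positivity
    have ha0 : a ≠ 0 := (hd0.trans_le h).ne'
    have hat : a ≠ ⊤ := (ha.trans_lt ENNReal.one_lt_top).ne
    have e : u = (u - v) + v := by ring
    rw [e, ENNReal.rpow_add _ _ ha0 hat]
    gcongr
    calc a ^ (u - v) ≤ a ^ (-|u - v|) := ENNReal.rpow_le_rpow_of_exponent_ge ha (neg_abs_le _)
      _ = (a⁻¹) ^ |u - v| := by rw [ENNReal.rpow_neg, ENNReal.inv_rpow]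
      _ ≤ ENNReal.ofReal (L ^ (n + 1)) ^ |u - v| := by
        gcongr
        rw [ENNReal.inv_le_iff_inv_le, ← ENNReal.ofReal_inv_of_pos (by positivity)]
        exact h
      _ = ENNReal.ofReal ((L ^ |u - v|) ^ (n + 1)) := by
        rw [ENNReal.ofReal_rpow_of_nonneg (by positivity) (abs_nonneg _), ← Real.rpow_natCast,
          ← Real.rpow_natCast, ← Real.rpow_mul hL0.le, ← Real.rpow_mul hL0.le, mul_comm]
      _ ≤ ENNReal.ofReal ((Real.exp c) ^ (n + 1)) := by
        refine ENNReal.ofReal_le_ofReal ?_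
        gcongr
        rw [← exp_one_add_rpow_div_log (norm_nonneg y) c]
        exact Real.rpow_le_rpow_of_exponent_le hL1 huv
      _ = _ := by
        rw [← Real.exp_nat_mul]
        push_cast
        rfl
  · refine le_add_left (le_trans ?_ h.le)
    nth_rewrite 2 [← ENNReal.rpow_one a]
    exact ENNReal.rpow_le_rpow_of_exponent_ge ha hu

/-- The part of `f` with small values. -/
theorem IsLogHolderFn.maximalFn_rpow_le_of_small {r : Rn n → ℝ} {c l : ℝ}
    (h : IsLogHolderFn r c l) {f : Rn n → ℝ≥0∞} (hf : Measurable f)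
    (hf1 : ∀ y, f y ≤ 1) (x : Rn n) :
    maximalFn f x ^ r x ≤ ENNReal.ofReal (Real.exp ((n + 1) * c)) *
      (ENNReal.ofReal (Real.exp ((n + 1) * c)) * maximalFn (fun y ↦ f y ^ r y) x +
        maximalFn decayFn x) + decayFn x := by
  have hr0 : ∀ y, 0 < r y := fun y ↦ one_pos.trans_le (h.one_le y)
  rw [← ENNReal.le_rpow_inv_iff (hr0 x)]
  refine iSup_le fun j ↦ ?_
  rw [ENNReal.le_rpow_inv_iff (hr0 x)]
  set B := Metric.closedBall x (2 ^ j : ℝ) with hB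
  have hB0 : volume B ≠ 0 := volume_closedBall_pos x (by positivity)
  have hBt : volume B ≠ ⊤ := volume_closedBall_ne_top x _
  have hA : (volume B)⁻¹ * ∫⁻ y in B, f y ≤ 1 := by
    calc _ ≤ (volume B)⁻¹ * ∫⁻ y in B, 1 := by
          gcongr with y
          exact hf1 y
      _ = 1 := by rw [setLIntegral_one, ENNReal.inv_mul_cancel hB0 hBt]
  refine (rpow_le_rpow_add_decayFn hA (h.one_le x) x (h.abs_sub_limit_le x)).trans ?_
  gcongr
  calc _ ≤ (volume B)⁻¹ * ∫⁻ y in B, f y ^ l := avg_rpow_le hf h.one_le_limit hB0 hBt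
    _ ≤ (volume B)⁻¹ * ∫⁻ y in B,
        (ENNReal.ofReal (Real.exp ((n + 1) * c)) * f y ^ r y + decayFn y) := by
        gcongr with y
        refine rpow_le_rpow_add_decayFn (hf1 y) h.one_le_limit y ?_
        rw [abs_sub_comm]
        exact h.abs_sub_limit_le y
    _ = ENNReal.ofReal (Real.exp ((n + 1) * c)) * ((volume B)⁻¹ * ∫⁻ y in B, f y ^ r y) +
        (volume B)⁻¹ * ∫⁻ y in B, decayFn y := by
        rw [lintegral_add_right _ measurable_decayFn,
          lintegral_const_mul' _ _ ENNReal.ofReal_ne_top]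
        ring
    _ ≤ _ := by
        gcongr
        · exact le_iSup (fun j : ℤ ↦ (volume (Metric.closedBall x (2 ^ j : ℝ)))⁻¹ *
            ∫⁻ y in Metric.closedBall x (2 ^ j : ℝ), f y ^ r y) j
        · exact le_iSup (fun j : ℤ ↦ (volume (Metric.closedBall x (2 ^ j : ℝ)))⁻¹ *
            ∫⁻ y in Metric.closedBall x (2 ^ j : ℝ), decayFn y) j

theorem add_rpow_le_two_rpow_mul (a b : ℝ≥0∞) {s : ℝ} (hs : 1 ≤ s) :
    (a + b) ^ s ≤ 2 ^ s * (a ^ s + b ^ s) := by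
  refine (ENNReal.rpow_add_le_mul_rpow_add_rpow a b hs).trans ?_
  gcongr
  · exact one_le_two
  · linarith

/-- The maximal function is bounded on the variable Lebesgue space with the exponent `q r(·)`, for
`q > 1` and a bounded log-Hölder continuous exponent `r ≥ 1`. -/
theorem IsLogHolderFn.exists_lintegral_maximalFn_rpow_le {r : Rn n → ℝ} {c l : ℝ}
    (h : IsLogHolderFn r c l) (hr : Measurable r) {R : ℝ} (hR : ∀ x, r x ≤ R) {q : ℝ}
    (hq : 1 < q) :
    ∃ C : ℝ≥0∞, C ≠ ⊤ ∧ ∀ f : Rn n → ℝ≥0∞, Measurable f → ∫⁻ x, f x ^ (r x * q) ≤ 1 →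
      ∫⁻ x, maximalFn f x ^ (r x * q) ≤ C := by
  have hq0 : 0 < q := by linarith
  have hr0 : ∀ y, 0 < r y := fun y ↦ one_pos.trans_le (h.one_le y)
  obtain ⟨Cq, hCq, hM⟩ := VarSobolev.exists_lintegral_maximalFn_rpow_le n hq
  set C1 := ENNReal.ofReal
      ((1 + (volume (Metric.closedBall (0 : Rn n) 1)).toReal⁻¹) ^ c * Real.exp (n * c)) with hC1
  set K := ENNReal.ofReal (Real.exp ((n + 1) * c)) with hK
  set I := ∫⁻ x : Rn n, decayFn x ^ q with hI
  have hIt : I ≠ ⊤ := (lintegral_decayFn_rpow_lt_top n hq.le).ne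
  refine ⟨2 ^ (R * q) * (C1 ^ q * Cq + 2 ^ q * (K ^ q * (2 ^ q * (K ^ q * Cq + Cq * I)) + I)), ?_,
    fun f hf hint ↦ ?_⟩
  · have hR0 : 0 ≤ R := (hr0 0).le.trans (hR 0)
    have h2q : (2 : ℝ≥0∞) ^ q ≠ ⊤ := by finiteness
    have hKq : K ^ q ≠ ⊤ := ENNReal.rpow_ne_top_of_nonneg hq0.le ENNReal.ofReal_ne_top
    have hCq1 : C1 ^ q ≠ ⊤ := ENNReal.rpow_ne_top_of_nonneg hq0.le ENNReal.ofReal_ne_top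
    have h2R : (2 : ℝ≥0∞) ^ (R * q) ≠ ⊤ := ENNReal.rpow_ne_top_of_nonneg (by positivity) (by simp)
    finiteness
  set S : Set (Rn n) := {y | 1 ≤ f y} with hS
  have hSm : MeasurableSet S := measurableSet_le measurable_const hf
  have hf1m := hf.indicator hSm
  have hf2m := hf.indicator hSm.compl
  have hsplit : f = fun y ↦ S.indicator f y + Sᶜ.indicator f y := by
    funext y
    exact (congrFun (Set.indicator_self_add_compl S f) y).symm
  have hle : ∀ T : Set (Rn n), ∫⁻ y, (T.indicator f y ^ r y) ^ q ≤ 1 := by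
    intro T
    refine (lintegral_mono fun y ↦ ?_).trans hint
    rw [← ENNReal.rpow_mul]
    have := (hr0 y).le
    gcongr
    exact Set.indicator_le_self _ _ y
  have hg1m : Measurable fun y ↦ S.indicator f y ^ r y := hf1m.pow hr
  have hg2m : Measurable fun y ↦ Sᶜ.indicator f y ^ r y := hf2m.pow hr
  have hM1 := (hM _ hg1m).trans (mul_le_mul_right (hle S) Cq)
  have hM2 := (hM _ hg2m).trans (mul_le_mul_right (hle Sᶜ) Cq)
  have hM3 := hM _ (measurable_decayFn (n := n))
  rw [mul_one] at hM1 hM2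
  have hlarge : ∀ x, maximalFn (S.indicator f) x ^ r x ≤
      C1 * maximalFn (fun y ↦ S.indicator f y ^ r y) x := by
    refine h.maximalFn_rpow_le_of_large hf1m (fun y ↦ ?_) ?_
    · by_cases hy : y ∈ S
      · rw [Set.indicator_of_mem hy]
        exact .inr hy
      · exact .inl (Set.indicator_of_notMem hy _)
    · refine (lintegral_mono fun y ↦ ?_).trans (hle S)
      by_cases hy : y ∈ S
      · rw [Set.indicator_of_mem hy, ← ENNReal.rpow_mul]
        refine ENNReal.rpow_le_rpow_of_exponent_le hy ?_
        nlinarith [hr0 y]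
      · rw [Set.indicator_of_notMem hy, ENNReal.zero_rpow_of_pos (hr0 y)]
        exact zero_le
  have hsmall : ∀ x, maximalFn (Sᶜ.indicator f) x ^ r x ≤
      K * (K * maximalFn (fun y ↦ Sᶜ.indicator f y ^ r y) x + maximalFn decayFn x) +
        decayFn x := by
    refine h.maximalFn_rpow_le_of_small hf2m fun y ↦ ?_
    by_cases hy : y ∈ S
    · rw [Set.indicator_of_notMem (by simpa using hy)]
      exact zero_le
    · rw [Set.indicator_of_mem (by simpa using hy)]
      exact (not_le.1 hy).le
  have hpt : ∀ x, maximalFn f x ^ (r x * q) ≤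
      2 ^ (R * q) * (C1 ^ q * maximalFn (fun y ↦ S.indicator f y ^ r y) x ^ q +
        2 ^ q * (K ^ q * (2 ^ q * (K ^ q * maximalFn (fun y ↦ Sᶜ.indicator f y ^ r y) x ^ q +
          maximalFn decayFn x ^ q)) + decayFn x ^ q)) := by
    intro x
    have h1 : 1 ≤ r x * q := by nlinarith [h.one_le x]
    calc _ ≤ (maximalFn (S.indicator f) x + maximalFn (Sᶜ.indicator f) x) ^ (r x * q) := by
          gcongr
          nth_rewrite 1 [hsplit]
          exact maximalFn_add_le hf1m x
      _ ≤ 2 ^ (r x * q) * (maximalFn (S.indicator f) x ^ (r x * q) +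
          maximalFn (Sᶜ.indicator f) x ^ (r x * q)) := add_rpow_le_two_rpow_mul _ _ h1
      _ ≤ 2 ^ (R * q) * ((C1 * maximalFn (fun y ↦ S.indicator f y ^ r y) x) ^ q +
          (K * (K * maximalFn (fun y ↦ Sᶜ.indicator f y ^ r y) x + maximalFn decayFn x) +
            decayFn x) ^ q) := by
          rw [ENNReal.rpow_mul (maximalFn _ _), ENNReal.rpow_mul (maximalFn _ _)]
          gcongr
          · exact one_le_two
          · exact hR x
          · exact hlarge x
          · exact hsmall x
      _ ≤ _ := by
          rw [ENNReal.mul_rpow_of_nonneg _ _ hq0.le]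
          gcongr
          refine (add_rpow_le_two_rpow_mul _ _ hq.le).trans ?_
          rw [ENNReal.mul_rpow_of_nonneg _ _ hq0.le]
          gcongr
          refine (add_rpow_le_two_rpow_mul _ _ hq.le).trans ?_
          rw [ENNReal.mul_rpow_of_nonneg _ _ hq0.le]
  have hm1 := (measurable_maximalFn hg1m).pow_const q
  have hm2 := (measurable_maximalFn hg2m).pow_const q
  have hm3 := (measurable_maximalFn (measurable_decayFn (n := n))).pow_const q
  have hm4 := (measurable_decayFn (n := n)).pow_const q
  refine (lintegral_mono hpt).trans ?_
  rw [lintegral_const_mul _ (by fun_prop), lintegral_add_left (by fun_prop),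
    lintegral_const_mul _ (by fun_prop), lintegral_const_mul _ (by fun_prop),
    lintegral_add_left (by fun_prop), lintegral_const_mul _ (by fun_prop),
    lintegral_const_mul _ (by fun_prop), lintegral_add_left (by fun_prop),
    lintegral_const_mul _ (by fun_prop)]
  gcongr

end VariableMaximal

/-! ### Log-Hölder exponents -/

section Exponents

variable {n : ℕ} {p : Rn n → ℝ≥0∞}

theorem IsLogHolder.continuous_recip (hp : IsLogHolder p) : Continuous (recip p) := by
  obtain ⟨C, hC⟩ := hp.2.1
  refine continuous_iff_continuousAt.2 fun x ↦ ?_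
  rw [continuousAt_iff_punctured_nhds, tendsto_iff_dist_tendsto_zero]
  have h1 : Tendsto (fun y ↦ C / Real.log (Real.exp 1 + 1 / ‖y - x‖)) (𝓝[≠] x) (𝓝 0) := by
    refine Tendsto.const_div_atTop (Real.tendsto_log_atTop.comp
      (tendsto_atTop_add_const_left _ _ ?_)) C
    simp_rw [one_div]
    exact tendsto_inv_nhdsGT_zero.comp (tendsto_norm_sub_self_nhdsNE x)
  exact squeeze_zero (fun _ ↦ dist_nonneg) (fun y ↦ hC y x) h1

/-- The bounds for the exponent hold everywhere, not just almost everywhere: in particular the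
exponent is finite. -/
theorem IsLogHolder.recip_mem_Icc (hp : IsLogHolder p) (hp_minus : 1 < expMinus p) (x : Rn n) :
    recip p x ∈ Set.Icc ((expPlus p).toReal⁻¹) ((expMinus p).toReal⁻¹) := by
  have hae : ∀ᵐ x, recip p x ∈ Set.Icc ((expPlus p).toReal⁻¹) ((expMinus p).toReal⁻¹) := by
    filter_upwards [ae_essInf_le (f := p) (μ := volume), ae_le_essSup (f := p) (μ := volume)]
      with y h1 h2
    have h0 : (expMinus p)⁻¹ ≠ ⊤ := ENNReal.inv_ne_top.2 (zero_lt_one.trans hp_minus).ne'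
    have h3 : (p y)⁻¹ ≤ (expMinus p)⁻¹ := ENNReal.inv_le_inv.2 h1
    have h4 : (expPlus p)⁻¹ ≤ (p y)⁻¹ := ENNReal.inv_le_inv.2 h2
    rw [recip, ← ENNReal.toReal_inv, ← ENNReal.toReal_inv]
    exact ⟨ENNReal.toReal_mono (h3.trans_lt h0.lt_top).ne h4, ENNReal.toReal_mono h0 h3⟩
  have hcl : IsClosed (recip p ⁻¹' Set.Icc ((expPlus p).toReal⁻¹) ((expMinus p).toReal⁻¹)) :=
    isClosed_Icc.preimage hp.continuous_recip
  have huniv := (hcl.ae_eq_univ_iff_eq (μ := (volume : Measure (Rn n)))).1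
    (eventuallyEq_univ.2 hae)
  exact huniv.ge (Set.mem_univ x)

theorem expMinus_le_expPlus (p : Rn n → ℝ≥0∞) : expMinus p ≤ expPlus p := by
  obtain ⟨x, h1, h2⟩ := ((ae_essInf_le (f := p) (μ := volume)).and
    (ae_le_essSup (f := p) (μ := volume))).exists
  exact h1.trans h2

/-- Write `p = r q` with the constant `q = p⁻ > 1` and a log-Hölder continuous `r ≥ 1`. -/
theorem IsLogHolder.exists_eq_mul (hn : 0 < n) (hp : IsLogHolder p) (hp_minus : 1 < expMinus p)
    (hp_plus : expPlus p < ⊤) :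
    ∃ (q R c l : ℝ) (r : Rn n → ℝ), 1 < q ∧ IsLogHolderFn r c l ∧ Measurable r ∧
      (∀ x, r x ≤ R) ∧ ∀ x, p x = ENNReal.ofReal (r x * q) := by
  set m := (expMinus p).toReal with hm
  set M := (expPlus p).toReal with hM
  have hmt : expMinus p ≠ ⊤ := ((expMinus_le_expPlus p).trans_lt hp_plus).ne
  have hm1 : 1 < m := by
    rw [hm, ← ENNReal.toReal_one]
    exact ENNReal.toReal_strict_mono hmt hp_minus
  have hmM : m ≤ M := ENNReal.toReal_mono hp_plus.ne (expMinus_le_expPlus p)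
  have hm0 : 0 < m := by linarith
  have hM0 : 0 < M := by linarith
  have hI := hp.recip_mem_Icc hp_minus
  have hpos : ∀ x, 0 < recip p x := fun x ↦ (inv_pos.2 hM0).trans_le (hI x).1
  obtain ⟨⟨hmeas, -⟩, ⟨C, hC⟩, L, hL, C', hC'⟩ := id hp
  have : NeZero n := ⟨hn.ne'⟩
  have hLI : L ∈ Set.Icc (M⁻¹) (m⁻¹) := isClosed_Icc.mem_of_tendsto hL (.of_forall hI)
  have hinv : ∀ u ∈ Set.Icc (M⁻¹) (m⁻¹), m ≤ u⁻¹ ∧ u⁻¹ ≤ M := fun u hu ↦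
    ⟨by rw [le_inv_comm₀ hm0 ((inv_pos.2 hM0).trans_le hu.1)]; exact hu.2,
      by rw [inv_le_comm₀ ((inv_pos.2 hM0).trans_le hu.1) hM0]; exact hu.1⟩
  -- the inverse is Lipschitz continuous on `[1/p⁺, 1/p⁻]`
  have hlip : ∀ u ∈ Set.Icc (M⁻¹) (m⁻¹), ∀ v ∈ Set.Icc (M⁻¹) (m⁻¹), ∀ D : ℝ, 1 ≤ D →
      |u - v| ≤ max C C' / D → |u⁻¹ / m - v⁻¹ / m| ≤ M ^ 2 / m * max C C' / D := by
    intro u hu v hv D hD hA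
    have hu0 : 0 < u := (inv_pos.2 hM0).trans_le hu.1
    have hv0 : 0 < v := (inv_pos.2 hM0).trans_le hv.1
    have h0 : 0 ≤ max C C' / D := (abs_nonneg _).trans hA
    have hu1 := (hinv u hu).2
    have hv1 := (hinv v hv).2
    have e : u⁻¹ / m - v⁻¹ / m = (v - u) * (u⁻¹ * v⁻¹) / m := by field_simp
    rw [e, abs_div, abs_mul, abs_of_pos hm0, abs_of_pos (mul_pos (inv_pos.2 hu0) (inv_pos.2 hv0)),
      abs_sub_comm]
    calc |u - v| * (u⁻¹ * v⁻¹) / m ≤ max C C' / D * (M * M) / m := by gcongr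
      _ = _ := by ring
  have hlog : ∀ w : ℝ, 0 ≤ w → 0 < Real.log (Real.exp 1 + w) := fun w hw ↦
    one_pos.trans_le (one_le_log_exp_one_add hw)
  refine ⟨m, M / m, M ^ 2 / m * max C C', L⁻¹ / m, fun x ↦ (recip p x)⁻¹ / m, hm1, ⟨fun x ↦ ?_,
    ?_, fun x y ↦ ?_, fun x ↦ ?_⟩, ?_, fun x ↦ ?_, fun x ↦ ?_⟩
  · rw [one_le_div hm0]
    exact (hinv _ (hI x)).1
  · rw [one_le_div hm0]
    exact (hinv _ hLI).1
  · have h := hlog (1 / ‖x - y‖) (by positivity)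
    refine hlip _ (hI x) _ (hI y) _ (one_le_log_exp_one_add (by positivity)) ((hC x y).trans ?_)
    gcongr
    exact le_max_left _ _
  · have h := hlog ‖x‖ (norm_nonneg x)
    refine hlip _ (hI x) _ hLI _ (one_le_log_exp_one_add (norm_nonneg x)) ((hC' x).trans ?_)
    gcongr
    exact le_max_right _ _
  · exact (hp.continuous_recip.measurable.inv).div_const m
  · exact div_le_div_of_nonneg_right (hinv _ (hI x)).2 hm0.le
  · have h1 := hpos x
    rw [recip] at h1
    have h2 := ENNReal.toReal_pos_iff.1 h1
    rw [div_mul_cancel₀ _ hm0.ne', recip, ← ENNReal.toReal_inv, inv_inv, ENNReal.ofReal_toReal]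
    exact ENNReal.inv_pos.1 h2.1

end Exponents

/-! ### An interpolated bound for Riemann-Liouville type integrals -/

section Interpolation

/-- If `|w(t)| ≤ min (A, L t^{-e})`, then `∫₀^∞ t^{a-1} |w(t)| dt ≤ C A^{1-a/e} L^{a/e}`. -/
theorem lintegral_rpow_mul_min_le {a e : ℝ} (ha : 0 < a) (hae : a < e) (A : ℝ≥0∞) {L : ℝ}
    (hL : 0 ≤ L) :
    ∫⁻ t in Set.Ioi (0 : ℝ), ENNReal.ofReal (t ^ (a - 1)) * min A (ENNReal.ofReal (L * t ^ (-e))) ≤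
      ENNReal.ofReal (a⁻¹ + (e - a)⁻¹) * (A ^ (1 - a / e) * ENNReal.ofReal L ^ (a / e)) := by
  have he : 0 < e := ha.trans hae
  have hea : 0 < e - a := by linarith
  have hθ : 0 < a / e := by positivity
  have hθ1 : 0 < 1 - a / e := by
    rw [sub_pos, div_lt_one he]
    exact hae
  rcases hL.eq_or_lt with rfl | hL0
  · simp
  rcases eq_or_ne A ⊤ with rfl | hAt
  · rw [ENNReal.top_rpow_of_pos hθ1, ENNReal.top_mul, ENNReal.mul_top]
    · exact le_top
    · rw [← pos_iff_ne_zero, ENNReal.ofReal_pos]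
      positivity
    · rw [← pos_iff_ne_zero]
      exact ENNReal.rpow_pos (ENNReal.ofReal_pos.2 hL0) ENNReal.ofReal_ne_top
  obtain ⟨A, rfl⟩ : ∃ B : ℝ, A = ENNReal.ofReal B := ⟨A.toReal, (ENNReal.ofReal_toReal hAt).symm⟩
  rcases le_or_gt A 0 with hA0 | hA0
  · simp [ENNReal.ofReal_of_nonpos hA0]
  -- the two bounds coincide at `t = τ`
  set τ := (L / A) ^ (1 / e) with hτ
  have hLA : 0 < L / A := by positivity
  have hτ0 : 0 < τ := by positivity
  have h1 : A * τ ^ a = A ^ (1 - a / e) * L ^ (a / e) := by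
    rw [hτ, ← Real.rpow_mul hLA.le, Real.div_rpow hL0.le hA0.le, Real.rpow_sub hA0, Real.rpow_one,
      one_div_mul_eq_div]
    ring
  have h2 : L * τ ^ (a - e) = A ^ (1 - a / e) * L ^ (a / e) := by
    rw [← h1, Real.rpow_sub hτ0, mul_div_assoc']
    have : τ ^ e = L / A := by
      rw [hτ, ← Real.rpow_mul hLA.le, one_div_mul_cancel he.ne', Real.rpow_one]
    rw [this]
    field_simp
  have h3 : ∫⁻ t in Set.Ioc 0 τ, ENNReal.ofReal (t ^ (a - 1)) *
      min (ENNReal.ofReal A) (ENNReal.ofReal (L * t ^ (-e))) ≤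
      ENNReal.ofReal (a⁻¹ * (A ^ (1 - a / e) * L ^ (a / e))) := by
    calc _ ≤ ∫⁻ t in Set.Ioc 0 τ, ENNReal.ofReal A * ENNReal.ofReal (t ^ (a - 1)) := by
          refine lintegral_mono fun t ↦ ?_
          rw [mul_comm]
          gcongr
          exact min_le_left _ _
      _ = _ := by
          rw [lintegral_const_mul' _ _ ENNReal.ofReal_ne_top, ← setLIntegral_congr Ioo_ae_eq_Ioc,
            lintegral_Ioo_rpow ha hτ0.le, ENNReal.ofReal_rpow_of_nonneg hτ0.le ha.le,
            ← ENNReal.ofReal_inv_of_pos ha, ← ENNReal.ofReal_mul (by positivity),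
            ← ENNReal.ofReal_mul hA0.le, ← h1]
          congr 1
          ring
  have h4 : ∫⁻ t in Set.Ioi τ, ENNReal.ofReal (t ^ (a - 1)) *
      min (ENNReal.ofReal A) (ENNReal.ofReal (L * t ^ (-e))) ≤
      ENNReal.ofReal ((e - a)⁻¹ * (A ^ (1 - a / e) * L ^ (a / e))) := by
    calc _ ≤ ∫⁻ t in Set.Ioi τ, ENNReal.ofReal (L * t ^ (a - 1 - e)) := by
          refine setLIntegral_mono' measurableSet_Ioi fun t ht ↦ ?_
          have ht0 : 0 < t := hτ0.trans ht
          calc _ ≤ ENNReal.ofReal (t ^ (a - 1)) * ENNReal.ofReal (L * t ^ (-e)) := by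
                gcongr
                exact min_le_right _ _
            _ = _ := by
                rw [← ENNReal.ofReal_mul (by positivity), sub_eq_add_neg (a - 1) e,
                  Real.rpow_add ht0]
                congr 1
                ring
      _ = _ := by
          have hlt : a - 1 - e < -1 := by linarith
          rw [← ofReal_integral_eq_lintegral_ofReal
            ((integrableOn_Ioi_rpow_of_lt hlt hτ0).const_mul L)
            ((ae_restrict_iff' measurableSet_Ioi).2 (.of_forall fun t ht ↦ ?_)),
            integral_const_mul, integral_Ioi_rpow_of_lt hlt hτ0, ← h2]
          · have e1 : a - 1 - e + 1 = -(e - a) := by ring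
            have e2 : a - e = -(e - a) := by ring
            rw [e1, e2, neg_div_neg_eq]
            congr 1
            ring
          · exact mul_nonneg hL (Real.rpow_nonneg (hτ0.trans ht).le _)
  rw [← Set.Ioc_union_Ioi_eq_Ioi hτ0.le]
  refine (lintegral_union_le _ _ _).trans ((add_le_add h3 h4).trans (le_of_eq ?_))
  rw [ENNReal.ofReal_rpow_of_nonneg hA0.le hθ1.le, ENNReal.ofReal_rpow_of_nonneg hL0.le hθ.le,
    ← ENNReal.ofReal_mul (by positivity), ← ENNReal.ofReal_mul (by positivity),
    ← ENNReal.ofReal_add (by positivity) (by positivity)]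
  congr 1
  ring

end Interpolation

/-! ### Riesz potentials through the heat flow -/

section RieszPotential

variable {n : ℕ}

/-- The heat flow `(h_t * U)(x)`, `t > 0`, of the tempered distribution `U` with `V = 𝓕 U`. -/
def heatFlow (V : 𝓢'(Rn n, ℂ)) (t : ℝ) (x : Rn n) : ℂ :=
  if ht : 0 < t then V (Pw x (Gs ht)) else 0

theorem heatFlow_of_pos (V : 𝓢'(Rn n, ℂ)) {t : ℝ} (ht : 0 < t) (x : Rn n) :
    heatFlow V t x = V (Pw x (Gs ht)) := dif_pos ht

theorem continuousAt_heatFlow (V : 𝓢'(Rn n, ℂ)) {z : ℝ × Rn n} (hz : 0 < z.1) :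
    ContinuousAt (fun z : ℝ × Rn n ↦ heatFlow V z.1 z.2) z := by
  have hz2 : 0 < z.1 / 2 := by positivity
  -- factor out the heat semigroup at the time `z.1 / 2`
  have hfam : IsSmoothFamily {y : ℝ × Rn n | 0 ≤ y.1}
      (fun y ↦ Pw y.2 (Ht y.1 (Gs hz2))) := by
    have h1 : (fun y : (ℝ × Rn n) × Rn n ↦
        ((-(y.1.1 * (2 * Real.pi * ‖y.2‖) ^ 2) : ℝ) : ℂ)).HasTemperateGrowth :=
      hasTemperateGrowth_heat_exponent.comp (((ContinuousLinearMap.fst ℝ ℝ (Rn n)).prodMap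
        (ContinuousLinearMap.id ℝ (Rn n))).hasTemperateGrowth)
    have h2 : (fun y : (ℝ × Rn n) × Rn n ↦
        2 * Real.pi * Complex.I * ((inner ℝ y.1.2 y.2 : ℝ) : ℂ)).HasTemperateGrowth :=
      hasTemperateGrowth_planeWave_exponent.comp (((ContinuousLinearMap.snd ℝ ℝ (Rn n)).prodMap
        (ContinuousLinearMap.id ℝ (Rn n))).hasTemperateGrowth)
    refine isSmoothFamily_mul_cexp (Function.HasTemperateGrowth.const 1) (h1.add h2) (Gs hz2)
      (fun y hy ξ ↦ ?_) (fun y hy ξ ↦ ?_)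
    · rw [Pi.add_apply, Complex.add_re]
      have := heat_exponent_nonpos (show 0 ≤ y.1 from hy) ξ
      simpa using this
    · rw [Pw_apply, Ht_apply hy, planeWave, heatSymbol, Pi.add_apply, Complex.exp_add]
      ring
  have h3 := hfam.continuousOn_distribution V
  have h4 : ContinuousAt (fun y : ℝ × Rn n ↦ V (Pw y.2 (Ht y.1 (Gs hz2))))
      (z.1 - z.1 / 2, z.2) := by
    refine h3.continuousAt ?_
    have : {y : ℝ × Rn n | 0 < y.1} ∈ 𝓝 (z.1 - z.1 / 2, z.2) :=
      (isOpen_lt continuous_const continuous_fst).mem_nhds (by simpa using hz)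
    exact Filter.mem_of_superset this fun y (hy : 0 < y.1) ↦ hy.le
  have h5 : ContinuousAt (fun y : ℝ × Rn n ↦ ((y.1 - z.1 / 2, y.2) : ℝ × Rn n)) z := by fun_prop
  refine (ContinuousAt.comp (x := z) (f := fun y : ℝ × Rn n ↦ ((y.1 - z.1 / 2, y.2) : ℝ × Rn n))
    h4 h5).congr ?_
  have : {y : ℝ × Rn n | z.1 / 2 < y.1} ∈ 𝓝 z :=
    (isOpen_lt continuous_const continuous_fst).mem_nhds (by
      show z.1 / 2 < z.1
      linarith)
  filter_upwards [this] with y hy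
  have hy' : z.1 / 2 < y.1 := hy
  have hy0 : 0 < y.1 := by linarith
  rw [heatFlow_of_pos V hy0, Function.comp_apply, Ht_Gs hz2 (by linarith)]
  congr 3
  ring

theorem measurable_heatFlow (V : 𝓢'(Rn n, ℂ)) :
    Measurable (fun z : ℝ × Rn n ↦ heatFlow V z.1 z.2) := by
  classical
  have hm : MeasurableSet {z : ℝ × Rn n | 0 < z.1} :=
    measurableSet_lt measurable_const measurable_fst
  have h1 : (fun z : ℝ × Rn n ↦ heatFlow V z.1 z.2) =
      {z : ℝ × Rn n | 0 < z.1}.piecewise (fun z ↦ heatFlow V z.1 z.2) (fun _ ↦ 0) := by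
    funext z
    by_cases hz : 0 < z.1
    · rw [Set.piecewise_eq_of_mem _ _ _ (by exact hz)]
    · rw [Set.piecewise_eq_of_notMem _ _ _ (by exact hz), heatFlow, dif_neg hz]
  rw [h1]
  refine ContinuousOn.measurable_piecewise (fun z hz ↦ ?_) continuousOn_const hm
  exact (continuousAt_heatFlow V hz).continuousWithinAt

theorem distribution_Ht_eq_integral (V : 𝓢'(Rn n, ℂ)) {t : ℝ} (ht : 0 < t) (χ : 𝓢(Rn n, ℂ)) :
    V (Ht t χ) = ∫ x, 𝓕 χ x * heatFlow V t x := by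
  rw [← Mu_Gs ht, distribution_Mu]
  simp_rw [heatFlow_of_pos V ht]

/-- The Riesz potential `Γ(a)⁻¹ ∫₀^∞ t^{a-1} e^{(t+δ)Δ} U dt = (-Δ)^{-a} e^{δΔ} U`, where
`V = 𝓕 U`. -/
def rieszPotential (V : 𝓢'(Rn n, ℂ)) (a δ : ℝ) (x : Rn n) : ℂ :=
  ((Real.Gamma a)⁻¹ : ℂ) *
    ∫ t in Set.Ioi (0 : ℝ), ((t ^ (a - 1) : ℝ) : ℂ) * heatFlow V (t + δ) x

theorem measurable_rieszPotential_integrand (V : 𝓢'(Rn n, ℂ)) (a δ : ℝ) :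
    Measurable (fun z : ℝ × Rn n ↦ ((z.1 ^ (a - 1) : ℝ) : ℂ) * heatFlow V (z.1 + δ) z.2) := by
  have h1 : Measurable (fun z : ℝ × Rn n ↦ heatFlow V (z.1 + δ) z.2) :=
    (measurable_heatFlow V).comp
      (by fun_prop : Measurable fun z : ℝ × Rn n ↦ ((z.1 + δ, z.2) : ℝ × Rn n))
  exact (by fun_prop : Measurable fun z : ℝ × Rn n ↦ ((z.1 ^ (a - 1) : ℝ) : ℂ)).mul h1

theorem measurable_rieszPotential (V : 𝓢'(Rn n, ℂ)) (a δ : ℝ) :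
    Measurable (rieszPotential V a δ) := by
  have h := (measurable_rieszPotential_integrand V a δ).comp measurable_swap
  exact (h.stronglyMeasurable.integral_prod_right
    (f := fun x t ↦ ((t ^ (a - 1) : ℝ) : ℂ) * heatFlow V (t + δ) x)
    (ν := volume.restrict (Set.Ioi (0 : ℝ)))).measurable.const_mul _

variable {V : 𝓢'(Rn n, ℂ)} {A : Rn n → ℝ≥0∞} {L a e : ℝ}

theorem enorm_heatFlow_add_le (he : 0 < e) (hV : HasHeatBound V L e)
    (hA : ∀ t x, ‖heatFlow V t x‖ₑ ≤ A x) {t δ : ℝ} (ht : 0 < t) (hδ : 0 ≤ δ) (x : Rn n) :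
    ‖heatFlow V (t + δ) x‖ₑ ≤ min (A x) (ENNReal.ofReal (L * t ^ (-e))) := by
  have hL := hV.nonneg
  have h0 : 0 < t + δ := by positivity
  refine le_min (hA _ x) ?_
  rw [heatFlow_of_pos V h0, ← ofReal_norm]
  exact ENNReal.ofReal_le_ofReal ((hV _ h0 x).trans (mul_le_mul_of_nonneg_left
    (Real.rpow_le_rpow_of_nonpos ht (by linarith) (by linarith)) hL))

theorem lintegral_rieszPotential_integrand_le (ha : 0 < a) (hae : a < e) (hV : HasHeatBound V L e)
    (hA : ∀ t x, ‖heatFlow V t x‖ₑ ≤ A x) {δ : ℝ} (hδ : 0 ≤ δ) (x : Rn n) :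
    ∫⁻ t in Set.Ioi (0 : ℝ), ‖((t ^ (a - 1) : ℝ) : ℂ) * heatFlow V (t + δ) x‖ₑ ≤
      ENNReal.ofReal (a⁻¹ + (e - a)⁻¹) * (A x ^ (1 - a / e) * ENNReal.ofReal L ^ (a / e)) := by
  refine le_trans ?_ (lintegral_rpow_mul_min_le ha hae (A x) hV.nonneg)
  refine setLIntegral_mono' measurableSet_Ioi fun t ht ↦ ?_
  have ht0 : 0 < t := ht
  rw [enorm_mul, ← ofReal_norm, Complex.norm_real, Real.norm_of_nonneg (by positivity)]
  gcongr
  exact enorm_heatFlow_add_le (ha.trans hae) hV hA ht0 hδ x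

/-- Interpolation between the bound by the maximal function for short times and the decay of the
heat flow for long times. -/
theorem enorm_rieszPotential_le (ha : 0 < a) (hae : a < e) (hV : HasHeatBound V L e)
    (hA : ∀ t x, ‖heatFlow V t x‖ₑ ≤ A x) {δ : ℝ} (hδ : 0 ≤ δ) (x : Rn n) :
    ‖rieszPotential V a δ x‖ₑ ≤ ENNReal.ofReal ((Real.Gamma a)⁻¹ * (a⁻¹ + (e - a)⁻¹)) *
      (A x ^ (1 - a / e) * ENNReal.ofReal L ^ (a / e)) := by
  have hΓ := Real.Gamma_pos_of_pos ha
  rw [rieszPotential, enorm_mul, ENNReal.ofReal_mul (by positivity), mul_assoc]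
  gcongr
  · rw [← ofReal_norm, norm_inv, Complex.norm_real, Real.norm_of_nonneg hΓ.le]
  · exact (enorm_integral_le_lintegral_enorm _).trans
      (lintegral_rieszPotential_integrand_le ha hae hV hA hδ x)

theorem tendsto_rieszPotential (ha : 0 < a) (hae : a < e) (hV : HasHeatBound V L e)
    (hA : ∀ t x, ‖heatFlow V t x‖ₑ ≤ A x) {x : Rn n} (hx : A x ≠ ⊤) :
    Tendsto (fun δ ↦ rieszPotential V a δ x) (𝓝[>] 0) (𝓝 (rieszPotential V a 0 x)) := by
  have he := ha.trans hae
  have hae' : a / e < 1 := (div_lt_one he).2 hae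
  refine Tendsto.const_mul _ ?_
  have hmeas : ∀ δ, Measurable fun t : ℝ ↦ ((t ^ (a - 1) : ℝ) : ℂ) * heatFlow V (t + δ) x :=
    fun δ ↦ (measurable_rieszPotential_integrand V a δ).comp measurable_prodMk_right
  have hbm : Measurable fun t : ℝ ↦ ENNReal.ofReal (t ^ (a - 1)) *
      min (A x) (ENNReal.ofReal (L * t ^ (-e))) := by fun_prop
  have hfin : ∫⁻ t in Set.Ioi (0 : ℝ), ENNReal.ofReal (t ^ (a - 1)) *
      min (A x) (ENNReal.ofReal (L * t ^ (-e))) ≠ ⊤ := by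
    refine ((lintegral_rpow_mul_min_le ha hae (A x) hV.nonneg).trans_lt ?_).ne
    refine ENNReal.mul_lt_top ENNReal.ofReal_lt_top (ENNReal.mul_lt_top ?_ ?_)
    · exact (ENNReal.rpow_ne_top_of_nonneg (by linarith) hx).lt_top
    · exact (ENNReal.rpow_ne_top_of_nonneg (by positivity) ENNReal.ofReal_ne_top).lt_top
  refine tendsto_integral_filter_of_dominated_convergence
    (fun t ↦ (ENNReal.ofReal (t ^ (a - 1)) *
      min (A x) (ENNReal.ofReal (L * t ^ (-e)))).toReal) ?_ ?_ ?_ ?_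
  · exact .of_forall fun δ ↦ (hmeas δ).aestronglyMeasurable
  · refine eventually_nhdsWithin_of_forall fun δ hδ ↦
      (ae_restrict_iff' measurableSet_Ioi).2 (.of_forall fun t ht ↦ ?_)
    have ht0 : 0 < t := ht
    have hfin' : ENNReal.ofReal (t ^ (a - 1)) * min (A x) (ENNReal.ofReal (L * t ^ (-e))) ≠ ⊤ :=
      ENNReal.mul_ne_top ENNReal.ofReal_ne_top ((min_le_left _ _).trans_lt hx.lt_top).ne
    rw [← ENNReal.ofReal_le_iff_le_toReal hfin', ofReal_norm, enorm_mul, ← ofReal_norm,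
      Complex.norm_real, Real.norm_of_nonneg (by positivity)]
    gcongr
    exact enorm_heatFlow_add_le he hV hA ht0 (le_of_lt hδ) x
  · exact integrable_toReal_of_lintegral_ne_top hbm.aemeasurable hfin
  · refine (ae_restrict_iff' measurableSet_Ioi).2 (.of_forall fun t ht ↦ ?_)
    refine Tendsto.const_mul _ ?_
    have h1 : ContinuousAt (fun z : ℝ × Rn n ↦ heatFlow V z.1 z.2) (t + 0, x) :=
      continuousAt_heatFlow V (by simpa using ht)
    have h2 : ContinuousAt (fun δ : ℝ ↦ ((t + δ, x) : ℝ × Rn n)) 0 := by fun_prop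
    exact (ContinuousAt.comp (x := (0 : ℝ)) (f := fun δ : ℝ ↦ ((t + δ, x) : ℝ × Rn n))
      h1 h2).tendsto.mono_left nhdsWithin_le_nhds

theorem integral_rieszPotential (ha : 0 < a) (hae : a < e) (hV : HasHeatBound V L e)
    (hA : ∀ t x, ‖heatFlow V t x‖ₑ ≤ A x) {δ : ℝ} (hδ : 0 ≤ δ) (χ : 𝓢(Rn n, ℂ))
    (hfin : ∫⁻ x, ‖𝓕 χ x‖ₑ * A x ^ (1 - a / e) < ⊤) :
    ((Real.Gamma a)⁻¹ : ℂ) * ∫ t in Set.Ioi (0 : ℝ), ((t ^ (a - 1) : ℝ) : ℂ) * V (Ht (t + δ) χ) =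
      ∫ x, 𝓕 χ x * rieszPotential V a δ x := by
  have hae' : 0 ≤ a / e := by
    have := ha.trans hae
    positivity
  have hm := measurable_rieszPotential_integrand V a δ
  have hχm : Measurable (fun z : ℝ × Rn n ↦ 𝓕 χ z.2) :=
    (𝓕 χ).continuous.measurable.comp measurable_snd
  have hint : Integrable (Function.uncurry fun (t : ℝ) (x : Rn n) ↦
      𝓕 χ x * (((t ^ (a - 1) : ℝ) : ℂ) * heatFlow V (t + δ) x))
      ((volume.restrict (Set.Ioi (0 : ℝ))).prod volume) := by
    have hmeas : Measurable (Function.uncurry fun (t : ℝ) (x : Rn n) ↦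
      𝓕 χ x * (((t ^ (a - 1) : ℝ) : ℂ) * heatFlow V (t + δ) x)) := hχm.mul hm
    refine ⟨hmeas.aestronglyMeasurable, ?_⟩
    rw [HasFiniteIntegral, lintegral_prod_symm _ hmeas.enorm.aemeasurable]
    calc _ ≤ ∫⁻ x, ENNReal.ofReal (a⁻¹ + (e - a)⁻¹) * ENNReal.ofReal L ^ (a / e) *
          (‖𝓕 χ x‖ₑ * A x ^ (1 - a / e)) := by
          refine lintegral_mono fun x ↦ ?_
          simp only [Function.uncurry, enorm_mul (𝓕 χ x)]
          rw [lintegral_const_mul' _ _ enorm_ne_top]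
          calc _ ≤ ‖𝓕 χ x‖ₑ * (ENNReal.ofReal (a⁻¹ + (e - a)⁻¹) *
                (A x ^ (1 - a / e) * ENNReal.ofReal L ^ (a / e))) := by
                gcongr
                exact lintegral_rieszPotential_integrand_le ha hae hV hA hδ x
            _ = _ := by ring
      _ < ⊤ := by
          have h1 : ENNReal.ofReal L ^ (a / e) ≠ ⊤ :=
            ENNReal.rpow_ne_top_of_nonneg hae' ENNReal.ofReal_ne_top
          rw [lintegral_const_mul' _ _ (ENNReal.mul_ne_top ENNReal.ofReal_ne_top h1)]
          exact ENNReal.mul_lt_top (ENNReal.mul_ne_top ENNReal.ofReal_ne_top h1).lt_top hfin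
  have h1 : ∫ t in Set.Ioi (0 : ℝ), ((t ^ (a - 1) : ℝ) : ℂ) * V (Ht (t + δ) χ) =
      ∫ t in Set.Ioi (0 : ℝ), ∫ x, 𝓕 χ x * (((t ^ (a - 1) : ℝ) : ℂ) * heatFlow V (t + δ) x) := by
    refine setIntegral_congr_fun measurableSet_Ioi fun t ht ↦ ?_
    have ht0 : 0 < t + δ := add_pos_of_pos_of_nonneg ht hδ
    simp only [distribution_Ht_eq_integral V ht0, ← integral_const_mul]
    exact integral_congr_ae (.of_forall fun x ↦ by ring)
  rw [h1, integral_integral_swap hint, ← integral_const_mul]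
  refine integral_congr_ae (.of_forall fun x ↦ ?_)
  simp only [rieszPotential, integral_const_mul]
  ring

end RieszPotential

/-! ### Distributions given by functions -/

section Represents

variable {n : ℕ}

theorem Represents.congr_ae {T : 𝓢'(Rn n, ℂ)} {g g' : Rn n → ℂ} (h : Represents T g)
    (hg : g =ᵐ[volume] g') : Represents T g' := by
  refine ⟨h.1.congr hg, fun φ ↦ ?_⟩
  have : (fun x ↦ φ x * g x) =ᵐ[volume] fun x ↦ φ x * g' x := by
    filter_upwards [hg] with x hx
    rw [hx]
  exact ⟨(h.2 φ).1.congr this, (h.2 φ).2.trans (integral_congr_ae this)⟩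

theorem Represents.add {T S : 𝓢'(Rn n, ℂ)} {g h : Rn n → ℂ} (hT : Represents T g)
    (hS : Represents S h) : Represents (T + S) (fun x ↦ g x + h x) := by
  refine ⟨hT.1.add hS.1, fun φ ↦ ?_⟩
  have : (fun x ↦ φ x * (g x + h x)) = fun x ↦ φ x * g x + φ x * h x := by
    funext x
    ring
  rw [this, integral_add (hT.2 φ).1 (hS.2 φ).1, ← (hT.2 φ).2, ← (hS.2 φ).2]
  exact ⟨(hT.2 φ).1.add (hS.2 φ).1, rfl⟩

theorem Represents.sub {T S : 𝓢'(Rn n, ℂ)} {g h : Rn n → ℂ} (hT : Represents T g)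
    (hS : Represents S h) : Represents (T - S) (fun x ↦ g x - h x) := by
  refine ⟨hT.1.sub hS.1, fun φ ↦ ?_⟩
  have : (fun x ↦ φ x * (g x - h x)) = fun x ↦ φ x * g x - φ x * h x := by
    funext x
    ring
  rw [this, integral_sub (hT.2 φ).1 (hS.2 φ).1, ← (hT.2 φ).2, ← (hS.2 φ).2]
  exact ⟨(hT.2 φ).1.sub (hS.2 φ).1, rfl⟩

theorem represents_toTemperedDistribution {r : ℝ≥0∞} [Fact (1 ≤ r)] {γ : Rn n → ℂ}
    (h : MemLp γ r volume) : Represents (Lp.toTemperedDistribution h.toLp) γ := by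
  have hr : ENNReal.HolderConjugate (ENNReal.conjExponent r) r := by
    have := ENNReal.HolderConjugate.conjExponent (Fact.out : 1 ≤ r)
    exact this.symm
  refine ⟨h.1, fun φ ↦ ⟨?_, ?_⟩⟩
  · exact MemLp.integrable_mul (φ.memLp (ENNReal.conjExponent r) volume) h
  · rw [Lp.toTemperedDistribution_apply]
    refine integral_congr_ae ?_
    filter_upwards [h.coeFn_toLp] with x hx
    rw [hx, smul_eq_mul]

/-- A function which is bounded by a constant plus an integrable function is a tempered
distribution. -/
theorem exists_represents {γ : Rn n → ℂ} (hγ : Measurable γ) {F : Rn n → ℝ≥0∞} (hF : Measurable F)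
    (hFi : ∫⁻ x, F x ≠ ⊤) {c : ℝ≥0∞} (hc : c ≠ ⊤) (h : ∀ x, ‖γ x‖ₑ ≤ c * (1 + F x)) :
    ∃ U, Represents U γ := by
  set S : Set (Rn n) := {x | F x ≤ 1} with hS
  have hSm : MeasurableSet S := measurableSet_le hF measurable_const
  have h1 : MemLp (S.indicator γ) ⊤ volume := by
    refine memLp_top_of_bound (hγ.indicator hSm).aestronglyMeasurable (c * 2).toReal
      (.of_forall fun x ↦ ?_)
    rw [← ENNReal.ofReal_le_iff_le_toReal (ENNReal.mul_ne_top hc (by simp)), ofReal_norm]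
    by_cases hx : x ∈ S
    · rw [Set.indicator_of_mem hx]
      refine (h x).trans ?_
      gcongr
      rw [← one_add_one_eq_two]
      gcongr
      exact hx
    · rw [Set.indicator_of_notMem hx]
      simp
  have h2 : MemLp (Sᶜ.indicator γ) 1 volume := by
    rw [memLp_one_iff_integrable]
    refine ⟨(hγ.indicator hSm.compl).aestronglyMeasurable, ?_⟩
    refine (lintegral_mono fun x ↦ ?_).trans_lt
      ((lintegral_const_mul' (c * 2) F (ENNReal.mul_ne_top hc (by simp))).trans_lt
        (ENNReal.mul_lt_top (ENNReal.mul_ne_top hc (by simp)).lt_top hFi.lt_top))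
    by_cases hx : x ∈ S
    · rw [Set.indicator_of_notMem (by simpa using hx)]
      simp
    · rw [Set.indicator_of_mem (by simpa using hx)]
      have hx1 : 1 ≤ F x := (not_le.1 hx).le
      calc _ ≤ c * (1 + F x) := h x
        _ ≤ c * (F x + F x) := by gcongr
        _ = _ := by ring
  refine ⟨_, ((represents_toTemperedDistribution h1).add
    (represents_toTemperedDistribution h2)).congr_ae (.of_forall fun x ↦ ?_)⟩
  exact congrFun (Set.indicator_self_add_compl S γ) x

theorem lintegral_schwartz_mul_lt_top (φ : 𝓢(Rn n, ℂ)) {F : Rn n → ℝ≥0∞}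
    (hFi : ∫⁻ x, F x ≠ ⊤) : ∫⁻ x, ‖φ x‖ₑ * (1 + F x) < ⊤ := by
  obtain ⟨B, hB⟩ : ∃ B : ℝ, ∀ x, ‖φ x‖ ≤ B :=
    ⟨_, fun x ↦ SchwartzMap.norm_le_seminorm ℝ φ x⟩
  have h1 : ∀ x, ‖φ x‖ₑ * (1 + F x) ≤ ‖φ x‖ₑ + ENNReal.ofReal B * F x := by
    intro x
    rw [mul_add, mul_one]
    gcongr
    rw [← ofReal_norm]
    exact ENNReal.ofReal_le_ofReal (hB x)
  refine (lintegral_mono h1).trans_lt ?_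
  rw [lintegral_add_left φ.continuous.measurable.enorm,
    lintegral_const_mul' _ _ ENNReal.ofReal_ne_top]
  exact ENNReal.add_lt_top.2 ⟨(φ.integrable (μ := volume)).2,
    ENNReal.mul_lt_top ENNReal.ofReal_lt_top hFi.lt_top⟩

end Represents

/-! ### Smoothness of the heat flow -/

section Smoothness

variable {n : ℕ}

theorem hasFDerivAt_integral_smul_schwartz {u : Rn n → ℝ} (hu : Measurable u) {B : ℝ}
    (hB : ∀ x, ‖u x‖ ≤ B) {F : Type} [NormedAddCommGroup F] [NormedSpace ℝ F] (ψ : 𝓢(Rn n, F))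
    (x : Rn n) :
    HasFDerivAt (fun x ↦ ∫ y, u y • ψ (x - y))
      (∫ y, u y • SchwartzMap.fderivCLM ℝ (Rn n) F ψ (x - y)) x := by
  have hB0 : 0 ≤ B := (norm_nonneg _).trans (hB 0)
  set C : ℝ := 2 ^ (n + 1) * ((Finset.Iic (n + 1, 0)).sup
    (fun m ↦ SchwartzMap.seminorm ℝ m.1 m.2)) (SchwartzMap.fderivCLM ℝ (Rn n) F ψ) with hC
  have hC0 : 0 ≤ C := by positivity
  have hdec : ∀ z, ‖SchwartzMap.fderivCLM ℝ (Rn n) F ψ z‖ ≤ C * ((1 + ‖z‖) ^ (n + 1))⁻¹ := by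
    intro z
    have h := SchwartzMap.one_add_le_sup_seminorm_apply (𝕜 := ℝ) (m := (n + 1, 0)) le_rfl le_rfl
      (SchwartzMap.fderivCLM ℝ (Rn n) F ψ) z
    rw [norm_iteratedFDeriv_zero] at h
    rw [← div_eq_mul_inv, le_div_iff₀ (by positivity), mul_comm]
    exact h
  have : SecondCountableTopologyEither (Rn n) (Rn n →L[ℝ] F) := ⟨.inl inferInstance⟩
  refine hasFDerivAt_integral_of_dominated_of_fderiv_le (s := Metric.ball x 1)
    (F' := fun x y ↦ u y • SchwartzMap.fderivCLM ℝ (Rn n) F ψ (x - y))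
    (bound := fun y ↦ B * (C * 2 ^ (n + 1)) * (1 + ‖x - y‖) ^ (-((n : ℝ) + 1)))
    (Metric.ball_mem_nhds x one_pos) ?_ ?_ ?_ ?_ ?_ ?_
  · refine .of_forall fun x ↦ ?_
    exact hu.aestronglyMeasurable.smul
      (ψ.continuous.comp (by fun_prop : Continuous fun y ↦ x - y)).aestronglyMeasurable
  · exact (ψ.integrable.comp_sub_left x).bdd_smul _ hu.aestronglyMeasurable (.of_forall hB)
  · exact hu.aestronglyMeasurable.smul ((SchwartzMap.continuous _).comp
      (by fun_prop : Continuous fun y ↦ x - y)).aestronglyMeasurable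
  · refine .of_forall fun y z hz ↦ ?_
    rw [norm_smul, mul_assoc]
    refine mul_le_mul (hB y) ((hdec _).trans ?_) (norm_nonneg _) hB0
    have h1 : 1 + ‖x - y‖ ≤ 2 * (1 + ‖z - y‖) := by
      have h2 : ‖x - y‖ ≤ ‖z - x‖ + ‖z - y‖ := by
        have e : x - y = (z - y) - (z - x) := by abel
        rw [e, add_comm]
        exact norm_sub_le _ _
      have h3 : ‖z - x‖ < 1 := by rwa [← dist_eq_norm]
      have := norm_nonneg (z - y)
      linarith
    have h4 : (1 + ‖x - y‖) ^ (-((n : ℝ) + 1)) = ((1 + ‖x - y‖) ^ (n + 1))⁻¹ := by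
      rw [Real.rpow_neg (by positivity), ← Real.rpow_natCast]
      push_cast
      rfl
    rw [h4, mul_assoc C]
    refine mul_le_mul_of_nonneg_left ?_ hC0
    rw [← div_eq_mul_inv, inv_eq_one_div, div_le_div_iff₀ (by positivity) (by positivity), one_mul,
      ← mul_pow]
    exact pow_le_pow_left₀ (by positivity) h1 _
  · exact ((integrable_one_add_norm (E := Rn n) (μ := volume) (r := n + 1)
      (by simp)).comp_sub_left x).const_mul _
  · refine .of_forall fun y z _ ↦ ?_
    have h1 : HasFDerivAt ψ (fderiv ℝ ψ (z - y)) (z - y) := (ψ.differentiableAt).hasFDerivAt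
    have h2 := h1.comp z ((hasFDerivAt_id z).sub_const y)
    rw [SchwartzMap.fderivCLM_apply]
    exact h2.const_smul (u y)

/-- The convolution of a bounded function with a Schwartz function is smooth. -/
theorem contDiff_integral_smul_schwartz {u : Rn n → ℝ} (hu : Measurable u) {B : ℝ}
    (hB : ∀ x, ‖u x‖ ≤ B) (k : ℕ) : ∀ {F : Type} [NormedAddCommGroup F] [NormedSpace ℝ F]
    (ψ : 𝓢(Rn n, F)), ContDiff ℝ k (fun x ↦ ∫ y, u y • ψ (x - y)) := by
  induction k with
  | zero =>
    intro F _ _ ψ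
    refine contDiff_zero.2 (continuous_iff_continuousAt.2 fun x ↦ ?_)
    exact (hasFDerivAt_integral_smul_schwartz hu hB ψ x).continuousAt
  | succ k ih =>
    intro F _ _ ψ
    push_cast
    exact contDiff_succ_iff_hasFDerivAt.2
      ⟨_, ih (SchwartzMap.fderivCLM ℝ (Rn n) F ψ), hasFDerivAt_integral_smul_schwartz hu hB ψ⟩

theorem heatFlow_eq_convolution (Θ : 𝓢'(Rn n, ℂ)) {t r : ℝ} (ht : 0 < t) (hr : 0 < r)
    (x : Rn n) :
    heatFlow Θ (t + r) x = ∫ y, heatKernel ht 0 (x - y) * heatFlow Θ r y := by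
  have h1 : heatFlow Θ (t + r) x = Θ (Ht r (Pw x (Gs ht))) := by
    rw [heatFlow_of_pos Θ (by positivity), ← Pw_Ht x hr.le, Ht_Gs ht hr.le]
  rw [h1, distribution_Ht_eq_integral Θ hr, fourier_Pw_Gs]
  refine integral_congr_ae (.of_forall fun y ↦ ?_)
  simp only [heatKernel_apply, zero_sub, norm_neg]

theorem contDiff_heatFlow {Θ : 𝓢'(Rn n, ℂ)} {K b : ℝ} (hΘ : HasHeatBound Θ K b) {t : ℝ}
    (ht : 0 < t) : ContDiff ℝ ∞ (heatFlow Θ t) := by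
  have ht2 : 0 < t / 2 := by positivity
  have hm : Measurable (heatFlow Θ (t / 2)) :=
    (measurable_heatFlow Θ).comp measurable_prodMk_left
  have hb : ∀ x, ‖heatFlow Θ (t / 2) x‖ ≤ K * (t / 2) ^ (-b) := fun x ↦ by
    rw [heatFlow_of_pos Θ ht2]
    exact hΘ _ ht2 x
  set ψ : 𝓢(Rn n, ℂ) := heatKernel ht2 0 with hψ
  have hint : Integrable (fun y ↦ ψ y) := ψ.integrable
  have h1 : heatFlow Θ t = fun x ↦ (∫ y, (heatFlow Θ (t / 2) y).re • ψ (x - y)) +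
      (∫ y, (heatFlow Θ (t / 2) y).im • ψ (x - y)) * Complex.I := by
    funext x
    have e : t = t / 2 + t / 2 := by ring
    nth_rewrite 1 [e]
    rw [heatFlow_eq_convolution Θ ht2 ht2, ← integral_mul_const, ← integral_add]
    · refine integral_congr_ae (.of_forall fun y ↦ ?_)
      simp only [Complex.real_smul, ← hψ]
      nth_rewrite 1 [← Complex.re_add_im (heatFlow Θ (t / 2) y)]
      ring
    · exact (hint.comp_sub_left x).bdd_smul _ (Complex.measurable_re.comp hm).aestronglyMeasurable
        (.of_forall fun y ↦ (Complex.abs_re_le_norm _).trans (hb y))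
    · exact ((hint.comp_sub_left x).bdd_smul _ (Complex.measurable_im.comp hm).aestronglyMeasurable
        (.of_forall fun y ↦ (Complex.abs_im_le_norm _).trans (hb y))).mul_const _
  rw [h1]
  refine contDiff_infty.2 fun k ↦ ContDiff.add ?_ (ContDiff.mul ?_ contDiff_const)
  · exact contDiff_integral_smul_schwartz (Complex.measurable_re.comp hm)
      (fun y ↦ (Complex.abs_re_le_norm _).trans (hb y)) k ψ
  · exact contDiff_integral_smul_schwartz (Complex.measurable_im.comp hm)
      (fun y ↦ (Complex.abs_im_le_norm _).trans (hb y)) k ψ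

/-- The tempered distribution `e^{δΔ} T`. -/
def heatDistribution (δ : ℝ) (T : 𝓢'(Rn n, ℂ)) : 𝓢'(Rn n, ℂ) :=
  𝓕⁻ (TemperedDistribution.smulLeftCLM ℂ (heatSymbol δ) (𝓕 T))

theorem fourier_heatDistribution_apply (δ : ℝ) (T : 𝓢'(Rn n, ℂ)) (χ : 𝓢(Rn n, ℂ)) :
    𝓕 (heatDistribution δ T) χ = 𝓕 T (Ht δ χ) := by
  rw [heatDistribution, FourierTransform.fourier_fourierInv_eq]
  rfl

theorem represents_heatDistribution {δ : ℝ} (hδ : 0 < δ) (T : 𝓢'(Rn n, ℂ)) :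
    Represents (heatDistribution δ T) (heatFlow (𝓕 T) δ) := by
  refine ⟨((measurable_heatFlow (𝓕 T)).comp measurable_prodMk_left).aestronglyMeasurable,
    fun φ ↦ ⟨?_, ?_⟩⟩
  · have := integrable_distribution_Mu (𝓕 T) (Gs hδ) φ
    simpa only [heatFlow_of_pos (𝓕 T) hδ] using this
  · have h1 : heatDistribution δ T φ = 𝓕 (heatDistribution δ T) (𝓕⁻ φ) := by
      rw [TemperedDistribution.fourier_apply, FourierTransform.fourier_fourierInv_eq]
    rw [h1, fourier_heatDistribution_apply, distribution_Ht_eq_integral _ hδ,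
      FourierTransform.fourier_fourierInv_eq]

theorem isSmooth_heatDistribution {δ : ℝ} (hδ : 0 < δ) {T : 𝓢'(Rn n, ℂ)} {K b : ℝ}
    (hT : HasHeatBound (𝓕 T) K b) : IsSmooth (heatDistribution δ T) :=
  ⟨_, contDiff_heatFlow hT hδ, represents_heatDistribution hδ T⟩

end Smoothness

/-! ### The interpolation inequality -/

section Inequality

variable {n : ℕ}

theorem luxNorm_le_of_modular_le {q : Rn n → ℝ≥0∞} {γ : Rn n → ℂ} {r : ℝ} (hr : 0 < r)
    (h : modular q (fun x ↦ γ x / (r : ℂ)) ≤ 1) : luxNorm q γ ≤ ENNReal.ofReal r :=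
  iInf_le_of_le r (iInf_le_of_le hr (iInf_le _ h))

theorem sobolevNorm_le_luxNorm {s : ℝ} {p : Rn n → ℝ≥0∞} {T U : 𝓢'(Rn n, ℂ)} {g : Rn n → ℂ}
    (hU : IsFracLaplacian s T U) (hg : Represents U g) : sobolevNorm s p T ≤ luxNorm p g :=
  iInf₂_le g ⟨U, hU, hg⟩

theorem enorm_div_ofReal (z : ℂ) {r : ℝ} (hr : 0 < r) :
    ‖z / (r : ℂ)‖ₑ = ENNReal.ofReal r⁻¹ * ‖z‖ₑ := by
  rw [div_eq_mul_inv, enorm_mul, mul_comm, ← Complex.ofReal_inv]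
  congr 1
  rw [← ofReal_norm, Complex.norm_real, Real.norm_of_nonneg (by positivity)]

theorem rpow_le_one_add_rpow (h : ℝ≥0∞) {τ P : ℝ} (hτ : 0 ≤ τ) (hτP : τ ≤ P) :
    h ^ τ ≤ 1 + h ^ P := by
  rcases le_total h 1 with h1 | h1
  · exact le_add_right (ENNReal.rpow_le_one h1 hτ)
  · exact le_add_left (ENNReal.rpow_le_rpow_of_exponent_le h1 hτP)

theorem hasHeatBound_of_besovNorm_le {T : 𝓢'(Rn n, ℂ)} {β K : ℝ} (hK : 0 ≤ K)
    (h : besovNorm β T ≤ ENNReal.ofReal K) : HasHeatBound (𝓕 T) K (β / 2) := by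
  intro t ht x
  have h1 : ENNReal.ofReal (t ^ (β / 2)) * ‖T (heatKernel ht x)‖ₑ ≤ ENNReal.ofReal K :=
    (le_iSup_of_le t (le_iSup_of_le ht (le_iSup (fun x ↦ ENNReal.ofReal (t ^ (β / 2)) *
      ‖T (heatKernel ht x)‖ₑ) x))).trans h
  rw [← ofReal_norm, ← ENNReal.ofReal_mul (by positivity), ENNReal.ofReal_le_ofReal_iff hK] at h1
  rw [TemperedDistribution.fourier_apply, fourier_Pw_Gs, Real.rpow_neg ht.le, ← div_eq_mul_inv,
    le_div_iff₀ (by positivity), mul_comm]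
  exact h1

/-- The heat flow of the function `g` is controlled by its maximal function. -/
theorem enorm_heatFlow_le_of_represents {U : 𝓢'(Rn n, ℂ)} {g : Rn n → ℂ} (hU : Represents U g)
    (hg : Measurable g) {C r : ℝ} (hr : 0 < r)
    (hC : ∀ f : Rn n → ℝ≥0∞, Measurable f → ∀ (t : ℝ) (ht : 0 < t) (x : Rn n),
      ∫⁻ y, ‖heatKernel ht x y‖ₑ * f y ≤ ENNReal.ofReal C * maximalFn f x) (t : ℝ) (x : Rn n) :
    ‖heatFlow (𝓕 U) t x‖ₑ ≤
      ENNReal.ofReal (r * C) * maximalFn (fun y ↦ ‖g y / (r : ℂ)‖ₑ) x := by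
  by_cases ht : 0 < t
  swap
  · rw [heatFlow, dif_neg ht]
    simp
  rw [heatFlow_of_pos _ ht, TemperedDistribution.fourier_apply, fourier_Pw_Gs, (hU.2 _).2]
  refine (enorm_integral_le_lintegral_enorm _).trans ?_
  calc ∫⁻ y, ‖heatKernel ht x y * g y‖ₑ
      = ENNReal.ofReal r * ∫⁻ y, ‖heatKernel ht x y‖ₑ * ‖g y / (r : ℂ)‖ₑ := by
        rw [← lintegral_const_mul' _ _ ENNReal.ofReal_ne_top]
        refine lintegral_congr fun y ↦ ?_
        rw [enorm_mul, enorm_div_ofReal _ hr, mul_left_comm (‖heatKernel ht x y‖ₑ), ← mul_assoc,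
          ← ENNReal.ofReal_mul hr.le, mul_inv_cancel₀ hr.ne', ENNReal.ofReal_one, one_mul]
    _ ≤ ENNReal.ofReal r * (ENNReal.ofReal C *
        maximalFn (fun y ↦ ‖g y / (r : ℂ)‖ₑ) x) := by
        gcongr
        exact hC _ (hg.div_const _).enorm t ht x
    _ = _ := by rw [ENNReal.ofReal_mul hr.le, mul_assoc]

/-- If `U = (-Δ)^σ T` has a heat flow bounded by `H ∈ L^{P(·)}`, and `T` lies in a Besov space of
negative order, then the function `Γ(a)⁻¹ ∫₀^∞ t^{a-1} e^{(t+δ)Δ} U dt` represents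
`(-Δ)^{σ-a} e^{δΔ} T`. -/
theorem exists_isFracLaplacian_rieszPotential {T U S : 𝓢'(Rn n, ℂ)} {σ a b K L δ : ℝ} {κ : ℝ≥0∞}
    {H : Rn n → ℝ≥0∞} {P : Rn n → ℝ} (hσ : 0 < σ) (ha : 0 < a) (haσ : a ≤ σ) (hb : 0 < b)
    (hδ : 0 ≤ δ) (hU : IsFracLaplacian (2 * σ) T U) (hT : HasHeatBound (𝓕 T) K b)
    (hL : HasHeatBound (𝓕 U) L (σ + b)) (hκ : κ ≠ ⊤) (hH : Measurable H) (hPm : Measurable P)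
    (hP : ∀ x, 1 ≤ P x) (hHP : ∫⁻ x, H x ^ P x ≠ ⊤)
    (hA : ∀ t x, ‖heatFlow (𝓕 U) t x‖ₑ ≤ κ * H x)
    (hS : ∀ χ, 𝓕 S χ = 𝓕 T (Ht δ χ)) :
    ∃ U', IsFracLaplacian (2 * (σ - a)) S U' ∧ Represents U' (rieszPotential (𝓕 U) a δ) := by
  have hae : a < σ + b := by linarith
  have he : 0 < σ + b := by linarith
  set τ := 1 - a / (σ + b) with hτ
  have hτ0 : 0 ≤ τ := by
    rw [hτ, sub_nonneg, div_le_one he]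
    exact hae.le
  have hτ1 : τ ≤ 1 := sub_le_self _ (by positivity)
  have hpow : ∀ x, (κ * H x) ^ τ ≤ κ ^ τ * (1 + H x ^ P x) := by
    intro x
    rw [ENNReal.mul_rpow_of_nonneg _ _ hτ0]
    gcongr
    exact rpow_le_one_add_rpow _ hτ0 (hτ1.trans (hP x))
  have hκτ : κ ^ τ ≠ ⊤ := ENNReal.rpow_ne_top_of_nonneg hτ0 hκ
  have hLθ : ENNReal.ofReal L ^ (a / (σ + b)) ≠ ⊤ :=
    ENNReal.rpow_ne_top_of_nonneg (by positivity) ENNReal.ofReal_ne_top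
  obtain ⟨U', hU'⟩ := exists_represents (measurable_rieszPotential (𝓕 U) a δ) (hH.pow hPm) hHP
    (c := ENNReal.ofReal ((Real.Gamma a)⁻¹ * (a⁻¹ + (σ + b - a)⁻¹)) *
      (κ ^ τ * ENNReal.ofReal L ^ (a / (σ + b))))
    (by finiteness) (fun x ↦ by
      refine (enorm_rieszPotential_le ha hae hL hA hδ x).trans ?_
      calc _ ≤ ENNReal.ofReal ((Real.Gamma a)⁻¹ * (a⁻¹ + (σ + b - a)⁻¹)) *
            (κ ^ τ * (1 + H x ^ P x) * ENNReal.ofReal L ^ (a / (σ + b))) := by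
            gcongr
            exact hpow x
        _ = _ := by ring)
  refine ⟨U', isFracLaplacian_iff.2 fun χ ↦ ?_, hU'⟩
  have hfin : ∫⁻ x, ‖𝓕 χ x‖ₑ * (κ * H x) ^ τ < ⊤ := by
    refine lt_of_le_of_lt (lintegral_mono fun x ↦ ?_)
      ((lintegral_const_mul' (κ ^ τ) (fun x ↦ ‖𝓕 χ x‖ₑ * (1 + H x ^ P x)) hκτ).trans_lt
        (ENNReal.mul_lt_top hκτ.lt_top (lintegral_schwartz_mul_lt_top (𝓕 χ) hHP)))
    calc _ ≤ ‖𝓕 χ x‖ₑ * (κ ^ τ * (1 + H x ^ P x)) := by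
          gcongr
          exact hpow x
      _ = _ := by ring
  have h1 := tendsto_Rg_of_isSymbolLimit hσ ha haσ hb (isFracLaplacian_iff.1 hU) hT (Ht δ χ)
  have h2 : 𝓕 U' χ = ∫ x, 𝓕 χ x * rieszPotential (𝓕 U) a δ x := (hU'.2 (𝓕 χ)).2
  rw [h2, ← integral_rieszPotential ha hae hL hA hδ χ hfin]
  have h3 : ∫ t in Set.Ioi (0 : ℝ), ((t ^ (a - 1) : ℝ) : ℂ) * 𝓕 U (Ht t (Ht δ χ)) =
      ∫ t in Set.Ioi (0 : ℝ), ((t ^ (a - 1) : ℝ) : ℂ) * 𝓕 U (Ht (t + δ) χ) :=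
    setIntegral_congr_fun measurableSet_Ioi fun t ht ↦ by
      beta_reduce
      rw [Ht_Ht (le_of_lt ht) hδ]
  rw [h3] at h1
  refine h1.congr' (eventually_nhdsWithin_of_forall fun ε hε ↦ ?_)
  beta_reduce
  rw [hS, Ht_Rg hδ _ hε]

variable {γ : Rn n → ℂ} {H : Rn n → ℝ≥0∞} {q : Rn n → ℝ≥0∞} {P : Rn n → ℝ} {d τ : ℝ}

theorem enorm_div_rpow_le (hτ : 0 < τ) (hP : ∀ x, 1 ≤ P x)
    (hq : ∀ x, (q x).toReal = P x / τ) (hγ : ∀ x, ‖γ x‖ₑ ≤ ENNReal.ofReal d * H x ^ τ) {r : ℝ}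
    (hr : 0 < r) (x : Rn n) :
    ‖γ x / (r : ℂ)‖ₑ ^ (q x).toReal ≤ ENNReal.ofReal (d / r) ^ (P x / τ) * H x ^ P x := by
  have h0 : 0 ≤ P x / τ := div_nonneg (zero_le_one.trans (hP x)) hτ.le
  have h1 : H x ^ P x = (H x ^ τ) ^ (P x / τ) := by
    rw [← ENNReal.rpow_mul, mul_div_cancel₀ _ hτ.ne']
  rw [hq, h1, ← ENNReal.mul_rpow_of_nonneg _ _ h0, enorm_div_ofReal _ hr]
  refine ENNReal.rpow_le_rpow ?_ h0
  rw [div_eq_inv_mul, ENNReal.ofReal_mul (by positivity), mul_assoc]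
  gcongr
  exact hγ x

theorem modular_div_le_one (hd : 0 ≤ d) (hτ : 0 < τ) (hτ1 : τ ≤ 1) (hP : ∀ x, 1 ≤ P x)
    (hq : ∀ x, (q x).toReal = P x / τ) (hγ : ∀ x, ‖γ x‖ₑ ≤ ENNReal.ofReal d * H x ^ τ) {M r : ℝ}
    (hM : 0 ≤ M) (hHP : ∫⁻ x, H x ^ P x ≤ ENNReal.ofReal M) (hr : 0 < r) (hdr : d * (1 + M) ≤ r) :
    modular q (fun x ↦ γ x / (r : ℂ)) ≤ 1 := by
  have hdr1 : d / r ≤ 1 := by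
    rw [div_le_one hr]
    nlinarith
  calc modular q (fun x ↦ γ x / (r : ℂ)) ≤ ∫⁻ x, ENNReal.ofReal (d / r) * H x ^ P x := by
        refine lintegral_mono fun x ↦ (enorm_div_rpow_le hτ hP hq hγ hr x).trans ?_
        gcongr
        nth_rewrite 2 [← ENNReal.rpow_one (ENNReal.ofReal (d / r))]
        refine ENNReal.rpow_le_rpow_of_exponent_ge (ENNReal.ofReal_le_one.2 hdr1) ?_
        rw [le_div_iff₀ hτ, one_mul]
        exact hτ1.trans (hP x)
    _ ≤ ENNReal.ofReal (d / r) * ENNReal.ofReal M := by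
        rw [lintegral_const_mul' _ _ ENNReal.ofReal_ne_top]
        gcongr
    _ ≤ 1 := by
        rw [← ENNReal.ofReal_mul (by positivity), ENNReal.ofReal_le_one, div_mul_eq_mul_div,
          div_le_one hr]
        linarith

/-- Dominated convergence in a variable Lebesgue space. -/
theorem tendsto_modular_div {ι : Type*} {l : Filter ι} [l.IsCountablyGenerated]
    {γ : ι → Rn n → ℂ} (hτ : 0 < τ) (hP : ∀ x, 1 ≤ P x) (hPm : Measurable P) {R : ℝ}
    (hPR : ∀ x, P x ≤ R) (hq : ∀ x, (q x).toReal = P x / τ) (hγm : ∀ i, Measurable (γ i))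
    (hγ : ∀ᶠ i in l, ∀ x, ‖γ i x‖ₑ ≤ ENNReal.ofReal d * H x ^ τ) (hHP : ∫⁻ x, H x ^ P x ≠ ⊤)
    (hlim : ∀ᵐ x, Tendsto (fun i ↦ γ i x) l (𝓝 0)) {r : ℝ} (hr : 0 < r) :
    Tendsto (fun i ↦ modular q (fun x ↦ γ i x / (r : ℂ))) l (𝓝 0) := by
  have hR : 0 ≤ R := zero_le_one.trans ((hP 0).trans (hPR 0))
  set c : ℝ≥0∞ := max 1 (ENNReal.ofReal (d / r)) ^ (R / τ) with hc
  have hct : c ≠ ⊤ := ENNReal.rpow_ne_top_of_nonneg (by positivity) (by simp)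
  have hqm : Measurable fun x ↦ (q x).toReal := by
    simp_rw [hq]
    exact hPm.div_const τ
  have h0 : (0 : ℝ≥0∞) = ∫⁻ _ : Rn n, 0 := by simp
  rw [h0]
  refine tendsto_lintegral_filter_of_dominated_convergence (fun x ↦ c * H x ^ P x) ?_ ?_ ?_ ?_
  · exact .of_forall fun i ↦ ((hγm i).div_const _).enorm.pow hqm
  · filter_upwards [hγ] with i hi
    refine .of_forall fun x ↦ (enorm_div_rpow_le hτ hP hq hi hr x).trans ?_
    have h1 : 0 ≤ P x / τ := div_nonneg (zero_le_one.trans (hP x)) hτ.le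
    gcongr
    calc ENNReal.ofReal (d / r) ^ (P x / τ) ≤ max 1 (ENNReal.ofReal (d / r)) ^ (P x / τ) := by
          gcongr
          exact le_max_right _ _
      _ ≤ c := ENNReal.rpow_le_rpow_of_exponent_le (le_max_left _ _)
          (div_le_div_of_nonneg_right (hPR x) hτ.le)
  · rw [lintegral_const_mul' _ _ hct]
    exact ENNReal.mul_ne_top hct hHP
  · filter_upwards [hlim] with x hx
    have h1 : 0 < (q x).toReal := by
      rw [hq]
      exact div_pos (one_pos.trans_le (hP x)) hτ
    have h2 : Tendsto (fun i ↦ γ i x / (r : ℂ)) l (𝓝 0) := by simpa using hx.div_const (r : ℂ)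
    have h3 : Tendsto (fun i ↦ ‖γ i x / (r : ℂ)‖ₑ ^ (q x).toReal) l
        (𝓝 (‖(0 : ℂ)‖ₑ ^ (q x).toReal)) := (ENNReal.continuous_rpow_const.tendsto _).comp h2.enorm
    rwa [enorm_zero, ENNReal.zero_rpow_of_pos h1] at h3

/-- The estimate for fixed upper bounds `r` and `K` of the two norms on the right-hand side. -/
theorem exists_sobolevNorm_le {p q : Rn n → ℝ≥0∞} (hn : 0 < n) (hp : IsLogHolder p)
    (hp_minus : 1 < expMinus p) (hp_plus : expPlus p < ⊤) {s s₁ β θ : ℝ} (hβ : 0 < β)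
    (hs₁ : 0 ≤ s₁) (hs₁s : s₁ < s) (hθ : θ = (s - s₁) / (β + s))
    (hq : ∀ x, q x = p x / ENNReal.ofReal (1 - θ)) :
    ∃ N : ℝ, 0 ≤ N ∧ ∀ (T U : 𝓢'(Rn n, ℂ)) (g : Rn n → ℂ) (r K : ℝ), 0 < r → 0 < K →
      besovNorm β T ≤ ENNReal.ofReal K → IsFracLaplacian s T U → Represents U g →
      modular p (fun x ↦ g x / (r : ℂ)) ≤ 1 →
        MemSobolev s₁ q T ∧ sobolevNorm s₁ q T ≤ ENNReal.ofReal (N * (r ^ (1 - θ) * K ^ θ)) := by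
  obtain ⟨σ, a, b, rfl, rfl, rfl⟩ : ∃ σ a b : ℝ, s = 2 * σ ∧ s₁ = 2 * (σ - a) ∧ β = 2 * b :=
    ⟨s / 2, (s - s₁) / 2, β / 2, by ring, by ring, by ring⟩
  have ha : 0 < a := by linarith
  have haσ : a ≤ σ := by linarith
  have hσ : 0 < σ := by linarith
  have hb : 0 < b := by linarith
  have hae : a < σ + b := by linarith
  have hθe : θ = a / (σ + b) := by
    rw [hθ]
    field_simp
    ring
  have hθ0 : 0 < θ := by
    rw [hθe]
    positivity
  have hθ1 : θ < 1 := by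
    rw [hθe, div_lt_one (by positivity)]
    exact hae
  have hτ0 : 0 < 1 - θ := by linarith
  obtain ⟨q₀, R, c, l, ρ, hq₀, hρ, hρm, hρR, hpρ⟩ := hp.exists_eq_mul hn hp_minus hp_plus
  set P : Rn n → ℝ := fun x ↦ ρ x * q₀ with hPdef
  have hPm : Measurable P := hρm.mul_const q₀
  have hP : ∀ x, 1 ≤ P x := fun x ↦ by
    have := hρ.one_le x
    simp only [hPdef]
    nlinarith
  have hPR : ∀ x, P x ≤ R * q₀ := fun x ↦ by
    simp only [hPdef]
    gcongr
    exact hρR x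
  have hpP : ∀ x, (p x).toReal = P x := fun x ↦ by
    rw [hpρ, ENNReal.toReal_ofReal (zero_le_one.trans (hP x))]
  have hqP : ∀ x, (q x).toReal = P x / (1 - θ) := fun x ↦ by
    rw [hq, ENNReal.toReal_div, hpP, ENNReal.toReal_ofReal hτ0.le]
  obtain ⟨CM, hCM, hmax⟩ := hρ.exists_lintegral_maximalFn_rpow_le hρm hρR hq₀
  obtain ⟨CH, hCH0, hCH⟩ := exists_lintegral_heatKernel_le n
  obtain ⟨CB, hCB0, hCB⟩ := exists_hasHeatBound_of_isSymbolLimit n hσ hb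
  have hΓ := Real.Gamma_pos_of_pos ha
  have hea : 0 < σ + b - a := by linarith
  set cR := (Real.Gamma a)⁻¹ * (a⁻¹ + (σ + b - a)⁻¹) with hcR
  have hcR0 : 0 ≤ cR := by positivity
  set D := cR * (CH ^ (1 - θ) * CB ^ θ) with hD
  have hD0 : 0 ≤ D := by positivity
  refine ⟨(D + 1) * (1 + CM.toReal), by positivity, fun T U g r K hr hK hTK hU hg hgr ↦ ?_⟩
  -- replace `g` by a measurable function
  have hgm : StronglyMeasurable (hg.1.mk g) := hg.1.stronglyMeasurable_mk
  have hgae : g =ᵐ[volume] hg.1.mk g := hg.1.ae_eq_mk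
  set g' := hg.1.mk g with hg'
  have hg2 : Represents U g' := hg.congr_ae hgae
  set H : Rn n → ℝ≥0∞ := maximalFn (fun y ↦ ‖g' y / (r : ℂ)‖ₑ) with hHdef
  have hHm : Measurable H := measurable_maximalFn (hgm.measurable.div_const _).enorm
  have hHP : ∫⁻ x, H x ^ P x ≤ ENNReal.ofReal CM.toReal := by
    rw [ENNReal.ofReal_toReal hCM]
    refine hmax _ (hgm.measurable.div_const _).enorm (le_trans (le_of_eq ?_) hgr)
    refine lintegral_congr_ae ?_
    filter_upwards [hgae] with x hx
    rw [hpP, hx]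
  have hHPt : ∫⁻ x, H x ^ P x ≠ ⊤ := (hHP.trans_lt ENNReal.ofReal_lt_top).ne
  have hT : HasHeatBound (𝓕 T) K b := by
    have := hasHeatBound_of_besovNorm_le hK.le hTK
    rwa [mul_div_cancel_left₀ _ two_ne_zero] at this
  have hL := hCB _ _ K (isFracLaplacian_iff.1 hU) hT
  have hA := enorm_heatFlow_le_of_represents hg2 hgm.measurable hr hCH
  set d := D * (r ^ (1 - θ) * K ^ θ) with hd
  have hd0 : 0 ≤ d := by positivity
  have hγ : ∀ δ, 0 ≤ δ → ∀ x,
      ‖rieszPotential (𝓕 U) a δ x‖ₑ ≤ ENNReal.ofReal d * H x ^ (1 - θ) := by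
    intro δ hδ x
    refine (enorm_rieszPotential_le ha hae hL hA hδ x).trans (le_of_eq ?_)
    rw [← hθe, ENNReal.mul_rpow_of_nonneg _ _ hτ0.le,
      ENNReal.ofReal_rpow_of_nonneg (by positivity) hτ0.le,
      ENNReal.ofReal_rpow_of_nonneg (by positivity) hθ0.le, Real.mul_rpow hr.le hCH0,
      Real.mul_rpow hCB0 hK.le, ← hcR, mul_right_comm, ← ENNReal.ofReal_mul (by positivity),
      ← mul_assoc, ← ENNReal.ofReal_mul hcR0, hd, hD]
    congr 2
    ring
  have hlux : ∀ δ, 0 ≤ δ → luxNorm q (rieszPotential (𝓕 U) a δ) ≤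
      ENNReal.ofReal ((D + 1) * (1 + CM.toReal) * (r ^ (1 - θ) * K ^ θ)) := by
    intro δ hδ
    refine luxNorm_le_of_modular_le (by positivity) (modular_div_le_one hd0 hτ0 (by linarith) hP hqP
      (hγ δ hδ) ENNReal.toReal_nonneg hHP (by positivity) ?_)
    calc d * (1 + CM.toReal) = D * (1 + CM.toReal) * (r ^ (1 - θ) * K ^ θ) := by
          rw [hd]
          ring
      _ ≤ _ := by
          gcongr
          linarith
  have hfrac : ∀ δ, 0 ≤ δ → ∀ S : 𝓢'(Rn n, ℂ), (∀ χ, 𝓕 S χ = 𝓕 T (Ht δ χ)) →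
      ∃ U', IsFracLaplacian (2 * (σ - a)) S U' ∧ Represents U' (rieszPotential (𝓕 U) a δ) :=
    fun δ hδ S hS ↦ exists_isFracLaplacian_rieszPotential hσ ha haσ hb hδ hU hT hL
      ENNReal.ofReal_ne_top hHm hPm hP hHPt hA hS
  obtain ⟨U₀, hU₀, hU₀r⟩ := hfrac 0 le_rfl T (fun χ ↦ by rw [Ht_zero])
  have hnorm : sobolevNorm (2 * (σ - a)) q T ≤
      ENNReal.ofReal ((D + 1) * (1 + CM.toReal) * (r ^ (1 - θ) * K ^ θ)) :=
    (sobolevNorm_le_luxNorm hU₀ hU₀r).trans (hlux 0 le_rfl)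
  refine ⟨⟨hnorm.trans_lt ENNReal.ofReal_lt_top, fun δ' hδ' ↦ ?_⟩, hnorm⟩
  -- approximation by the heat flow `e^{δΔ} T`
  obtain ⟨η, hη0, hη⟩ : ∃ η : ℝ, 0 < η ∧ ENNReal.ofReal η < δ' := by
    obtain ⟨η, hη0, hη⟩ := ENNReal.lt_iff_exists_nnreal_btwn.1 hδ'
    exact ⟨η, by exact_mod_cast hη0, by simpa using hη⟩
  have hconv : Tendsto (fun δ : ℝ ↦ modular q (fun x ↦
      (rieszPotential (𝓕 U) a 0 x - rieszPotential (𝓕 U) a δ x) / (η : ℂ))) (𝓝[>] 0) (𝓝 0) := by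
    refine tendsto_modular_div (d := 2 * d) (H := H) hτ0 hP hPm hPR hqP
      (fun δ ↦ (measurable_rieszPotential _ _ _).sub (measurable_rieszPotential _ _ _))
      (eventually_nhdsWithin_of_forall fun δ hδ x ↦ ?_) hHPt ?_ hη0
    · calc _ ≤ ‖rieszPotential (𝓕 U) a 0 x‖ₑ + ‖rieszPotential (𝓕 U) a δ x‖ₑ := enorm_sub_le
        _ ≤ ENNReal.ofReal d * H x ^ (1 - θ) + ENNReal.ofReal d * H x ^ (1 - θ) :=
            add_le_add (hγ 0 le_rfl x) (hγ δ (le_of_lt hδ) x)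
        _ = _ := by
            rw [ENNReal.ofReal_mul zero_le_two, ENNReal.ofReal_ofNat]
            ring
    · filter_upwards [ae_lt_top (hHm.pow hPm) hHPt] with x hx
      have hHx : H x ≠ ⊤ := by
        intro h
        rw [h, ENNReal.top_rpow_of_pos (one_pos.trans_le (hP x))] at hx
        exact lt_irrefl _ hx
      have h1 := tendsto_rieszPotential ha hae hL hA (x := x)
        (ENNReal.mul_ne_top ENNReal.ofReal_ne_top hHx)
      simpa using h1.const_sub (rieszPotential (𝓕 U) a 0 x)
  obtain ⟨δ, hδmod, hδ⟩ := ((hconv.eventually (Iio_mem_nhds zero_lt_one)).and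
    (self_mem_nhdsWithin : Set.Ioi (0 : ℝ) ∈ 𝓝[>] 0)).exists
  have hδ0 : 0 < δ := hδ
  obtain ⟨U₁, hU₁, hU₁r⟩ := hfrac δ hδ0.le (heatDistribution δ T)
    (fourier_heatDistribution_apply δ T)
  refine ⟨heatDistribution δ T, isSmooth_heatDistribution hδ0 hT,
    ((sobolevNorm_le_luxNorm hU₁ hU₁r).trans (hlux δ hδ0.le)).trans_lt ENNReal.ofReal_lt_top, ?_⟩
  have hsub : IsFracLaplacian (2 * (σ - a)) (T - heatDistribution δ T) (U₀ - U₁) :=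
    isFracLaplacian_iff.2 fun χ ↦
      (isFracLaplacian_iff.1 hU₀ χ).sub (isFracLaplacian_iff.1 hU₁ χ)
  refine ((sobolevNorm_le_luxNorm hsub (hU₀r.sub hU₁r)).trans
    (luxNorm_le_of_modular_le hη0 ?_)).trans_lt hη
  exact le_of_lt hδmod

theorem le_mul_rpow_of_forall_gt {S c X : ℝ≥0∞} {κ : ℝ} (hc : c ≠ ⊤) (hX : X ≠ ⊤)
    (h : ∀ x, X < x → x ≠ ⊤ → S ≤ c * x ^ κ) : S ≤ c * X ^ κ := by
  have : (𝓝[>] X).NeBot := nhdsGT_neBot_of_exists_gt ⟨⊤, hX.lt_top⟩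
  have h1 : Tendsto (fun x : ℝ≥0∞ ↦ c * x ^ κ) (𝓝[>] X) (𝓝 (c * X ^ κ)) :=
    (ENNReal.Tendsto.const_mul (ENNReal.continuous_rpow_const.tendsto X)
      (.inr hc)).mono_left nhdsWithin_le_nhds
  refine ge_of_tendsto h1 ?_
  filter_upwards [self_mem_nhdsWithin, mem_nhdsWithin_of_mem_nhds (Iio_mem_nhds hX.lt_top)]
    with x hx hxt using h x hx (ne_of_lt hxt)

end Inequality

end VarSobolev

end

theorem theorem2 (n : ℕ) (p : VarSobolev.Rn n → ENNReal) (hp : VarSobolev.IsLogHolder p)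
    (hp_minus : 1 < VarSobolev.expMinus p) (hp_plus : VarSobolev.expPlus p < ⊤)
    (s : ℝ) (hs : 0 < s) (hsn : s < n / (VarSobolev.expPlus p).toReal)
    (β : ℝ) (hβ : 0 < β) (s₁ : ℝ) (hs₁ : 0 ≤ s₁) (hs₁s : s₁ < s)
    (θ : ℝ) (hθ : θ = (s - s₁) / (β + s))
    (q : VarSobolev.Rn n → ENNReal) (hq : ∀ x, q x = p x / ENNReal.ofReal (1 - θ)) :
    θ < 1 ∧
    ∃ C : NNReal, ∀ T : TemperedDistribution (VarSobolev.Rn n) ℂ,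
      VarSobolev.MemSobolev s p T → VarSobolev.MemBesov β T →
        VarSobolev.MemSobolev s₁ q T ∧
        VarSobolev.sobolevNorm s₁ q T ≤
          (C : ENNReal) * VarSobolev.sobolevNorm s p T ^ (1 - θ) *
            VarSobolev.besovNorm β T ^ θ := by
  have hθ1 : θ < 1 := by
    rw [hθ, div_lt_one (by positivity)]
    linarith
  have hθ0 : 0 < θ := by
    rw [hθ]
    exact div_pos (by linarith) (by positivity)
  -- the range `0 < s < n / p⁺` is empty for `n = 0`
  have hn : 0 < n := by
    rcases Nat.eq_zero_or_pos n with rfl | h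
    · simp only [Nat.cast_zero, zero_div] at hsn
      linarith
    · exact h
  obtain ⟨N, hN, hmain⟩ := VarSobolev.exists_sobolevNorm_le hn hp hp_minus hp_plus hβ hs₁ hs₁s hθ hq
  refine ⟨hθ1, N.toNNReal, fun T hT hTB ↦ ?_⟩
  have key : ∀ x y : ENNReal, VarSobolev.sobolevNorm s p T < x → VarSobolev.besovNorm β T < y →
      y ≠ ⊤ → VarSobolev.MemSobolev s₁ q T ∧
        VarSobolev.sobolevNorm s₁ q T ≤ (N.toNNReal : ENNReal) * x ^ (1 - θ) * y ^ θ := by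
    intro x y hx hy hyt
    simp only [VarSobolev.sobolevNorm, VarSobolev.luxNorm, iInf_lt_iff] at hx
    obtain ⟨g, ⟨U, hU, hg⟩, r, hr, hmod, hrx⟩ := hx
    have hy0 : 0 < y.toReal := ENNReal.toReal_pos (zero_le.trans_lt hy).ne' hyt
    have hyr : ENNReal.ofReal y.toReal = y := ENNReal.ofReal_toReal hyt
    obtain ⟨h1, h2⟩ := hmain T U g r y.toReal hr hy0 (hyr.symm ▸ hy.le) hU hg hmod
    refine ⟨h1, h2.trans ?_⟩
    rw [ENNReal.ofReal_mul hN, ENNReal.ofReal_mul (by positivity),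
      ← ENNReal.ofReal_rpow_of_pos hr, ← ENNReal.ofReal_rpow_of_pos hy0, hyr, ← mul_assoc]
    gcongr
    exact le_rfl
  obtain ⟨x₀, hx₀, -⟩ := exists_between hT.1
  obtain ⟨y₀, hy₀, hy₀t⟩ := exists_between hTB
  refine ⟨(key x₀ y₀ hx₀ hy₀ hy₀t.ne).1, ?_⟩
  refine VarSobolev.le_mul_rpow_of_forall_gt (ENNReal.mul_ne_top ENNReal.coe_ne_top
    (ENNReal.rpow_ne_top_of_nonneg (by linarith) hT.1.ne)) hTB.ne fun y hy hyt ↦ ?_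
  rw [mul_right_comm]
  refine VarSobolev.le_mul_rpow_of_forall_gt (ENNReal.mul_ne_top ENNReal.coe_ne_top
    (ENNReal.rpow_ne_top_of_nonneg hθ0.le hyt)) hT.1.ne fun x hx _ ↦ ?_
  rw [mul_right_comm]
  exact (key x y hx hy hyt).2
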